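/- **Setting.** Let $(\mathbb X,d)$ be a complete, locally compact metric space in which any two points have a midpoint. A set $A\subseteq\mathbb X$ is *strongly convex* if any two of its points are joined by a unique shortest path of $\mathbb X$, which lies in $A$ and depends continuously on the end points; assume that all sufficiently small open balls at any point are strongly convex. Write $B_r$, $D_r$, $S_r$ for open balls, closed balls and spheres, $D_a(A)=\{z: d(z,A)\le a\}$ for $A\subseteq\mathbb X$ (with $D_a(\emptyset)=\emptyset$), and let $\mathrm{conv}(z)$ be the supremum of all $\delta$ such that the balls $B_{\delta'}(z)$, $0<\delta'\le\delta$, are strongly convex; $\mathrm{conv}(P)=\inf_{z\in P}\mathrm{conv}(z)$. Homology has coefficients in $\mathbb Z$, $H=\bigoplus_\ell H_\ell$, and isomorphisms are meant in each degree $\ell$. Let $K\subseteq\mathbb X$ be a compact neighborhood retract with a tame homology stratification $\mathcal S$. That is, $\mathcal S$ is a locally finite partition of $K$ into locally closed sets (strata) such that $X\cap\overline Y\ne\emptyset$ implies $X\subseteq\overline Y$ for $X,Y\in\mathcal S$; each stratum is a finite dimensional homology manifold; for $x\in X\in\mathcal S$ and all sufficiently small $r>0$, the inclusion induced maps $H_\ell(K,K-B_r(x))\to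 H_\ell(K,K-\{x\})$ and $H_\ell(K,K-B_r(x))\to H_\ell(K,K-B_\rho(y))\to H_\ell(K,K-\{y\})$ are isomorphisms whenever $y\in B_r(x)\cap X$, $0<\rho<r-d(x,y)$; and all groups $H_\ell(K,K-\{x\})$ are finitely generated. Let $\varepsilon>0$ and let $P\subset\mathbb X$ be an $\varepsilon$-sample of $K$, i.e. a finite set with $d_H(K,P)<\varepsilon$. Put $t=0$ if $P\subseteq K$ and $t=1$ otherwise; $s=\sqrt2$ if $\mathbb X$ is a Euclidean space and $s=2$ otherwise; and let $c\in\{1,s\}$. Let $p\in P$, and let $x\in K$ be the closest point to $p$ if $P\subseteq K$, and any point of $K$ with $d(x,p)<\varepsilon$ otherwise. Let $\mathcal C_a(Q)$, for $Q\subseteq P$, be the Čech complex (the nerve of the balls $D_a(q)$, $q\in Q$), let $\mathcal R_a(Q)$ be the Vietoris-Rips complex (the simplices on $Q$ all of whose edges lie in $\mathcal C_a(Q)$), and put $$C(a,b)=H(\mathcal C_a(P),\mathcal C_a(P-B_b(p))),\qquad V(a,b)=H(\mathcal R_a(P),\mathcal R_a(P-B_b(p))).$$ **Strong seemliness.** Put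 $F(a,b)=H(D_a(K),D_a(K)-B_b(x))$ for $a>0$ or $b>0$ and $F(0,0)=H(K,K-\{x\})$. For $\epsilon\ge0$ let $A_x(\epsilon)$ be the set of triples $(R,r,\alpha)$ with $R\ge r>\alpha\ge\epsilon$ such that: for all $\rho\in(0,R]$, $D_\rho(x)$ is homeomorphic to a closed Euclidean ball (and, if $\mathbb X$ is a smooth Riemannian manifold and $\mathcal S$ is a Whitney stratification, $S_\rho(x)$ is a smooth submanifold transverse to all strata); for all $\rho\in(0,R]$ the inclusion induced maps $F(0,R)\to F(0,\rho)\to F(0,0)$ are isomorphisms; and, for the inclusion induced maps $i_*:F(0,R)\to F(\epsilon,R)$, $j_*:F(\epsilon,R)\to F(\alpha,r)$, the map $j_*\circ i_*:F(0,R)\to\operatorname{im}j_*$ is an isomorphism. Let $A_x(\epsilon|\alpha)=\{(R,r):(R,r,\alpha)\in A_x(\epsilon)\}$. $K$ is *strongly homologically seemly at $x$* if there are $\varepsilon_x>0$ and functions $\rho^l,\rho^u\ge0$ of $(\epsilon,\alpha)$, $0\le\epsilon\le\alpha\le\varepsilon_x$, such that 1. $A_x(\epsilon|\alpha)\neq\emptyset$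 for all $0\le\epsilon\le\alpha\le\varepsilon_x$, and $\sup_{\alpha\in[\epsilon,\varepsilon_x]}d_H(A_x(0|\alpha),A_x(\epsilon|\alpha))\to0$ as $\epsilon\to0$; 2. $\rho^l$ is non-decreasing and $\rho^u$ is non-increasing in $\epsilon$ and in $\alpha$, and $\rho^l<\rho^u$; 3. for fixed $\alpha$, as $\epsilon\to0$, $\rho^l(\epsilon,\alpha)$ tends to the infimum of the numbers $r$ and $\rho^u(\epsilon,\alpha)$ to the supremum of the numbers $R$ over all $(R,r)\in\bigcap_{\alpha'\in[0,\alpha]}A_x(0|\alpha')$; 4. $(\rho,\rho,\alpha)\in A_x(\epsilon)$ for all $\epsilon>0$ and $\rho\in[\rho^l(\epsilon,\alpha),\rho^u(\epsilon,\alpha)]$. Put $\bar r_x(\beta)=\rho^l(\beta,\beta)$, $\bar R_x(\beta)=\rho^u(\beta,\beta)$ for $\beta\in[0,\varepsilon_x]$ (the bounds that are valid for all first arguments $\epsilon\le\beta$). **Corollary.** Suppose that $K$ is strongly homologically seemly at $x$ and that $c(1+c+t)\varepsilon<\mathrm{conv}(P)$. Assume that $\bar r_x(\beta)\le M\beta^m$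 for all $\beta\in[0,\varepsilon_x]$, where $M,m>0$, and put $M_0=\bar R_x(\varepsilon_x)$. If $(c^2+(t+1)c+t)\,\varepsilon\le\varepsilon_x$ and $$M(c^2+(t+1)c+t)^m\varepsilon^m+(c^2+(3+t)c+5t+2)\,\varepsilon<M_0,$$ then, with $\beta=(c^2+(t+1)c+t)\varepsilon$ and $\gamma=(c^2+(t+3)c+5t+2)\varepsilon$, we have $\bar R_x(\beta)-\bar r_x(\beta)>\gamma$, and for all $$R'\in\big(M(c^2+(t+1)c+t)^m\varepsilon^m+(c^2+(3+t)c+5t+2)\varepsilon,\;M_0\big),$$ $$r'\in\big(M(c^2+(t+1)c+t)^m\varepsilon^m,\;R'-(c^2+(3+t)c+5t+2)\varepsilon\big),$$ and $R=R'-(1+t)\varepsilon$, $r=r'+\beta$, one has $$\operatorname{im}\big(C(\varepsilon,R)\to C((1+c+t)\varepsilon,r)\big)\cong H(K,K-\{x\})\quad\text{if }c=1,$$ $$\operatorname{im}\big(V(\varepsilon,R)\to V((1+c+t)\varepsilon,r)\big)\cong H(K,K-\{x\})\quad\text{if }c=s.$$ -/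

import Mathlib

open Set Filter Topology Metric
open scoped ENNReal Manifold ContDiff Bundle

noncomputable section

namespace LocalHomology

universe u v

/-! ## Relative homology with integer coefficients -/

section Chains

variable {S : ℕ → Type u} (face : ∀ n, Fin (n + 2) → S (n + 1) → S n)

/-- The boundary map `∂ σ = ∑ i, (-1)^i (face i of σ)` on integral chains; it is zero in degree 0
(there `n - 1 = 0`). -/
def boundary : ∀ n : ℕ, (S n →₀ ℤ) →ₗ[ℤ] (S (n - 1) →₀ ℤ)
  | 0 => 0
  | n + 1 => ∑ i : Fin (n + 2), ((-1 : ℤ) ^ (i : ℕ)) • Finsupp.lmapDomain ℤ ℤ (face n i)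

/-- Chains supported in `A` whose boundary is supported in `B`. -/
def relCycles (A B : ∀ n, Set (S n)) (n : ℕ) : Submodule ℤ (S n →₀ ℤ) :=
  Finsupp.supported ℤ ℤ (A n) ⊓ (Finsupp.supported ℤ ℤ (B (n - 1))).comap (boundary face n)

/-- Sums of a boundary of a chain supported in `A` and of a chain supported in `B`. -/
def relBoundaries (A B : ∀ n, Set (S n)) (n : ℕ) : Submodule ℤ (S n →₀ ℤ) :=
  (Finsupp.supported ℤ ℤ (A (n + 1))).map (boundary face (n + 1)) ⊔ Finsupp.supported ℤ ℤ (B n)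

/-- The `n`-th relative homology group of the pair `(A, B)`. -/
abbrev RelHomology (A B : ∀ n, Set (S n)) (n : ℕ) : Type u :=
  relCycles face A B n ⧸ (relBoundaries face A B n).submoduleOf (relCycles face A B n)

variable {face}

theorem relCycles_mono {A B A' B' : ∀ n, Set (S n)} (hA : ∀ n, A n ⊆ A' n)
    (hB : ∀ n, B n ⊆ B' n) (n : ℕ) : relCycles face A B n ≤ relCycles face A' B' n :=
  inf_le_inf (Finsupp.supported_mono (hA n))
    (Submodule.comap_mono (Finsupp.supported_mono (hB (n - 1))))

theorem relBoundaries_mono {A B A' B' : ∀ n, Set (S n)} (hA : ∀ n, A n ⊆ A' n)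
    (hB : ∀ n, B n ⊆ B' n) (n : ℕ) : relBoundaries face A B n ≤ relBoundaries face A' B' n :=
  sup_le_sup (Submodule.map_mono (Finsupp.supported_mono (hA (n + 1))))
    (Finsupp.supported_mono (hB n))

/-- The map on relative homology induced by an inclusion of pairs `(A, B) ⊆ (A', B')`. -/
def relMap {A B A' B' : ∀ n, Set (S n)} (hA : ∀ n, A n ⊆ A' n) (hB : ∀ n, B n ⊆ B' n) (n : ℕ) :
    RelHomology face A B n →ₗ[ℤ] RelHomology face A' B' n :=
  Submodule.mapQ _ _ (Submodule.inclusion (relCycles_mono hA hB n))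
    (fun _ hz => relBoundaries_mono hA hB n hz)

end Chains

section Singular

variable {X : Type u} [TopologicalSpace X]

/-- Singular `n`-simplices of `X`. -/
abbrev SingularSimplex (X : Type u) [TopologicalSpace X] (n : ℕ) : Type u :=
  C(stdSimplex ℝ (Fin (n + 1)), X)

/-- The `i`-th face of a singular simplex. -/
def singularFace (n : ℕ) (i : Fin (n + 2)) (σ : SingularSimplex X (n + 1)) : SingularSimplex X n :=
  σ.comp ⟨stdSimplex.map (Fin.succAbove i), stdSimplex.continuous_map _⟩

/-- The singular simplices of a subset `A`, seen as the singular simplices of the ambient space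
with image in `A`. -/
def singularIn (A : Set X) (n : ℕ) : Set (SingularSimplex X n) := {σ | ∀ a, σ a ∈ A}

theorem singularIn_mono {A A' : Set X} (h : A ⊆ A') (n : ℕ) : singularIn A n ⊆ singularIn A' n :=
  fun _ hσ a => h (hσ a)

/-- Relative singular homology `H_ℓ(A, B)` of subsets `B ⊆ A` of `X`. -/
abbrev SingularHomology (A B : Set X) (ℓ : ℕ) : Type u :=
  RelHomology singularFace (singularIn A) (singularIn B) ℓ

/-- The inclusion induced homomorphism `H_ℓ(A, B) → H_ℓ(A', B')`. -/
def singularMap {A B A' B' : Set X} (hA : A ⊆ A') (hB : B ⊆ B') (ℓ : ℕ) :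
    SingularHomology A B ℓ →ₗ[ℤ] SingularHomology A' B' ℓ :=
  relMap (singularIn_mono hA) (singularIn_mono hB) ℓ

/-- `(A, B) ⊆ (A', B')` and the inclusion induces isomorphisms on homology in all degrees. -/
def InclusionIso (A B A' B' : Set X) : Prop :=
  ∃ (hA : A ⊆ A') (hB : B ⊆ B'), ∀ ℓ, Function.Bijective (singularMap hA hB ℓ)

end Singular

section Simplicial

variable {V : Type u}

/-- The `n`-simplices of the ordered chain complex of an abstract simplicial complex `L` on
vertices in `V`: tuples of vertices (repetitions allowed) that all lie in one simplex of `L`. -/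
def orderedIn (L : PreAbstractSimplicialComplex V) (n : ℕ) : Set (Fin (n + 1) → V) :=
  {v | ∃ σ ∈ L.faces, ∀ i, v i ∈ σ}

/-- The `i`-th face of an ordered simplex: drop the `i`-th vertex. -/
def orderedFace (n : ℕ) (i : Fin (n + 2)) (v : Fin (n + 2) → V) : Fin (n + 1) → V :=
  v ∘ Fin.succAbove i

theorem orderedIn_mono {L L' : PreAbstractSimplicialComplex V} (h : L.faces ⊆ L'.faces) (n : ℕ) :
    orderedIn L n ⊆ orderedIn L' n :=
  fun _ ⟨σ, hσ, hv⟩ => ⟨σ, h hσ, hv⟩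

/-- Relative simplicial homology `H_ℓ(L, N)` of a complex `L` and a subcomplex `N`. -/
abbrev SimplicialHomology (L N : PreAbstractSimplicialComplex V) (ℓ : ℕ) : Type u :=
  RelHomology (S := fun n => Fin (n + 1) → V) orderedFace (orderedIn L) (orderedIn N) ℓ

/-- The inclusion induced homomorphism `H_ℓ(L, N) → H_ℓ(L', N')`. -/
def simplicialMap {L N L' N' : PreAbstractSimplicialComplex V} (hL : L.faces ⊆ L'.faces)
    (hN : N.faces ⊆ N'.faces) (ℓ : ℕ) :
    SimplicialHomology L N ℓ →ₗ[ℤ] SimplicialHomology L' N' ℓ :=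
  relMap (orderedIn_mono hL) (orderedIn_mono hN) ℓ

end Simplicial

/-! ## Čech and Vietoris-Rips complexes -/

section Complexes

variable {X : Type u} [MetricSpace X]

/-- The Čech complex over `Q` at scale `α`: the nerve of the closed balls of radius `α`. -/
def cech (Q : Set X) (α : ℝ) : PreAbstractSimplicialComplex X where
  faces := {σ | σ.Nonempty ∧ (∀ v ∈ σ, v ∈ Q) ∧ ∃ y, ∀ v ∈ σ, y ∈ closedBall v α}
  isRelLowerSet_faces := by
    rintro σ ⟨h0, hQ, y, hy⟩
    exact ⟨h0, fun τ hτ hne => ⟨hne, fun v hv => hQ v (hτ hv), y, fun v hv => hy v (hτ hv)⟩⟩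

/-- The Vietoris-Rips complex over `Q` at scale `α`: simplices all of whose edges lie in the
Čech complex. -/
def rips (Q : Set X) (α : ℝ) : PreAbstractSimplicialComplex X where
  faces := {σ | σ.Nonempty ∧ (∀ v ∈ σ, v ∈ Q) ∧
    ∀ v ∈ σ, ∀ w ∈ σ, ∃ y, y ∈ closedBall v α ∧ y ∈ closedBall w α}
  isRelLowerSet_faces := by
    rintro σ ⟨h0, hQ, hy⟩
    exact ⟨h0, fun τ hτ hne => ⟨hne, fun v hv => hQ v (hτ hv),
      fun v hv w hw => hy v (hτ hv) w (hτ hw)⟩⟩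

theorem cech_mono {Q Q' : Set X} (hQ : Q ⊆ Q') {α α' : ℝ} (h : α ≤ α') :
    (cech Q α).faces ⊆ (cech Q' α').faces := by
  rintro σ ⟨h0, h1, y, hy⟩
  exact ⟨h0, fun v hv => hQ (h1 v hv), y, fun v hv => closedBall_subset_closedBall h (hy v hv)⟩

theorem rips_mono {Q Q' : Set X} (hQ : Q ⊆ Q') {α α' : ℝ} (h : α ≤ α') :
    (rips Q α).faces ⊆ (rips Q' α').faces := by
  rintro σ ⟨h0, h1, hy⟩
  refine ⟨h0, fun v hv => hQ (h1 v hv), fun v hv w hw => ?_⟩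
  obtain ⟨y, hy1, hy2⟩ := hy v hv w hw
  exact ⟨y, closedBall_subset_closedBall h hy1, closedBall_subset_closedBall h hy2⟩

/-- `H_ℓ(C_a(P), C_a(P - B_b(p)))`. -/
abbrev CechHomology (P : Set X) (p : X) (a b : ℝ) (ℓ : ℕ) : Type u :=
  SimplicialHomology (cech P a) (cech (P \ ball p b) a) ℓ

/-- `H_ℓ(R_a(P), R_a(P - B_b(p)))`. -/
abbrev RipsHomology (P : Set X) (p : X) (a b : ℝ) (ℓ : ℕ) : Type u :=
  SimplicialHomology (rips P a) (rips (P \ ball p b) a) ℓ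

/-- The map induced by inclusion when the global scale grows and the local scale shrinks. -/
def cechMap (P : Set X) (p : X) {a b a' b' : ℝ} (ha : a ≤ a') (hb : b' ≤ b) (ℓ : ℕ) :
    CechHomology P p a b ℓ →ₗ[ℤ] CechHomology P p a' b' ℓ :=
  simplicialMap (cech_mono subset_rfl ha)
    (cech_mono (sdiff_subset_sdiff_right (ball_subset_ball hb)) ha) ℓ

/-- The map induced by inclusion when the global scale grows and the local scale shrinks. -/
def ripsMap (P : Set X) (p : X) {a b a' b' : ℝ} (ha : a ≤ a') (hb : b' ≤ b) (ℓ : ℕ) :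
    RipsHomology P p a b ℓ →ₗ[ℤ] RipsHomology P p a' b' ℓ :=
  simplicialMap (rips_mono subset_rfl ha)
    (rips_mono (sdiff_subset_sdiff_right (ball_subset_ball hb)) ha) ℓ

end Complexes

/-! ## Metric notions -/

section MetricNotions

variable {X : Type u} [MetricSpace X]

/-- Any two points have a midpoint. -/
def HasMidpoints (X : Type u) [MetricSpace X] : Prop :=
  ∀ x y : X, ∃ z, dist x y = 2 * dist x z ∧ dist x y = 2 * dist y z

/-- `γ` is a shortest path from `x` to `y`, parametrized proportionally to arc length. -/
def IsShortestPath (γ : C(unitInterval, X)) (x y : X) : Prop :=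
  γ 0 = x ∧ γ 1 = y ∧ ∀ a b : unitInterval, dist (γ a) (γ b) = |(a : ℝ) - b| * dist x y

/-- Any two points of `A` are joined by a unique shortest path, it lies in `A`, and it depends
continuously on the end points. -/
def StronglyConvex (A : Set X) : Prop :=
  ∃ Γ : A × A → C(unitInterval, X), Continuous Γ ∧ ∀ q : A × A,
    IsShortestPath (Γ q) q.1 q.2 ∧ (∀ a, Γ q a ∈ A) ∧
      ∀ γ : C(unitInterval, X), IsShortestPath γ q.1 q.2 → γ = Γ q

/-- All sufficiently small open balls at any point are strongly convex. -/
def LocallyStronglyConvex (X : Type u) [MetricSpace X] : Prop :=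
  ∀ x : X, ∃ δ₀ > 0, ∀ δ : ℝ, 0 < δ → δ < δ₀ → StronglyConvex (ball x δ)

/-- The convexity radius at `x`: the supremum of all `δ` such that the open balls at `x` of
radius at most `δ` are strongly convex. -/
def convRadius (x : X) : ℝ≥0∞ :=
  sSup {δ | ∀ δ' : ℝ, 0 < δ' → ENNReal.ofReal δ' ≤ δ → StronglyConvex (ball x δ')}

/-- The convexity radius of a set. -/
def convRadiusSet (A : Set X) : ℝ≥0∞ := ⨅ x ∈ A, convRadius x

/-- `P` is a (possibly noisy) `ε`-sample of `K`. -/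
def IsSample (K P : Set X) (ε : ℝ) : Prop :=
  P.Finite ∧ hausdorffEDist K P < ENNReal.ofReal ε

/-- How `x ∈ K` is chosen for `p ∈ P`: the closest point to `p` if the sample is noise-free,
any point with `d(x, p) < ε` otherwise. -/
def IsBasePoint (K P : Set X) (ε : ℝ) (p x : X) : Prop :=
  x ∈ K ∧ (P ⊆ K → ∀ z ∈ K, dist p x ≤ dist p z) ∧ (¬ P ⊆ K → dist x p < ε)

open Classical in
/-- The constant `t`: `0` if the sample is noise-free, `1` otherwise. -/
def noiseConst (K P : Set X) : ℝ := if P ⊆ K then 0 else 1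

open Classical in
/-- The constant `s`: `√2` if the space is a Euclidean space, `2` otherwise. -/
def ripsConst (X : Type u) [MetricSpace X] : ℝ :=
  if ∃ n : ℕ, Nonempty (X ≃ᵢ EuclideanSpace ℝ (Fin n)) then √2 else 2

/-- `K` is a neighborhood retract in `X`. -/
def IsNeighborhoodRetract (K : Set X) : Prop :=
  ∃ U : Set X, IsOpen U ∧ K ⊆ U ∧ ∃ q : X → X, ContinuousOn q U ∧ MapsTo q U K ∧ ∀ x ∈ K, q x = x

/-- `A` is homeomorphic to a closed Euclidean ball. -/
def IsTopologicalBall (A : Set X) : Prop :=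
  ∃ n : ℕ, Nonempty (A ≃ₜ closedBall (0 : EuclideanSpace ℝ (Fin n)) 1)

end MetricNotions

/-! ## Stratifications -/

section Strata

variable {X : Type u} [MetricSpace X]

/-- Stratifications of `K`. -/
structure IsStratification (K : Set X) (𝒮 : Set (Set X)) : Prop where
  locallyFinite : ∀ x ∈ K, ∃ U ∈ 𝓝 x, {S ∈ 𝒮 | (S ∩ U).Nonempty}.Finite
  disjoint : 𝒮.PairwiseDisjoint id
  locallyClosed : ∀ S ∈ 𝒮, IsLocallyClosed S
  cover : K = ⋃₀ 𝒮
  frontier : ∀ S ∈ 𝒮, ∀ T ∈ 𝒮, (S ∩ closure T).Nonempty → S ⊆ closure T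

/-- Finite dimensional homology manifolds. -/
def IsHomologyManifold (S : Set X) : Prop :=
  ∃ d : ℕ, ∀ x ∈ S, Nonempty (SingularHomology S (S \ {x}) d ≃ₗ[ℤ] ℤ) ∧
    ∀ ℓ, ℓ ≠ d → Subsingleton (SingularHomology S (S \ {x}) ℓ)

/-- Tame homology stratifications of `K`. -/
structure IsTameHomologyStratification (K : Set X) (𝒮 : Set (Set X)) : Prop
    extends IsStratification K 𝒮 where
  manifold : ∀ S ∈ 𝒮, IsHomologyManifold S
  locallyConstant : ∀ S ∈ 𝒮, ∀ x ∈ S, ∃ r₀ > 0, ∀ r : ℝ, 0 < r → r < r₀ →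
    InclusionIso K (K \ ball x r) K (K \ {x}) ∧
    ∀ y ∈ ball x r ∩ S, ∀ ρ : ℝ, 0 < ρ → ρ < r - dist x y →
      InclusionIso K (K \ ball x r) K (K \ ball y ρ) ∧
      InclusionIso K (K \ ball y ρ) K (K \ {y})
  finitelyGenerated : ∀ x ∈ K, ∀ ℓ, Module.Finite ℤ (SingularHomology K (K \ {x}) ℓ)

section Whitney

variable {n : ℕ} [ChartedSpace (EuclideanSpace ℝ (Fin n)) X]

/-- Smooth (embedded) submanifolds, through slice charts. -/
def IsSmoothSubmanifold (n : ℕ) [ChartedSpace (EuclideanSpace ℝ (Fin n)) X] (M : Set X) : Prop :=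
  ∀ y ∈ M, ∃ φ ∈ IsManifold.maximalAtlas (𝓡 n) ∞ X, y ∈ φ.source ∧
    ∃ L : Submodule ℝ (EuclideanSpace ℝ (Fin n)),
      φ '' (M ∩ φ.source) = φ.target ∩ {z | z - φ y ∈ L}

/-- The tangent space of a submanifold `M` at `z`, in the coordinates of a chart `ψ` around `z`:
the velocities at `z` of smooth curves in `M`. -/
def coordTangent (ψ : OpenPartialHomeomorph X (EuclideanSpace ℝ (Fin n))) (M : Set X) (z : X) :
    Submodule ℝ (EuclideanSpace ℝ (Fin n)) :=
  Submodule.span ℝ {v | ∃ γ : ℝ → X, γ 0 = z ∧ ContMDiffAt 𝓘(ℝ, ℝ) (𝓡 n) ∞ γ 0 ∧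
    (∀ᶠ a in 𝓝 0, γ a ∈ M) ∧ HasDerivAt (fun a => ψ (γ a)) v 0}

/-- Convergence in the Grassmannian, through orthogonal projections. -/
def SubspaceTendsto (T : ℕ → Submodule ℝ (EuclideanSpace ℝ (Fin n)))
    (τ : Submodule ℝ (EuclideanSpace ℝ (Fin n))) : Prop :=
  Tendsto (fun i => (T i).starProjection) atTop (𝓝 τ.starProjection)

/-- Whitney stratifications: smooth strata satisfying conditions (a) and (b). -/
def IsWhitney (n : ℕ) [ChartedSpace (EuclideanSpace ℝ (Fin n)) X] (𝒮 : Set (Set X)) : Prop :=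
  (∀ S ∈ 𝒮, IsSmoothSubmanifold n S) ∧
  ∀ T ∈ 𝒮, ∀ S ∈ 𝒮, T ⊆ closure S → ∀ y ∈ T, ∀ a b : ℕ → X,
    (∀ i, a i ∈ S) → (∀ i, b i ∈ T) → (∀ i, a i ≠ b i) →
    Tendsto a atTop (𝓝 y) → Tendsto b atTop (𝓝 y) →
    ∀ ψ ∈ IsManifold.maximalAtlas (𝓡 n) ∞ X, y ∈ ψ.source →
    ∀ τ l : Submodule ℝ (EuclideanSpace ℝ (Fin n)),
      SubspaceTendsto (fun i => coordTangent ψ S (a i)) τ →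
      SubspaceTendsto (fun i => Submodule.span ℝ {ψ (a i) - ψ (b i)}) l →
      coordTangent ψ T y ≤ τ ∧ l ≤ τ

/-- `M` and `N` are smooth submanifolds with `T_y M + T_y N = T_y X` at all common points `y`. -/
def IsTransverse (n : ℕ) [ChartedSpace (EuclideanSpace ℝ (Fin n)) X] (M N : Set X) : Prop :=
  IsSmoothSubmanifold n M ∧ IsSmoothSubmanifold n N ∧ ∀ y ∈ M ∩ N,
    coordTangent (chartAt (EuclideanSpace ℝ (Fin n)) y) M y ⊔
      coordTangent (chartAt (EuclideanSpace ℝ (Fin n)) y) N y = ⊤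

end Whitney

/-- If `X` is a smooth Riemannian manifold (with its given distance) in which `𝒮` is a Whitney
stratification, then the sphere `S_ρ(x)` is transverse to all the strata. No condition
otherwise. (The smooth structure is determined by the distance.) -/
def SphereTransverse (𝒮 : Set (Set X)) (x : X) (ρ : ℝ) : Prop :=
  ∀ (n : ℕ) (_ : ChartedSpace (EuclideanSpace ℝ (Fin n)) X) (_ : IsManifold (𝓡 n) ∞ X)
    (_ : Bundle.RiemannianBundle (fun y : X => TangentSpace (𝓡 n) y))
    (_ : IsContMDiffRiemannianBundle (𝓡 n) ∞ (EuclideanSpace ℝ (Fin n))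
      (fun y : X => TangentSpace (𝓡 n) y))
    (_ : IsRiemannianManifold (𝓡 n) X),
    IsWhitney n 𝒮 → ∀ S ∈ 𝒮, IsTransverse n (sphere x ρ) S

end Strata

/-! ## Homological seemliness at a point -/

section Seemliness

variable {X : Type u} [MetricSpace X]

theorem diff_ball_mono {A A' : Set X} (hA : A ⊆ A') (x : X) {R r : ℝ} (h : r ≤ R) :
    A \ ball x R ⊆ A' \ ball x r :=
  sdiff_subset_sdiff hA (ball_subset_ball h)

/-- The group `F(a, b) = H_ℓ(D_a(K), D_a(K) - B_b(x))`. Here `cthickening a K` is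
`{z | d(z, K) ≤ a}`. -/
abbrev F (K : Set X) (x : X) (a b : ℝ) (ℓ : ℕ) : Type u :=
  SingularHomology (cthickening a K) (cthickening a K \ ball x b) ℓ

/-- The inclusion induced map `F(a, b) → F(a', b')`. -/
def mapF (K : Set X) (x : X) {a b a' b' : ℝ} (ha : a ≤ a') (hb : b' ≤ b) (ℓ : ℕ) :
    F K x a b ℓ →ₗ[ℤ] F K x a' b' ℓ :=
  singularMap (cthickening_mono ha K) (diff_ball_mono (cthickening_mono ha K) x hb) ℓ

/-- `(R, r, α) ∈ A_x(ε)`. -/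
structure IsAdmissible (K : Set X) (𝒮 : Set (Set X)) (x : X) (ε R r α : ℝ) : Prop where
  nonneg : 0 ≤ ε
  le_alpha : ε ≤ α
  alpha_lt : α < r
  le_R : r ≤ R
  isBall : ∀ ρ ∈ Ioc 0 R, IsTopologicalBall (closedBall x ρ)
  transverse : ∀ ρ ∈ Ioc 0 R, SphereTransverse 𝒮 x ρ
  /-- `F(0, R) → F(0, ρ) → F(0, 0) = H(K, K - {x})` are isomorphisms. -/
  localIso : ∀ ρ ∈ Ioc 0 R,
    InclusionIso (cthickening 0 K) (cthickening 0 K \ ball x R)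
      (cthickening 0 K) (cthickening 0 K \ ball x ρ) ∧
    InclusionIso (cthickening 0 K) (cthickening 0 K \ ball x ρ) K (K \ {x})
  /-- With `i : F(0, R) → F(ε, R)` and `j : F(ε, R) → F(α, r)`, the composite `j ∘ i` is an
  isomorphism onto the image of `j`. -/
  injective : ∀ ℓ, Function.Injective (mapF K x le_alpha le_R ℓ ∘ₗ mapF K x nonneg (le_refl R) ℓ)
  range_eq : ∀ ℓ, LinearMap.range (mapF K x le_alpha le_R ℓ ∘ₗ mapF K x nonneg (le_refl R) ℓ) =
    LinearMap.range (mapF K x le_alpha le_R ℓ)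

/-- The `α`-section `A_x(ε | α = α')`, a set of pairs `(R, r)`. -/
def alphaSection (K : Set X) (𝒮 : Set (Set X)) (x : X) (ε α' : ℝ) : Set (ℝ × ℝ) :=
  {q | IsAdmissible K 𝒮 x ε q.1 q.2 α'}

/-- `A_x([0, ε] | α ≤ β)`. -/
def slabSection (K : Set X) (𝒮 : Set (Set X)) (x : X) (αl : ℝ → ℝ) (ε β : ℝ) : Set (ℝ × ℝ) :=
  ⋂ ε' ∈ Icc 0 ε, ⋂ α' ∈ Icc (αl ε') β, alphaSection K 𝒮 x ε' α'

/-- The supremum of the first coordinates of `A_x([0, ε] | α ≤ β)`. -/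
def supR (K : Set X) (𝒮 : Set (Set X)) (x : X) (αl : ℝ → ℝ) (ε β : ℝ) : EReal :=
  ⨆ q ∈ slabSection K 𝒮 x αl ε β, (q.1 : EReal)

/-- The infimum of the second coordinates of `A_x([0, ε] | α ≤ β)`. -/
def infr (K : Set X) (𝒮 : Set (Set X)) (x : X) (αl : ℝ → ℝ) (ε β : ℝ) : EReal :=
  ⨅ q ∈ slabSection K 𝒮 x αl ε β, (q.2 : EReal)

/-- `K` is weakly homologically seemly at `x`, as witnessed by `εx`, `αl`, `αu` (only the values
of `αl`, `αu` on `[0, εx]` matter). -/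
structure IsWeaklySeemly (K : Set X) (𝒮 : Set (Set X)) (x : X) (εx : ℝ) (αl αu : ℝ → ℝ) :
    Prop where
  pos : 0 < εx
  αl_nonneg : ∀ ε ∈ Icc 0 εx, 0 ≤ αl ε
  αu_nonneg : ∀ ε ∈ Icc 0 εx, 0 ≤ αu ε
  αl_mono : MonotoneOn αl (Icc 0 εx)
  αu_anti : AntitoneOn αu (Icc 0 εx)
  αl_zero : αl 0 = 0
  αl_tendsto : Tendsto αl (𝓝[>] 0) (𝓝 0)
  αu_tendsto : Tendsto αu (𝓝[>] 0) (𝓝 (αu 0))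
  nonempty : ∀ ε ∈ Icc 0 εx, ∀ α' ∈ Icc (αl ε) (αu ε), (alphaSection K 𝒮 x ε α').Nonempty
  hausdorff : Tendsto (fun ε => ⨆ α' ∈ Icc (αl ε) (αu ε),
    hausdorffEDist (alphaSection K 𝒮 x 0 α') (alphaSection K 𝒮 x ε α')) (𝓝[>] 0) (𝓝 0)

/-- The set of pairs `(ε, α)` with `ε ∈ [0, εx]` and `α ∈ [αl(ε), αu(ε)]`. -/
def scaleDomain (εx : ℝ) (αl αu : ℝ → ℝ) : Set (ℝ × ℝ) :=
  {q | q.1 ∈ Icc 0 εx ∧ q.2 ∈ Icc (αl q.1) (αu q.1)}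

/-- `K` is moderately homologically seemly at `x`, as witnessed by `εx`, `αl`, `αu` and the
functions `ρl(ε, α)`, `ρu(ε, α)` (only their values on `scaleDomain εx αl αu` matter). -/
structure IsModeratelySeemly (K : Set X) (𝒮 : Set (Set X)) (x : X) (εx : ℝ) (αl αu : ℝ → ℝ)
    (ρl ρu : ℝ → ℝ → ℝ) : Prop extends IsWeaklySeemly K 𝒮 x εx αl αu where
  ρl_nonneg : ∀ q ∈ scaleDomain εx αl αu, 0 ≤ ρl q.1 q.2
  ρu_nonneg : ∀ q ∈ scaleDomain εx αl αu, 0 ≤ ρu q.1 q.2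
  ρu_anti : AntitoneOn (fun q : ℝ × ℝ => ρu q.1 q.2) (scaleDomain εx αl αu)
  ρl_mono : MonotoneOn (fun q : ℝ × ℝ => ρl q.1 q.2) (scaleDomain εx αl αu)
  lt : ∀ q ∈ scaleDomain εx αl αu, ρl q.1 q.2 < ρu q.1 q.2
  ρl_tendsto : ∀ α, Tendsto (fun ε => (ρl ε α : EReal))
    (𝓝[{ε | 0 < ε ∧ (ε, α) ∈ scaleDomain εx αl αu}] 0) (𝓝 (infr K 𝒮 x αl 0 α))
  ρu_tendsto : ∀ α, Tendsto (fun ε => (ρu ε α : EReal))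
    (𝓝[{ε | 0 < ε ∧ (ε, α) ∈ scaleDomain εx αl αu}] 0) (𝓝 (supR K 𝒮 x αl 0 α))
  admissible : ∀ q ∈ scaleDomain εx αl αu, 0 < q.1 → ∀ ρ ∈ Icc (ρl q.1 q.2) (ρu q.1 q.2),
    IsAdmissible K 𝒮 x q.1 ρ ρ q.2

/-- `K` is strongly homologically seemly at `x`: moderately seemly with `αu(ε) = εx` and
`αl(ε) = ε`. -/
structure IsStronglySeemly (K : Set X) (𝒮 : Set (Set X)) (x : X) (εx : ℝ) (αl αu : ℝ → ℝ)
    (ρl ρu : ℝ → ℝ → ℝ) : Prop extends IsModeratelySeemly K 𝒮 x εx αl αu ρl ρu where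
  αu_eq : ∀ ε ∈ Icc 0 εx, αu ε = εx
  αl_eq : ∀ ε ∈ Icc 0 εx, αl ε = ε

/-- The one-variable bounds `r̄_x(β)`, `R̄_x(β)` of a strongly seemly set: the value at `(β, β)` of
`ρl`, `ρu`. By monotonicity it is the largest value of `ρl(ε, β)` (the smallest value of
`ρu(ε, β)`) over `ε ∈ [0, β]`, and the common value if there is no dependence on `ε`. -/
def diagBound (ρ : ℝ → ℝ → ℝ) (β : ℝ) : ℝ := ρ β β

end Seemliness

end LocalHomology

end

noncomputable section

namespace LocalHomology

universe u v w

/-! ### Chains supported in a set -/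

/-! Thickenings of `K` are interleaved with complexes over the sample. Let `e = (c + t) ε`, let `b`
be a suitable radius between `R'` and `r'`, and let `V` stand for the Čech or the Rips family. There
are maps F(0, R') → V(ε, R) → F(e, b) → V((1 + c + t) ε, r) → F(β, r'). The maps from `F` to `V`
send a small singular simplex to sample points near its vertices; the maps from `V` to `F` realize a
simplex inside the balls around its vertices. Up to chain homotopy, two consecutive maps compose to
an inclusion. Seemliness makes F(0, R') → F(e, b) and F(0, R') → F(β, r') isomorphisms, so F(e, b) →
F(β, r') is injective. Hence the second arrow is surjective and the third is injective, and the
image of the middle map V → V is F(e, b), which is the local homology of `K` at `x`. The constant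
`γ` is exactly the total loss of radius from `R'` to `r'`.

No nerve theorem is needed: the maps and homotopies come from acyclic carriers
(`exists_carried_chainMap`, `exists_carried_homotopy`). Balls of radius below the convexity radius
are geodesically closed, so finitely many of them with a common point have a union that contracts to
this point along geodesics. The delicate composite is V → F → V: the tuples near a union of balls
need not form an acyclic family. The realization in `exists_cech_realization` therefore passes
through the barycentric subdivision; for a flag of faces, a vertex of the smallest face is the apex
of a cone over all nearby tuples.

Since the Hausdorff distance is strictly less than `ε`, there is a margin `δ`, and it absorbs the
diameter of singular simplices once these are small; subdivision (`relMap_smallIn_bijective`) shows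
that small simplices compute the homology. Čech and Rips complexes are treated together, as
complexes between the Čech complexes at scales `a` and `c a`; in Euclidean space the factor √2 comes
from `exists_forall_dist_sq_le`. The diagram chase is `nonempty_range_equiv`, and the radii are
matched in `nonempty_range_equiv_local`. -/

theorem supported_le_of_single_mem {α : Type u} {A : Set α} {N : Submodule ℤ (α →₀ ℤ)}
    (h : ∀ a ∈ A, Finsupp.single a (1 : ℤ) ∈ N) : Finsupp.supported ℤ ℤ A ≤ N := by
  rw [Finsupp.supported_eq_span_single, Submodule.span_le]
  rintro _ ⟨a, ha, rfl⟩
  exact h a ha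

theorem map_mem_of_single {α : Type u} {N : Type v} [AddCommGroup N] {A : Set α}
    {f : (α →₀ ℤ) →ₗ[ℤ] N} {B : Submodule ℤ N}
    (h : ∀ a ∈ A, f (Finsupp.single a 1) ∈ B) {z : α →₀ ℤ} (hz : z ∈ Finsupp.supported ℤ ℤ A) :
    f z ∈ B :=
  supported_le_of_single_mem (N := B.comap f) h hz

theorem map_eq_of_single {α : Type u} {N : Type v} [AddCommGroup N] {A : Set α}
    {f g : (α →₀ ℤ) →ₗ[ℤ] N} (h : ∀ a ∈ A, f (Finsupp.single a 1) = g (Finsupp.single a 1))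
    {z : α →₀ ℤ} (hz : z ∈ Finsupp.supported ℤ ℤ A) : f z = g z :=
  supported_le_of_single_mem (N := LinearMap.eqLocus f g) h hz

theorem linearMap_ext_single {α : Type u} {N : Type v} [AddCommGroup N]
    {f g : (α →₀ ℤ) →ₗ[ℤ] N} (h : ∀ a, f (Finsupp.single a 1) = g (Finsupp.single a 1)) :
    f = g := by
  ext a
  simpa using h a

theorem single_mem_supported {α : Type u} {A : Set α} {a : α} (h : a ∈ A) :
    Finsupp.single a (1 : ℤ) ∈ Finsupp.supported ℤ ℤ A :=
  Finsupp.single_mem_supported ℤ 1 h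

/-- The sum of the coefficients of a chain. -/
def augmentation (α : Type u) : (α →₀ ℤ) →ₗ[ℤ] ℤ := Finsupp.lsum ℤ fun _ => LinearMap.id

@[simp]
theorem augmentation_single {α : Type u} (a : α) (k : ℤ) :
    augmentation α (Finsupp.single a k) = k := by
  simp [augmentation]

/-! ### Boundaries, chain maps of pairs and acyclic carriers -/

section Chains

variable {S : ℕ → Type u} {T : ℕ → Type v}
variable (face : ∀ n, Fin (n + 2) → S (n + 1) → S n)
variable (face' : ∀ n, Fin (n + 2) → T (n + 1) → T n)

/-- The boundary map from degree `n + 1` to degree `n`. -/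
def bd (n : ℕ) : (S (n + 1) →₀ ℤ) →ₗ[ℤ] (S n →₀ ℤ) := boundary face (n + 1)

theorem boundary_single (n : ℕ) (σ : S (n + 1)) :
    bd face n (Finsupp.single σ 1) =
      ∑ i : Fin (n + 2), ((-1 : ℤ) ^ (i : ℕ)) • Finsupp.single (face n i σ) (1 : ℤ) := by
  simp [bd, boundary]

-- In degree 0 the boundary is the zero map, so the condition on the boundary is vacuous.
variable {face} in
theorem mem_relCycles_zero {A B : ∀ n, Set (S n)} {z : S 0 →₀ ℤ} :
    z ∈ relCycles face A B 0 ↔ z ∈ Finsupp.supported ℤ ℤ (A 0) :=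
  ⟨fun h => h.1, fun h => ⟨h, (Finsupp.supported ℤ ℤ (B 0)).zero_mem⟩⟩

variable {face} in
theorem mem_relCycles_succ {A B : ∀ n, Set (S n)} {n : ℕ} {z : S (n + 1) →₀ ℤ} :
    z ∈ relCycles face A B (n + 1) ↔ z ∈ Finsupp.supported ℤ ℤ (A (n + 1)) ∧
      bd face n z ∈ Finsupp.supported ℤ ℤ (B n) := Iff.rfl

variable {face} in
theorem mem_relBoundaries {A B : ∀ n, Set (S n)} {n : ℕ} {z : S n →₀ ℤ} :
    z ∈ relBoundaries face A B n ↔ ∃ w ∈ Finsupp.supported ℤ ℤ (A (n + 1)),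
      ∃ b ∈ Finsupp.supported ℤ ℤ (B n), bd face n w + b = z := by
  rw [relBoundaries, Submodule.mem_sup]
  constructor
  · rintro ⟨_, ⟨w, hw, rfl⟩, b, hb, h⟩
    exact ⟨w, hw, b, hb, h⟩
  · rintro ⟨w, hw, b, hb, h⟩
    exact ⟨_, ⟨w, hw, rfl⟩, b, hb, h⟩

/-- The (semi)simplicial identity between the faces of faces. -/
def FaceIdentity : Prop :=
  ∀ n (i j : Fin (n + 2)) (σ : S (n + 2)), i ≤ j →
    face n i (face (n + 1) j.succ σ) = face n j (face (n + 1) i.castSucc σ)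

variable {face face'}

theorem boundary_boundary (h : FaceIdentity face) (n : ℕ) (z : S (n + 2) →₀ ℤ) :
    bd face n (bd face (n + 1) z) = 0 := by
  suffices H : (bd face n) ∘ₗ (bd face (n + 1)) = 0 from LinearMap.congr_fun H z
  refine linearMap_ext_single fun σ => ?_
  simp only [LinearMap.comp_apply, LinearMap.zero_apply]
  rw [boundary_single]
  simp only [map_sum, map_smul]
  simp_rw [boundary_single, Finset.smul_sum, smul_smul]
  rw [← Fintype.sum_prod_type' (fun (j : Fin (n + 3)) (i : Fin (n + 2)) =>
    ((-1 : ℤ) ^ (j : ℕ) * (-1) ^ (i : ℕ)) • Finsupp.single (face n i (face (n + 1) j σ)) (1 : ℤ))]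
  -- The involution exchanges the order in which two vertices are dropped. This shifts one of the
  -- two indices by one and so reverses the sign.
  let inv : Fin (n + 3) × Fin (n + 2) → Fin (n + 3) × Fin (n + 2) := fun q =>
    if hq : q.2.castSucc < q.1 then (q.2.castSucc, q.1.pred (Fin.ne_zero_of_lt hq))
    else (q.2.succ, q.1.castLT (lt_of_le_of_lt (not_lt.1 hq) q.2.2))
  refine Finset.sum_involution (fun q _ => inv q) ?_ ?_ (fun _ _ => Finset.mem_univ _) ?_
  · rintro ⟨j, i⟩ -
    by_cases hq : i.castSucc < j
    · obtain ⟨j, rfl⟩ := Fin.exists_succ_eq.2 (Fin.ne_zero_of_lt hq)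
      have hij : i ≤ j := by rwa [Fin.castSucc_lt_succ_iff] at hq
      simp only [inv, hq, dif_pos, Fin.pred_succ, h n i j σ hij]
      rw [← add_smul]
      simp [pow_succ, mul_comm]
    · have hle : j ≤ i.castSucc := not_lt.1 hq
      obtain ⟨j, rfl⟩ := Fin.exists_castSucc_eq.2 (ne_of_lt (lt_of_le_of_lt hle i.castSucc_lt_last))
      have hij : j ≤ i := by simpa using hle
      simp only [inv, hq, dif_neg, not_false_eq_true, Fin.castLT_castSucc, h n j i σ hij]
      rw [← add_smul]
      simp [pow_succ, mul_comm]
  · rintro ⟨j, i⟩ - - heq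
    by_cases hq : i.castSucc < j
    · simp only [inv, hq, dif_pos, Prod.mk.injEq] at heq
      exact hq.ne heq.1
    · simp only [inv, hq, dif_neg, not_false_eq_true, Prod.mk.injEq] at heq
      have := not_lt.1 hq
      rw [← heq.1] at this
      exact absurd this (by simp)
  · rintro ⟨j, i⟩ -
    by_cases hq : i.castSucc < j
    · obtain ⟨j, rfl⟩ := Fin.exists_succ_eq.2 (Fin.ne_zero_of_lt hq)
      have hij : i ≤ j := by rwa [Fin.castSucc_lt_succ_iff] at hq
      have h2 : ¬ (j.castSucc < i.castSucc) := by simpa using hij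
      simp [inv, hq, h2]
    · have hle : j ≤ i.castSucc := not_lt.1 hq
      obtain ⟨j, rfl⟩ := Fin.exists_castSucc_eq.2 (ne_of_lt (lt_of_le_of_lt hle i.castSucc_lt_last))
      have hij : j ≤ i := by simpa using hle
      have h2 : j.castSucc < i.succ := by rwa [Fin.castSucc_lt_succ_iff]
      simp [inv, hq, h2]

theorem augmentation_boundary (z : S 1 →₀ ℤ) : augmentation (S 0) (bd face 0 z) = 0 := by
  suffices H : augmentation (S 0) ∘ₗ bd face 0 = 0 from LinearMap.congr_fun H z
  refine linearMap_ext_single fun σ => ?_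
  rw [LinearMap.comp_apply, boundary_single, Fin.sum_univ_two]
  simp

/-- A family of simplices that contains the faces of its simplices. -/
def FaceClosed (face : ∀ n, Fin (n + 2) → S (n + 1) → S n) (A : ∀ n, Set (S n)) : Prop :=
  ∀ n, ∀ σ ∈ A (n + 1), ∀ i, face n i σ ∈ A n

theorem FaceClosed.boundary_mem {A : ∀ n, Set (S n)} (hA : FaceClosed face A) {n : ℕ}
    {z : S (n + 1) →₀ ℤ} (hz : z ∈ Finsupp.supported ℤ ℤ (A (n + 1))) :
    bd face n z ∈ Finsupp.supported ℤ ℤ (A n) := by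
  refine map_mem_of_single (fun σ hσ => ?_) hz
  rw [boundary_single]
  exact Submodule.sum_mem _ fun i _ => Submodule.smul_mem _ _ (single_mem_supported (hA n σ hσ i))

/-! ### Maps on relative homology induced by chain maps -/

/-- `f` is a chain map on the chains supported in `A`. -/
def IsChainMapOn (face : ∀ n, Fin (n + 2) → S (n + 1) → S n)
    (face' : ∀ n, Fin (n + 2) → T (n + 1) → T n) (A : ∀ n, Set (S n))
    (f : ∀ n, (S n →₀ ℤ) →ₗ[ℤ] (T n →₀ ℤ)) : Prop :=
  ∀ n, ∀ z ∈ Finsupp.supported ℤ ℤ (A (n + 1)),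
    bd face' n (f (n + 1) z) = f n (bd face n z)

/-- `f` maps chains supported in `A` to chains supported in `A'`. -/
def MapsChains (A : ∀ n, Set (S n)) (A' : ∀ n, Set (T n))
    (f : ∀ n, (S n →₀ ℤ) →ₗ[ℤ] (T n →₀ ℤ)) : Prop :=
  ∀ n, ∀ z ∈ Finsupp.supported ℤ ℤ (A n), f n z ∈ Finsupp.supported ℤ ℤ (A' n)

/-- Chain maps from the pair `(A, B)` to the pair `(A', B')`. -/
structure IsPairMap (face : ∀ n, Fin (n + 2) → S (n + 1) → S n)
    (face' : ∀ n, Fin (n + 2) → T (n + 1) → T n) (A B : ∀ n, Set (S n)) (A' B' : ∀ n, Set (T n))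
    (f : ∀ n, (S n →₀ ℤ) →ₗ[ℤ] (T n →₀ ℤ)) : Prop where
  comm : IsChainMapOn face face' A f
  maps : MapsChains A A' f
  maps_sub : MapsChains B B' f

variable {A B : ∀ n, Set (S n)} {A' B' : ∀ n, Set (T n)}
variable {f g : ∀ n, (S n →₀ ℤ) →ₗ[ℤ] (T n →₀ ℤ)}

theorem IsPairMap.map_relCycles (hf : IsPairMap face face' A B A' B' f) (n : ℕ) :
    relCycles face A B n ≤ (relCycles face' A' B' n).comap (f n) := by
  intro z hz
  cases n with
  | zero => exact mem_relCycles_zero.2 (hf.maps 0 z (mem_relCycles_zero.1 hz))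
  | succ n =>
    obtain ⟨hz, hz'⟩ := mem_relCycles_succ.1 hz
    refine mem_relCycles_succ.2 ⟨hf.maps _ z hz, ?_⟩
    rw [hf.comm n z hz]
    exact hf.maps_sub n _ hz'

theorem IsPairMap.map_relBoundaries (hf : IsPairMap face face' A B A' B' f) (n : ℕ) :
    relBoundaries face A B n ≤ (relBoundaries face' A' B' n).comap (f n) := by
  refine sup_le ?_ fun z hz => Submodule.mem_sup_right (hf.maps_sub n z hz)
  rintro _ ⟨w, hw, rfl⟩
  exact Submodule.mem_sup_left ⟨f (n + 1) w, hf.maps _ w hw, hf.comm n w hw⟩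

/-- The homomorphism of relative homology groups induced by a chain map of pairs. -/
def inducedMap (hf : IsPairMap face face' A B A' B' f) (n : ℕ) :
    RelHomology face A B n →ₗ[ℤ] RelHomology face' A' B' n :=
  Submodule.mapQ _ _ ((f n).restrict (hf.map_relCycles n))
    (fun _ hz => hf.map_relBoundaries n hz)

theorem inducedMap_mk (hf : IsPairMap face face' A B A' B' f) (n : ℕ)
    (z : relCycles face A B n) :
    inducedMap hf n (Submodule.Quotient.mk z) =
      Submodule.Quotient.mk ⟨f n z, hf.map_relCycles n z.2⟩ := rfl

theorem relMap_mk {A₁ B₁ : ∀ n, Set (S n)} (hA : ∀ n, A n ⊆ A₁ n) (hB : ∀ n, B n ⊆ B₁ n) (n : ℕ)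
    (z : relCycles face A B n) :
    relMap (face := face) hA hB n (Submodule.Quotient.mk z) =
      Submodule.Quotient.mk ⟨z, relCycles_mono hA hB n z.2⟩ := rfl

theorem relHomology_mk_eq_iff {n : ℕ} (z z' : relCycles face A B n) :
    (Submodule.Quotient.mk z : RelHomology face A B n) = Submodule.Quotient.mk z' ↔
      (z : S n →₀ ℤ) - z' ∈ relBoundaries face A B n := by
  rw [Submodule.Quotient.eq]
  rfl

theorem IsPairMap.id_of_subset {A₁ B₁ : ∀ n, Set (S n)} (hA : ∀ n, A n ⊆ A₁ n)
    (hB : ∀ n, B n ⊆ B₁ n) :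
    IsPairMap face face A B A₁ B₁ (fun _ => LinearMap.id) :=
  ⟨fun _ _ _ => rfl, fun n _ hz => Finsupp.supported_mono (hA n) hz,
    fun n _ hz => Finsupp.supported_mono (hB n) hz⟩

theorem inducedMap_id {A₁ B₁ : ∀ n, Set (S n)} (hA : ∀ n, A n ⊆ A₁ n) (hB : ∀ n, B n ⊆ B₁ n)
    (n : ℕ) :
    inducedMap (IsPairMap.id_of_subset (face := face) hA hB) n = relMap hA hB n := rfl

theorem IsPairMap.comp {U : ℕ → Type w} {face'' : ∀ n, Fin (n + 2) → U (n + 1) → U n}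
    {A'' B'' : ∀ n, Set (U n)} {g : ∀ n, (T n →₀ ℤ) →ₗ[ℤ] (U n →₀ ℤ)}
    (hg : IsPairMap face' face'' A' B' A'' B'' g) (hf : IsPairMap face face' A B A' B' f) :
    IsPairMap face face'' A B A'' B'' (fun n => g n ∘ₗ f n) :=
  ⟨fun n z hz => by
      rw [LinearMap.comp_apply, hg.comm n _ (hf.maps _ z hz), hf.comm n z hz, LinearMap.comp_apply],
    fun n z hz => hg.maps n _ (hf.maps n z hz),
    fun n z hz => hg.maps_sub n _ (hf.maps_sub n z hz)⟩

theorem inducedMap_comp {U : ℕ → Type w} {face'' : ∀ n, Fin (n + 2) → U (n + 1) → U n}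
    {A'' B'' : ∀ n, Set (U n)} {g : ∀ n, (T n →₀ ℤ) →ₗ[ℤ] (U n →₀ ℤ)}
    (hg : IsPairMap face' face'' A' B' A'' B'' g) (hf : IsPairMap face face' A B A' B' f) (n : ℕ) :
    inducedMap (hg.comp hf) n = inducedMap hg n ∘ₗ inducedMap hf n := by
  ext z
  rfl

/-- `D` is a chain homotopy from `g` to `f` on the chains supported in `A`. -/
structure IsHomotopyOn (face : ∀ n, Fin (n + 2) → S (n + 1) → S n)
    (face' : ∀ n, Fin (n + 2) → T (n + 1) → T n) (A : ∀ n, Set (S n))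
    (f g : ∀ n, (S n →₀ ℤ) →ₗ[ℤ] (T n →₀ ℤ))
    (D : ∀ n, (S n →₀ ℤ) →ₗ[ℤ] (T (n + 1) →₀ ℤ)) : Prop where
  zero : ∀ z ∈ Finsupp.supported ℤ ℤ (A 0), bd face' 0 (D 0 z) = f 0 z - g 0 z
  succ : ∀ n, ∀ z ∈ Finsupp.supported ℤ ℤ (A (n + 1)),
    bd face' (n + 1) (D (n + 1) z) + D n (bd face n z) =
      f (n + 1) z - g (n + 1) z

/-- `D` raises degrees by one and maps chains supported in `A` to chains supported in `A'`. -/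
def MapsChainsSucc (A : ∀ n, Set (S n)) (A' : ∀ n, Set (T n))
    (D : ∀ n, (S n →₀ ℤ) →ₗ[ℤ] (T (n + 1) →₀ ℤ)) : Prop :=
  ∀ n, ∀ z ∈ Finsupp.supported ℤ ℤ (A n), D n z ∈ Finsupp.supported ℤ ℤ (A' (n + 1))

/-- The boundary of a relative cycle is supported in `B`, so the term `D ∂z` of the homotopy formula
is supported in `B'` and vanishes in relative homology. In degree 0 there is no such term. -/
theorem IsHomotopyOn.sub_mem {D : ∀ n, (S n →₀ ℤ) →ₗ[ℤ] (T (n + 1) →₀ ℤ)}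
    (hD : IsHomotopyOn face face' A f g D) (hDA : MapsChainsSucc A A' D)
    (hDB : MapsChainsSucc B B' D) {n : ℕ} {z : S n →₀ ℤ} (hz : z ∈ relCycles face A B n) :
    f n z - g n z ∈ relBoundaries face' A' B' n := by
  cases n with
  | zero =>
    rw [← hD.zero z hz.1]
    exact Submodule.mem_sup_left ⟨_, hDA 0 z hz.1, rfl⟩
  | succ n =>
    rw [← hD.succ n z hz.1]
    exact Submodule.add_mem_sup ⟨_, hDA _ z hz.1, rfl⟩ (hDB n _ hz.2)

theorem inducedMap_eq_of_homotopy {D : ∀ n, (S n →₀ ℤ) →ₗ[ℤ] (T (n + 1) →₀ ℤ)}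
    (hf : IsPairMap face face' A B A' B' f) (hg : IsPairMap face face' A B A' B' g)
    (hD : IsHomotopyOn face face' A f g D) (hDA : MapsChainsSucc A A' D)
    (hDB : MapsChainsSucc B B' D) (n : ℕ) : inducedMap hf n = inducedMap hg n := by
  ext z
  simp only [LinearMap.comp_apply, Submodule.mkQ_apply, inducedMap_mk]
  rw [relHomology_mk_eq_iff]
  exact hD.sub_mem hDA hDB z.2

/-! ### Acyclic carriers -/

/-- Cycles of the augmented chain complex. -/
def IsReducedCycle (face : ∀ n, Fin (n + 2) → S (n + 1) → S n) : ∀ n, (S n →₀ ℤ) → Prop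
  | 0, z => augmentation (S 0) z = 0
  | n + 1, z => bd face n z = 0

/-- The reduced homology of the chains supported in `C` vanishes. -/
structure IsAcyclic (face : ∀ n, Fin (n + 2) → S (n + 1) → S n) (C : ∀ n, Set (S n)) : Prop where
  nonempty : (C 0).Nonempty
  exists_boundary : ∀ n, ∀ z ∈ Finsupp.supported ℤ ℤ (C n), IsReducedCycle face n z →
    ∃ w ∈ Finsupp.supported ℤ ℤ (C (n + 1)), bd face n w = z

/-- `Φ` assigns to each simplex in `A` an acyclic family of simplices, and a smaller one to
each face. -/
structure IsAcyclicCarrier (face : ∀ n, Fin (n + 2) → S (n + 1) → S n)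
    (face' : ∀ n, Fin (n + 2) → T (n + 1) → T n) (A : ∀ n, Set (S n))
    (Φ : ∀ n, S n → ∀ k, Set (T k)) : Prop where
  faceClosed : FaceClosed face A
  mono : ∀ n, ∀ σ ∈ A (n + 1), ∀ i k, Φ n (face n i σ) k ⊆ Φ (n + 1) σ k
  acyclic : ∀ n, ∀ σ ∈ A n, IsAcyclic face' (Φ n σ)

/-- The value of `f` at each simplex in `A` is supported in the family assigned by `Φ`. -/
def IsCarried (A : ∀ n, Set (S n)) (Φ : ∀ n, S n → ∀ k, Set (T k))
    (f : ∀ n, (S n →₀ ℤ) →ₗ[ℤ] (T n →₀ ℤ)) : Prop :=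
  ∀ n, ∀ σ ∈ A n, f n (Finsupp.single σ 1) ∈ Finsupp.supported ℤ ℤ (Φ n σ n)

/-- The value of `D` at each simplex in `A` is supported in the family assigned by `Φ`. -/
def IsCarriedSucc (A : ∀ n, Set (S n)) (Φ : ∀ n, S n → ∀ k, Set (T k))
    (D : ∀ n, (S n →₀ ℤ) →ₗ[ℤ] (T (n + 1) →₀ ℤ)) : Prop :=
  ∀ n, ∀ σ ∈ A n, D n (Finsupp.single σ 1) ∈ Finsupp.supported ℤ ℤ (Φ n σ (n + 1))

/-- `f` preserves the augmentation of the vertices in `A`. -/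
def IsAugmented (A : ∀ n, Set (S n)) (f : ∀ n, (S n →₀ ℤ) →ₗ[ℤ] (T n →₀ ℤ)) : Prop :=
  ∀ σ ∈ A 0, augmentation (T 0) (f 0 (Finsupp.single σ 1)) = 1

variable {Φ : ∀ n, S n → ∀ k, Set (T k)}

theorem IsCarried.mapsChains (hf : IsCarried A Φ f) (h : ∀ n, ∀ σ ∈ B n, σ ∈ A n)
    (h' : ∀ n, ∀ σ ∈ B n, Φ n σ n ⊆ B' n) : MapsChains B B' f := fun n _ hz =>
  map_mem_of_single (fun σ hσ => Finsupp.supported_mono (h' n σ hσ) (hf n σ (h n σ hσ))) hz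

theorem IsCarriedSucc.mapsChainsSucc {D : ∀ n, (S n →₀ ℤ) →ₗ[ℤ] (T (n + 1) →₀ ℤ)}
    (hf : IsCarriedSucc A Φ D) (h : ∀ n, ∀ σ ∈ B n, σ ∈ A n)
    (h' : ∀ n, ∀ σ ∈ B n, Φ n σ (n + 1) ⊆ B' (n + 1)) : MapsChainsSucc B B' D := fun n _ hz =>
  map_mem_of_single (fun σ hσ => Finsupp.supported_mono (h' n σ hσ) (hf n σ (h n σ hσ))) hz

theorem IsAcyclicCarrier.carried_boundary (hΦ : IsAcyclicCarrier face face' A Φ)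
    {k n : ℕ} {F : (S n →₀ ℤ) →ₗ[ℤ] (T k →₀ ℤ)}
    (hF : ∀ σ ∈ A n, F (Finsupp.single σ 1) ∈ Finsupp.supported ℤ ℤ (Φ n σ k))
    {σ : S (n + 1)} (hσ : σ ∈ A (n + 1)) :
    F (bd face n (Finsupp.single σ 1)) ∈ Finsupp.supported ℤ ℤ (Φ (n + 1) σ k) := by
  rw [boundary_single]
  simp only [map_sum, map_smul]
  exact Submodule.sum_mem _ fun i _ => Submodule.smul_mem _ _
    (Finsupp.supported_mono (hΦ.mono n σ hσ i k) (hF _ (hΦ.faceClosed n σ hσ i)))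

open Classical in
/-- A chain supported in `C` with boundary `z`, if there is one. -/
def filling (face : ∀ n, Fin (n + 2) → S (n + 1) → S n) (C : ∀ n, Set (S n)) (n : ℕ)
    (z : S n →₀ ℤ) : S (n + 1) →₀ ℤ :=
  if h : ∃ w ∈ Finsupp.supported ℤ ℤ (C (n + 1)), bd face n w = z then h.choose else 0

theorem IsAcyclic.filling_spec {C : ∀ n, Set (S n)} (hC : IsAcyclic face C) {n : ℕ} {z : S n →₀ ℤ}
    (hz : z ∈ Finsupp.supported ℤ ℤ (C n)) (hz' : IsReducedCycle face n z) :
    filling face C n z ∈ Finsupp.supported ℤ ℤ (C (n + 1)) ∧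
      bd face n (filling face C n z) = z := by
  have h := hC.exists_boundary n z hz hz'
  rw [filling, dif_pos h]
  exact h.choose_spec

open Classical in
/-- The chain map built by successive fillings. -/
def carriedMap (face : ∀ n, Fin (n + 2) → S (n + 1) → S n)
    (face' : ∀ n, Fin (n + 2) → T (n + 1) → T n) (Φ : ∀ n, S n → ∀ k, Set (T k)) :
    ∀ n, (S n →₀ ℤ) →ₗ[ℤ] (T n →₀ ℤ)
  | 0 => Finsupp.linearCombination ℤ fun σ =>
      if h : (Φ 0 σ 0).Nonempty then Finsupp.single h.choose (1 : ℤ) else 0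
  | n + 1 => Finsupp.linearCombination ℤ fun σ => filling face' (Φ (n + 1) σ) n
      (carriedMap face face' Φ n (bd face n (Finsupp.single σ 1)))

/-- The chain homotopy built by successive fillings. -/
def carriedHomotopy (face : ∀ n, Fin (n + 2) → S (n + 1) → S n)
    (face' : ∀ n, Fin (n + 2) → T (n + 1) → T n) (Φ : ∀ n, S n → ∀ k, Set (T k))
    (h : ∀ n, (S n →₀ ℤ) →ₗ[ℤ] (T n →₀ ℤ)) : ∀ n, (S n →₀ ℤ) →ₗ[ℤ] (T (n + 1) →₀ ℤ)
  | 0 => Finsupp.linearCombination ℤ fun σ =>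
      filling face' (Φ 0 σ) 0 (h 0 (Finsupp.single σ 1))
  | n + 1 => Finsupp.linearCombination ℤ fun σ => filling face' (Φ (n + 1) σ) (n + 1)
      (h (n + 1) (Finsupp.single σ 1) -
        carriedHomotopy face face' Φ h n (bd face n (Finsupp.single σ 1)))

theorem isChainMapOn_of_single
    (h : ∀ n, ∀ σ ∈ A (n + 1), bd face' n (f (n + 1) (Finsupp.single σ 1)) =
      f n (bd face n (Finsupp.single σ 1))) : IsChainMapOn face face' A f :=
  fun n _ hz => map_eq_of_single (f := bd face' n ∘ₗ f (n + 1))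
    (g := f n ∘ₗ bd face n) (h n) hz

/-- Values are chosen degree by degree: the image of the boundary of a simplex is a reduced cycle in
the acyclic family of this simplex and can be filled there. For 1-simplices, being a reduced cycle
means augmentation zero, which is why the vertices are sent to chains of augmentation 1. -/
theorem exists_carried_chainMap (hS : FaceIdentity face) (hΦ : IsAcyclicCarrier face face' A Φ) :
    ∃ f : ∀ n, (S n →₀ ℤ) →ₗ[ℤ] (T n →₀ ℤ),
      IsChainMapOn face face' A f ∧ IsCarried A Φ f ∧ IsAugmented A f := by
  let f := carriedMap face face' Φ
  have h0 : ∀ σ ∈ A 0, f 0 (Finsupp.single σ 1) ∈ Finsupp.supported ℤ ℤ (Φ 0 σ 0) ∧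
      augmentation (T 0) (f 0 (Finsupp.single σ 1)) = 1 := by
    intro σ hσ
    have h := (hΦ.acyclic 0 σ hσ).nonempty
    simp only [f, carriedMap, Finsupp.linearCombination_single, one_smul, dif_pos h]
    exact ⟨single_mem_supported h.choose_spec, by simp⟩
  have haug : ∀ z ∈ Finsupp.supported ℤ ℤ (A 0), augmentation (T 0) (f 0 z) =
      augmentation (S 0) z := fun z hz =>
    map_eq_of_single (f := augmentation (T 0) ∘ₗ f 0) (fun σ hσ => by simp [h0 σ hσ]) hz
  have key : ∀ n, (∀ σ ∈ A n, f n (Finsupp.single σ 1) ∈ Finsupp.supported ℤ ℤ (Φ n σ n)) ∧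
      ∀ σ ∈ A (n + 1), f (n + 1) (Finsupp.single σ 1) ∈
          Finsupp.supported ℤ ℤ (Φ (n + 1) σ (n + 1)) ∧
        bd face' n (f (n + 1) (Finsupp.single σ 1)) =
          f n (bd face n (Finsupp.single σ 1)) := by
    intro n
    induction n with
    | zero =>
      refine ⟨fun σ hσ => (h0 σ hσ).1, fun σ hσ => ?_⟩
      have := (hΦ.acyclic 1 σ hσ).filling_spec (n := 0)
        (z := f 0 (bd face 0 (Finsupp.single σ 1)))
        (hΦ.carried_boundary (fun τ hτ => (h0 τ hτ).1) hσ) (by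
          change augmentation (T 0) _ = 0
          rw [haug _ (hΦ.faceClosed.boundary_mem (single_mem_supported hσ))]
          exact augmentation_boundary _)
      simpa [f, carriedMap] using this
    | succ n ih =>
      refine ⟨fun σ hσ => (ih.2 σ hσ).1, fun σ hσ => ?_⟩
      have hc : bd face' n (f (n + 1) (bd face (n + 1) (Finsupp.single σ 1))) =
          f n (bd face n (bd face (n + 1) (Finsupp.single σ 1))) :=
        map_eq_of_single (f := bd face' n ∘ₗ f (n + 1))
          (g := f n ∘ₗ bd face n) (fun τ hτ => (ih.2 τ hτ).2)
          (hΦ.faceClosed.boundary_mem (single_mem_supported hσ))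
      rw [boundary_boundary hS, map_zero] at hc
      have := (hΦ.acyclic (n + 2) σ hσ).filling_spec (n := n + 1)
        (z := f (n + 1) (bd face (n + 1) (Finsupp.single σ 1)))
        (hΦ.carried_boundary (fun τ hτ => (ih.2 τ hτ).1) hσ) hc
      simpa [f, carriedMap] using this
  exact ⟨f, isChainMapOn_of_single fun n σ hσ => ((key n).2 σ hσ).2, fun n => (key n).1,
    fun σ hσ => (h0 σ hσ).2⟩

/-- The same successive fillings, now of `f - g - D ∂`. In degree 0 the difference `f - g` is a
reduced cycle because both maps preserve the augmentation. -/
theorem exists_carried_homotopy (hS : FaceIdentity face)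
    (hΦ : IsAcyclicCarrier face face' A Φ)
    (hf : IsChainMapOn face face' A f) (hg : IsChainMapOn face face' A g)
    (hf' : IsCarried A Φ f) (hg' : IsCarried A Φ g) (hfa : IsAugmented A f)
    (hga : IsAugmented A g) :
    ∃ D : ∀ n, (S n →₀ ℤ) →ₗ[ℤ] (T (n + 1) →₀ ℤ),
      IsHomotopyOn face face' A f g D ∧ IsCarriedSucc A Φ D := by
  let h : ∀ n, (S n →₀ ℤ) →ₗ[ℤ] (T n →₀ ℤ) := fun n => f n - g n
  let D := carriedHomotopy face face' Φ h
  have hh : ∀ n, ∀ z ∈ Finsupp.supported ℤ ℤ (A (n + 1)),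
      bd face' n (h (n + 1) z) = h n (bd face n z) := fun n z hz => by
    simp only [h, LinearMap.sub_apply, map_sub, hf n z hz, hg n z hz]
  have hh' : ∀ n, ∀ σ ∈ A n, h n (Finsupp.single σ 1) ∈ Finsupp.supported ℤ ℤ (Φ n σ n) :=
    fun n σ hσ => Submodule.sub_mem _ (hf' n σ hσ) (hg' n σ hσ)
  have h0 : ∀ σ ∈ A 0, D 0 (Finsupp.single σ 1) ∈ Finsupp.supported ℤ ℤ (Φ 0 σ 1) ∧
      bd face' 0 (D 0 (Finsupp.single σ 1)) = h 0 (Finsupp.single σ 1) := by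
    intro σ hσ
    have := (hΦ.acyclic 0 σ hσ).filling_spec (n := 0) (hh' 0 σ hσ) (by
      change augmentation (T 0) _ = 0
      simp [h, hfa σ hσ, hga σ hσ])
    simpa [D, carriedHomotopy] using this
  have step : ∀ n, (∀ σ ∈ A n, D n (Finsupp.single σ 1) ∈
      Finsupp.supported ℤ ℤ (Φ n σ (n + 1))) →
      (∀ σ ∈ A (n + 1), bd face' n (D n (bd face n (Finsupp.single σ 1))) =
        h n (bd face n (Finsupp.single σ 1))) →
      ∀ σ ∈ A (n + 1), D (n + 1) (Finsupp.single σ 1) ∈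
          Finsupp.supported ℤ ℤ (Φ (n + 1) σ (n + 2)) ∧
        bd face' (n + 1) (D (n + 1) (Finsupp.single σ 1)) =
          h (n + 1) (Finsupp.single σ 1) - D n (bd face n (Finsupp.single σ 1)) := by
    intro n h1 h2 σ hσ
    have := (hΦ.acyclic (n + 1) σ hσ).filling_spec (n := n + 1)
      (z := h (n + 1) (Finsupp.single σ 1) - D n (bd face n (Finsupp.single σ 1)))
      (Submodule.sub_mem _ (hh' _ σ hσ) (hΦ.carried_boundary h1 hσ)) (by
        change bd face' n _ = 0
        rw [map_sub, hh n _ (single_mem_supported hσ), h2 σ hσ, sub_self])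
    simpa [D, carriedHomotopy] using this
  have key : ∀ n, (∀ σ ∈ A n, D n (Finsupp.single σ 1) ∈
      Finsupp.supported ℤ ℤ (Φ n σ (n + 1))) ∧
      (∀ σ ∈ A (n + 1), bd face' n (D n (bd face n (Finsupp.single σ 1))) =
        h n (bd face n (Finsupp.single σ 1))) := by
    intro n
    induction n with
    | zero =>
      exact ⟨fun σ hσ => (h0 σ hσ).1, fun σ hσ =>
        map_eq_of_single (f := bd face' 0 ∘ₗ D 0) (g := h 0) (fun τ hτ => (h0 τ hτ).2)
          (hΦ.faceClosed.boundary_mem (single_mem_supported hσ))⟩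
    | succ n ih =>
      refine ⟨fun σ hσ => (step n ih.1 ih.2 σ hσ).1, fun σ hσ => ?_⟩
      have := map_eq_of_single (f := bd face' (n + 1) ∘ₗ D (n + 1))
        (g := h (n + 1) - D n ∘ₗ bd face n)
        (fun τ hτ => (step n ih.1 ih.2 τ hτ).2)
        (hΦ.faceClosed.boundary_mem (single_mem_supported hσ))
      simpa [boundary_boundary hS] using this
  refine ⟨D, ⟨fun z hz => ?_, fun n z hz => ?_⟩, fun n => (key n).1⟩
  · exact map_eq_of_single (f := bd face' 0 ∘ₗ D 0) (g := h 0) (fun τ hτ => (h0 τ hτ).2) hz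
  · have := map_eq_of_single (f := bd face' (n + 1) ∘ₗ D (n + 1))
        (g := h (n + 1) - D n ∘ₗ bd face n)
        (fun τ hτ => (step n (key n).1 (key n).2 τ hτ).2) hz
    simp only [LinearMap.comp_apply, LinearMap.sub_apply] at this
    rw [this]
    simp [h]

end Chains

/-! ### The ordered chain complex of all tuples -/

section Tuples

/-- Tuples of `n + 1` points. -/
abbrev Tuple (V : Type u) (n : ℕ) : Type u := Fin (n + 1) → V

/-- The faces of tuples. -/
abbrev tupleFace (V : Type u) : ∀ n, Fin (n + 2) → Tuple V (n + 1) → Tuple V n := orderedFace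

/-- Tuples with entries in a set. -/
def tuplesIn {V : Type u} (C : Set V) (n : ℕ) : Set (Tuple V n) := {p | ∀ i, p i ∈ C}

variable {V : Type u} {W : Type v}

theorem succAbove_succAbove_of_le {n : ℕ} {i j : Fin (n + 2)} (h : i ≤ j) (k : Fin (n + 1)) :
    j.succ.succAbove (i.succAbove k) = i.castSucc.succAbove (j.succAbove k) := by
  have h' : (i : ℕ) ≤ j := h
  ext
  simp only [Fin.succAbove, Fin.lt_def]
  split_ifs <;> simp_all <;> omega

theorem faceIdentity_tuple : FaceIdentity (tupleFace V) := by
  intro n i j p h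
  funext k
  exact congrArg p (succAbove_succAbove_of_le h k)

theorem faceClosed_tuplesIn (C : Set V) : FaceClosed (tupleFace V) (tuplesIn C) :=
  fun _ _ hp _ _ => hp _

/-- The cone over chains of tuples with a given apex. -/
def cone (b : V) (n : ℕ) : (Tuple V n →₀ ℤ) →ₗ[ℤ] (Tuple V (n + 1) →₀ ℤ) :=
  Finsupp.lmapDomain ℤ ℤ fun p => (Fin.cons b p : Fin (n + 2) → V)

@[simp]
theorem cone_single (b : V) (n : ℕ) (p : Tuple V n) :
    cone b n (Finsupp.single p 1) = Finsupp.single (Fin.cons b p : Fin (n + 2) → V) 1 := by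
  simp [cone]

theorem tupleFace_zero_cons (b : V) (n : ℕ) (p : Tuple V n) :
    tupleFace V n 0 (Fin.cons b p : Fin (n + 2) → V) = p := by
  funext k
  simp [orderedFace]

theorem tupleFace_succ_cons (b : V) (n : ℕ) (p : Tuple V (n + 1)) (i : Fin (n + 2)) :
    tupleFace V (n + 1) i.succ (Fin.cons b p : Fin (n + 3) → V) =
      (Fin.cons b (tupleFace V n i p) : Fin (n + 2) → V) := by
  funext k
  refine Fin.cases ?_ (fun k => ?_) k <;> simp [orderedFace]

theorem bd_cone_succ (b : V) (n : ℕ) (z : Tuple V (n + 1) →₀ ℤ) :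
    bd (tupleFace V) (n + 1) (cone b (n + 1) z) = z - cone b n (bd (tupleFace V) n z) := by
  have : bd (tupleFace V) (n + 1) ∘ₗ cone b (n + 1) =
      LinearMap.id - cone b n ∘ₗ bd (tupleFace V) n := by
    refine linearMap_ext_single fun p => ?_
    simp only [LinearMap.comp_apply, LinearMap.sub_apply, LinearMap.id_apply, cone_single]
    rw [boundary_single, boundary_single, Fin.sum_univ_succ, tupleFace_zero_cons]
    simp only [tupleFace_succ_cons, map_sum, map_smul, cone_single, Fin.val_zero, pow_zero,
      one_smul, Fin.val_succ, pow_succ, mul_neg, mul_one, neg_smul, Finset.sum_neg_distrib]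
    rw [sub_eq_add_neg]
  exact LinearMap.congr_fun this z

theorem bd_cone_zero (b : V) (z : Tuple V 0 →₀ ℤ) :
    bd (tupleFace V) 0 (cone b 0 z) =
      z - augmentation _ z • Finsupp.single (fun _ => b : Tuple V 0) (1 : ℤ) := by
  have : bd (tupleFace V) 0 ∘ₗ cone b 0 = LinearMap.id -
      (augmentation (Tuple V 0)).smulRight (Finsupp.single (fun _ => b : Tuple V 0) (1 : ℤ)) := by
    refine linearMap_ext_single fun p => ?_
    have h1 : tupleFace V 0 1 (Fin.cons b p : Fin 2 → V) = fun _ => b := by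
      funext k
      fin_cases k
      simp [orderedFace]
    simp only [LinearMap.comp_apply, LinearMap.sub_apply, LinearMap.id_apply, cone_single]
    rw [boundary_single, Fin.sum_univ_two, tupleFace_zero_cons, h1]
    simp [sub_eq_add_neg]
  exact LinearMap.congr_fun this z

theorem cone_mem {C : ∀ n, Set (Tuple V n)} {b : V} {n : ℕ}
    (h : ∀ p ∈ C n, (Fin.cons b p : Fin (n + 2) → V) ∈ C (n + 1)) {z : Tuple V n →₀ ℤ}
    (hz : z ∈ Finsupp.supported ℤ ℤ (C n)) : cone b n z ∈ Finsupp.supported ℤ ℤ (C (n + 1)) :=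
  map_mem_of_single (fun p hp => by simpa using single_mem_supported (h p hp)) hz

/-- The cone operator is a contracting homotopy: a reduced cycle is the boundary of its cone. -/
theorem isAcyclic_of_cone {C : ∀ n, Set (Tuple V n)} (b : V) (h0 : (fun _ => b) ∈ C 0)
    (h : ∀ n, ∀ p ∈ C n, (Fin.cons b p : Fin (n + 2) → V) ∈ C (n + 1)) :
    IsAcyclic (tupleFace V) C := by
  refine ⟨⟨_, h0⟩, fun n z hz hz' => ⟨cone b n z, cone_mem (h n) hz, ?_⟩⟩
  cases n with
  | zero =>
    change augmentation _ z = 0 at hz'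
    rw [bd_cone_zero, hz', zero_smul, sub_zero]
  | succ n =>
    change bd _ _ z = 0 at hz'
    rw [bd_cone_succ, hz', map_zero, sub_zero]

/-! ### Barycentric subdivision of tuples -/

/-- The subdivision operator on chains of tuples for given barycenters. -/
def sd (bary : ∀ n, Tuple V n → V) : ∀ n, (Tuple V n →₀ ℤ) →ₗ[ℤ] (Tuple V n →₀ ℤ)
  | 0 => LinearMap.id
  | n + 1 => Finsupp.linearCombination ℤ fun p =>
      cone (bary (n + 1) p) n (sd bary n (bd (tupleFace V) n (Finsupp.single p 1)))

/-- The homotopy between the identity and the subdivision operator. -/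
def sdHomotopy (bary : ∀ n, Tuple V n → V) :
    ∀ n, (Tuple V n →₀ ℤ) →ₗ[ℤ] (Tuple V (n + 1) →₀ ℤ)
  | 0 => 0
  | n + 1 => Finsupp.linearCombination ℤ fun p => cone (bary (n + 1) p) (n + 1)
      (Finsupp.single p 1 - sdHomotopy bary n (bd (tupleFace V) n (Finsupp.single p 1)))

variable (bary : ∀ n, Tuple V n → V) (bary' : ∀ n, Tuple W n → W)

theorem sd_succ_single (n : ℕ) (p : Tuple V (n + 1)) :
    sd bary (n + 1) (Finsupp.single p 1) =
      cone (bary (n + 1) p) n (sd bary n (bd (tupleFace V) n (Finsupp.single p 1))) := by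
  simp [sd]

theorem sdHomotopy_succ_single (n : ℕ) (p : Tuple V (n + 1)) :
    sdHomotopy bary (n + 1) (Finsupp.single p 1) = cone (bary (n + 1) p) (n + 1)
      (Finsupp.single p 1 - sdHomotopy bary n (bd (tupleFace V) n (Finsupp.single p 1))) := by
  simp [sdHomotopy]

theorem bd_sd (n : ℕ) (z : Tuple V (n + 1) →₀ ℤ) :
    bd (tupleFace V) n (sd bary (n + 1) z) = sd bary n (bd (tupleFace V) n z) := by
  suffices H : bd (tupleFace V) n ∘ₗ sd bary (n + 1) = sd bary n ∘ₗ bd (tupleFace V) n from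
    LinearMap.congr_fun H z
  clear z
  induction n with
  | zero =>
    refine linearMap_ext_single fun p => ?_
    simp only [LinearMap.comp_apply]
    rw [sd_succ_single, bd_cone_zero]
    simp [sd, augmentation_boundary]
  | succ n ih =>
    refine linearMap_ext_single fun p => ?_
    simp only [LinearMap.comp_apply]
    rw [sd_succ_single, bd_cone_succ, sub_eq_self]
    have := LinearMap.congr_fun ih (bd (tupleFace V) (n + 1) (Finsupp.single p 1))
    simp only [LinearMap.comp_apply] at this
    rw [this, boundary_boundary faceIdentity_tuple, map_zero, map_zero]

theorem bd_sdHomotopy_zero (z : Tuple V 0 →₀ ℤ) :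
    bd (tupleFace V) 0 (sdHomotopy bary 0 z) = z - sd bary 0 z := by
  simp [sdHomotopy, sd]

theorem bd_sdHomotopy_succ (n : ℕ) (z : Tuple V (n + 1) →₀ ℤ) :
    bd (tupleFace V) (n + 1) (sdHomotopy bary (n + 1) z) +
      sdHomotopy bary n (bd (tupleFace V) n z) = z - sd bary (n + 1) z := by
  suffices H : bd (tupleFace V) (n + 1) ∘ₗ sdHomotopy bary (n + 1) +
      sdHomotopy bary n ∘ₗ bd (tupleFace V) n = LinearMap.id - sd bary (n + 1) from
    LinearMap.congr_fun H z
  clear z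
  induction n with
  | zero =>
    refine linearMap_ext_single fun p => ?_
    simp only [LinearMap.comp_apply, LinearMap.add_apply, LinearMap.sub_apply, LinearMap.id_apply]
    rw [sdHomotopy_succ_single, sd_succ_single, bd_cone_succ]
    simp [sdHomotopy, sd]
  | succ n ih =>
    refine linearMap_ext_single fun p => ?_
    simp only [LinearMap.comp_apply, LinearMap.add_apply, LinearMap.sub_apply, LinearMap.id_apply]
    have := LinearMap.congr_fun ih (bd (tupleFace V) (n + 1) (Finsupp.single p 1))
    simp only [LinearMap.comp_apply, LinearMap.add_apply, LinearMap.sub_apply, LinearMap.id_apply,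
      boundary_boundary faceIdentity_tuple, map_zero, add_zero] at this
    rw [sdHomotopy_succ_single, sd_succ_single, bd_cone_succ, map_sub _ (Finsupp.single p 1), this]
    simp only [sub_sub_cancel]
    abel

theorem sd_mem_of_closed {C : Set V} (hC : ∀ n, ∀ p ∈ tuplesIn C n, bary n p ∈ C) (n : ℕ)
    {z : Tuple V n →₀ ℤ} (hz : z ∈ Finsupp.supported ℤ ℤ (tuplesIn C n)) :
    sd bary n z ∈ Finsupp.supported ℤ ℤ (tuplesIn C n) := by
  induction n with
  | zero => exact hz
  | succ n ih =>
    refine map_mem_of_single (fun p hp => ?_) hz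
    rw [sd_succ_single]
    refine cone_mem (fun q hq => ?_) (ih ((faceClosed_tuplesIn C).boundary_mem
      (single_mem_supported hp)))
    exact Fin.cases (hC _ p hp) hq

/-- Tuples with pairwise distances at most `d`. -/
def tuplesMesh [PseudoMetricSpace V] (d : ℝ) (n : ℕ) : Set (Tuple V n) :=
  {p | ∀ i j, dist (p i) (p j) ≤ d}

theorem faceClosed_tuplesMesh [PseudoMetricSpace V] (d : ℝ) :
    FaceClosed (tupleFace V) (tuplesMesh d) :=
  fun _ _ hp _ _ _ => hp _ _

/-- A subdivided simplex is a cone from the barycenter over the subdivided boundary. Edges at the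
apex are bounded because balls are closed under barycenters, so the subdivided boundary stays in the
ball around the apex that contains the vertices. The other edges lie in subdivided faces, where
induction gives a smaller factor. -/
theorem sd_mem_mesh [PseudoMetricSpace V]
    (hball : ∀ (b : V) (r : ℝ) n, ∀ p ∈ tuplesIn (closedBall b r) n, bary n p ∈ closedBall b r)
    (hdist : ∀ n d, ∀ p ∈ tuplesMesh d n, ∀ j, dist (p j) (bary n p) ≤ n / (n + 1) * d)
    (n : ℕ) (d : ℝ) {z : Tuple V n →₀ ℤ} (hz : z ∈ Finsupp.supported ℤ ℤ (tuplesMesh d n)) :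
    sd bary n z ∈ Finsupp.supported ℤ ℤ (tuplesMesh ((n : ℝ) / (n + 1) * d) n) := by
  induction n with
  | zero =>
    refine Finsupp.supported_mono (fun p _ i j => ?_) hz
    rw [Fin.fin_one_eq_zero i, Fin.fin_one_eq_zero j]
    simp
  | succ n ih =>
    refine map_mem_of_single (fun p hp => ?_) hz
    rw [sd_succ_single]
    have hd : 0 ≤ d := dist_nonneg.trans (hp 0 0)
    have hle : (n : ℝ) / (n + 1) * d ≤ ((n + 1 : ℕ) : ℝ) / ((n + 1 : ℕ) + 1) * d := by
      refine mul_le_mul_of_nonneg_right ?_ hd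
      rw [div_le_div_iff₀ (by positivity) (by positivity)]
      push_cast
      nlinarith
    have hp' := hdist _ d p hp
    set r : ℝ := ((n + 1 : ℕ) : ℝ) / ((n + 1 : ℕ) + 1) * d with hr
    have h1 := ih ((faceClosed_tuplesMesh d).boundary_mem
      (single_mem_supported hp))
    have h2 := sd_mem_of_closed bary (hball (bary (n + 1) p) r) n
      ((faceClosed_tuplesIn (closedBall (bary (n + 1) p) r)).boundary_mem
        (single_mem_supported (a := p) hp'))
    have h3 : sd bary n (bd (tupleFace V) n (Finsupp.single p 1)) ∈ Finsupp.supported ℤ ℤ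
        (tuplesMesh ((n : ℝ) / (n + 1) * d) n ∩ tuplesIn (closedBall (bary (n + 1) p) r) n) :=
      fun q hq => ⟨h1 hq, h2 hq⟩
    refine map_mem_of_single (fun q hq => ?_) h3
    rw [cone_single]
    refine single_mem_supported fun i j => ?_
    have h0 : 0 ≤ r := dist_nonneg.trans (hp' 0)
    refine Fin.cases ?_ (fun i => ?_) i <;> refine Fin.cases ?_ (fun j => ?_) j
    · simpa using h0
    · simpa [dist_comm] using hq.2 j
    · simpa using hq.2 i
    · simpa using (hq.1 i j).trans hle

/-- The map on chains of tuples induced by a map of points. -/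
def tupleMap (φ : V → W) (n : ℕ) : (Tuple V n →₀ ℤ) →ₗ[ℤ] (Tuple W n →₀ ℤ) :=
  Finsupp.lmapDomain ℤ ℤ fun p => φ ∘ p

@[simp]
theorem tupleMap_single (φ : V → W) (n : ℕ) (p : Tuple V n) :
    tupleMap φ n (Finsupp.single p 1) = Finsupp.single (φ ∘ p : Tuple W n) 1 := by
  simp [tupleMap]

theorem bd_tupleMap (φ : V → W) (n : ℕ) (z : Tuple V (n + 1) →₀ ℤ) :
    bd (tupleFace W) n (tupleMap φ (n + 1) z) = tupleMap φ n (bd (tupleFace V) n z) := by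
  suffices H : bd (tupleFace W) n ∘ₗ tupleMap φ (n + 1) = tupleMap φ n ∘ₗ bd (tupleFace V) n from
    LinearMap.congr_fun H z
  refine linearMap_ext_single fun p => ?_
  simp only [LinearMap.comp_apply, tupleMap_single, boundary_single, map_sum, map_smul]
  rfl

theorem tupleMap_cone (φ : V → W) (b : V) (n : ℕ) (z : Tuple V n →₀ ℤ) :
    tupleMap φ (n + 1) (cone b n z) = cone (φ b) n (tupleMap φ n z) := by
  suffices H : tupleMap φ (n + 1) ∘ₗ cone b n = cone (φ b) n ∘ₗ tupleMap φ n from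
    LinearMap.congr_fun H z
  refine linearMap_ext_single fun p => ?_
  simp only [LinearMap.comp_apply, tupleMap_single, cone_single]
  congr 1
  funext k
  refine Fin.cases ?_ (fun k => ?_) k <;> simp

variable {bary bary'}

/-- Applied to affine maps, which preserve barycenters, this makes subdivision natural and lets it
pass from the standard simplex to singular simplices. -/
theorem tupleMap_sd {φ : V → W} (h : ∀ n p, φ (bary n p) = bary' n (φ ∘ p)) (n : ℕ)
    (z : Tuple V n →₀ ℤ) : tupleMap φ n (sd bary n z) = sd bary' n (tupleMap φ n z) := by
  suffices H : tupleMap φ n ∘ₗ sd bary n = sd bary' n ∘ₗ tupleMap φ n from LinearMap.congr_fun H z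
  clear z
  induction n with
  | zero => rfl
  | succ n ih =>
    refine linearMap_ext_single fun p => ?_
    have := LinearMap.congr_fun ih (bd (tupleFace V) n (Finsupp.single p 1))
    simp only [LinearMap.comp_apply] at this ⊢
    rw [sd_succ_single, tupleMap_cone, tupleMap_single, sd_succ_single, h, this,
      ← tupleMap_single, bd_tupleMap]

theorem tupleMap_sdHomotopy {φ : V → W} (h : ∀ n p, φ (bary n p) = bary' n (φ ∘ p)) (n : ℕ)
    (z : Tuple V n →₀ ℤ) :
    tupleMap φ (n + 1) (sdHomotopy bary n z) = sdHomotopy bary' n (tupleMap φ n z) := by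
  suffices H : tupleMap φ (n + 1) ∘ₗ sdHomotopy bary n = sdHomotopy bary' n ∘ₗ tupleMap φ n from
    LinearMap.congr_fun H z
  clear z
  induction n with
  | zero => simp [sdHomotopy]
  | succ n ih =>
    refine linearMap_ext_single fun p => ?_
    have := LinearMap.congr_fun ih (bd (tupleFace V) n (Finsupp.single p 1))
    simp only [LinearMap.comp_apply] at this ⊢
    rw [sdHomotopy_succ_single, tupleMap_cone, map_sub, tupleMap_single, sdHomotopy_succ_single,
      h, this, ← tupleMap_single, bd_tupleMap]

end Tuples

/-! ### Affine simplices -/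

section Affine

/-- The standard `n`-simplex. -/
abbrev Simplex (n : ℕ) : Type := stdSimplex ℝ (Fin (n + 1))

theorem affine_mem {k m : ℕ} (p : Tuple (Simplex m) k) (t : Simplex k) :
    ∑ i, t i • (p i : Fin (m + 1) → ℝ) ∈ stdSimplex ℝ (Fin (m + 1)) :=
  (convex_stdSimplex ℝ _).sum_mem (fun i _ => t.2.1 i) t.2.2 fun i _ => (p i).2

/-- The affine map between simplices with given values at the vertices. -/
def affineSimplex {k m : ℕ} (p : Tuple (Simplex m) k) : C(Simplex k, Simplex m) where
  toFun t := ⟨∑ i, t i • (p i : Fin (m + 1) → ℝ), affine_mem p t⟩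
  continuous_toFun := by
    refine Continuous.subtype_mk (continuous_finsetSum _ fun i _ => ?_) _
    exact ((continuous_apply i).comp continuous_subtype_val).smul continuous_const

theorem affineSimplex_coe {k m : ℕ} (p : Tuple (Simplex m) k) (t : Simplex k) :
    (affineSimplex p t : Fin (m + 1) → ℝ) = ∑ i, t i • (p i : Fin (m + 1) → ℝ) := rfl

theorem affineSimplex_apply {k m : ℕ} (p : Tuple (Simplex m) k) (t : Simplex k) (j : Fin (m + 1)) :
    affineSimplex p t j = ∑ i, t i * p i j := by
  rw [affineSimplex_coe, Finset.sum_apply]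
  rfl

/-- The tuple of the vertices of the standard simplex. -/
def vertexTuple (n : ℕ) : Tuple (Simplex n) n := fun i => stdSimplex.vertex i

theorem affineSimplex_vertexTuple (n : ℕ) : affineSimplex (vertexTuple n) = ContinuousMap.id _ := by
  ext t j
  simp only [affineSimplex_apply, vertexTuple, stdSimplex.vertex_coe, ContinuousMap.id_apply]
  simp [Pi.single_apply]

theorem affineSimplex_vertex {k m : ℕ} (p : Tuple (Simplex m) k) (i : Fin (k + 1)) :
    affineSimplex p (stdSimplex.vertex i) = p i := by
  ext j
  simp [affineSimplex_apply, Pi.single_apply]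

theorem affineSimplex_comp {l k m : ℕ} (p : Tuple (Simplex m) k) (q : Tuple (Simplex k) l) :
    (affineSimplex p).comp (affineSimplex q) = affineSimplex (affineSimplex p ∘ q) := by
  ext t j
  simp only [ContinuousMap.comp_apply, affineSimplex_apply, Function.comp_apply, Finset.sum_mul,
    Finset.mul_sum]
  rw [Finset.sum_comm]
  simp only [mul_assoc]

/-- The inclusion of a face of the standard simplex. -/
def simplexFace (n : ℕ) (i : Fin (n + 2)) : C(Simplex n, Simplex (n + 1)) :=
  ⟨stdSimplex.map (Fin.succAbove i), stdSimplex.continuous_map _⟩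

theorem simplexFace_apply_succAbove (n : ℕ) (i : Fin (n + 2)) (t : Simplex n) (k : Fin (n + 1)) :
    simplexFace n i t (i.succAbove k) = t k := by
  change stdSimplex.map (Fin.succAbove i) t (i.succAbove k) = t k
  rw [stdSimplex.map_coe, FunOnFinite.linearMap_apply_apply]
  simp [Finset.sum_filter]

theorem simplexFace_apply_self (n : ℕ) (i : Fin (n + 2)) (t : Simplex n) :
    simplexFace n i t i = 0 := by
  change stdSimplex.map (Fin.succAbove i) t i = 0
  rw [stdSimplex.map_coe, FunOnFinite.linearMap_apply_apply]
  simp [Fin.succAbove_ne]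

theorem affineSimplex_comp_simplexFace {k m : ℕ} (p : Tuple (Simplex m) (k + 1))
    (i : Fin (k + 2)) :
    (affineSimplex p).comp (simplexFace k i) = affineSimplex (tupleFace _ k i p) := by
  ext t j
  simp only [ContinuousMap.comp_apply, affineSimplex_apply]
  rw [Fin.sum_univ_succAbove _ i, simplexFace_apply_self]
  simp [simplexFace_apply_succAbove, orderedFace]

theorem affineSimplex_mem_closedBall {k m : ℕ} {p : Tuple (Simplex m) k} {b : Simplex m} {r : ℝ}
    (hp : ∀ i, p i ∈ closedBall b r) (t : Simplex k) : affineSimplex p t ∈ closedBall b r := by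
  have := (convex_closedBall (b : Fin (m + 1) → ℝ) r).sum_mem (t := Finset.univ)
    (fun i _ => t.2.1 i) t.2.2 (z := fun i => (p i : Fin (m + 1) → ℝ)) fun i _ => hp i
  exact this

theorem dist_affineSimplex_le {k m : ℕ} {p : Tuple (Simplex m) k} {d : ℝ} (hp : p ∈ tuplesMesh d k)
    (s t : Simplex k) : dist (affineSimplex p s) (affineSimplex p t) ≤ d :=
  affineSimplex_mem_closedBall (fun i => by
    have := affineSimplex_mem_closedBall (b := p i) (fun j => hp j i) t
    rwa [mem_closedBall, dist_comm]) s

/-- The barycenter of a tuple of points of a simplex. -/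
def bary (m n : ℕ) (p : Tuple (Simplex m) n) : Simplex m := affineSimplex p stdSimplex.barycenter

theorem affineSimplex_bary {k m n : ℕ} (p : Tuple (Simplex m) k) (q : Tuple (Simplex k) n) :
    affineSimplex p (bary k n q) = bary m n (affineSimplex p ∘ q) :=
  DFunLike.congr_fun (affineSimplex_comp p q) _

/-- The vector from the barycenter to `p j` is the average of the `n + 1` differences `p j - p i`,
one of which vanishes; hence the factor `n / (n + 1)`. -/
theorem dist_bary_le {m n : ℕ} {d : ℝ} {p : Tuple (Simplex m) n} (hp : p ∈ tuplesMesh d n)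
    (j : Fin (n + 1)) : dist (p j) (bary m n p) ≤ n / (n + 1) * d := by
  have hn : (0 : ℝ) < n + 1 := by positivity
  have h1 : (p j : Fin (m + 1) → ℝ) - (bary m n p : Fin (m + 1) → ℝ) =
      ((n : ℝ) + 1)⁻¹ • ∑ i, ((p j : Fin (m + 1) → ℝ) - p i) := by
    have hb : ∀ i, (stdSimplex.barycenter : Simplex n) i = ((n : ℝ) + 1)⁻¹ := fun i => by
      refine (stdSimplex.barycenter_apply (𝕜 := ℝ) i).trans ?_
      rw [Fintype.card_fin]
      push_cast
      rfl
    rw [bary, affineSimplex_coe]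
    simp only [hb]
    rw [Finset.sum_sub_distrib, Finset.sum_const, smul_sub, ← Finset.smul_sum]
    congr 1
    rw [Finset.card_univ, Fintype.card_fin, ← Nat.cast_smul_eq_nsmul ℝ, smul_smul]
    push_cast
    rw [inv_mul_cancel₀ hn.ne', one_smul]
  have h2 : ‖∑ i, ((p j : Fin (m + 1) → ℝ) - p i)‖ ≤ n * d := by
    rw [Fin.sum_univ_succAbove _ j, sub_self, zero_add]
    refine (norm_sum_le _ _).trans ?_
    refine (Finset.sum_le_card_nsmul _ _ d fun i _ => ?_).trans ?_
    · rw [← dist_eq_norm]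
      exact hp _ _
    · simp
  rw [Subtype.dist_eq, dist_eq_norm]
  change ‖(p j : Fin (m + 1) → ℝ) - (bary m n p : Fin (m + 1) → ℝ)‖ ≤ _
  rw [h1, norm_smul, Real.norm_of_nonneg (by positivity),
    div_mul_eq_mul_div, inv_mul_eq_div]
  gcongr

theorem sd_bary_mem_mesh (m n : ℕ) (d : ℝ) {z : Tuple (Simplex m) n →₀ ℤ}
    (hz : z ∈ Finsupp.supported ℤ ℤ (tuplesMesh d n)) :
    sd (bary m) n z ∈ Finsupp.supported ℤ ℤ (tuplesMesh ((n : ℝ) / (n + 1) * d) n) :=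
  sd_mem_mesh (bary m) (fun _ _ _ _ hp => affineSimplex_mem_closedBall hp _)
    (fun _ _ _ hp j => dist_bary_le hp j) n d hz

theorem iterate_sd_bary_mem_mesh (m n : ℕ) {z : Tuple (Simplex m) n →₀ ℤ} {d : ℝ}
    (hz : z ∈ Finsupp.supported ℤ ℤ (tuplesMesh d n)) (N : ℕ) :
    (sd (bary m) n)^[N] z ∈
      Finsupp.supported ℤ ℤ (tuplesMesh (((n : ℝ) / (n + 1)) ^ N * d) n) := by
  induction N with
  | zero => simpa using hz
  | succ N ih =>
    rw [Function.iterate_succ_apply', pow_succ', mul_assoc]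
    exact sd_bary_mem_mesh m n _ ih

end Affine

/-! ### Subdivision of singular chains -/

section Subdivision

variable {X : Type u} [TopologicalSpace X]

theorem singularFace_eq (n : ℕ) (i : Fin (n + 2)) (σ : SingularSimplex X (n + 1)) :
    singularFace n i σ = σ.comp (simplexFace n i) := rfl

theorem faceIdentity_singular : FaceIdentity (singularFace (X := X)) := by
  intro n i j σ h
  ext t
  simp only [singularFace, ContinuousMap.comp_apply, ContinuousMap.coe_mk,
    stdSimplex.map_comp_apply]
  congr 2
  funext k
  exact succAbove_succAbove_of_le h k

/-- The singular chain of affine simplices in a singular simplex. -/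
def push {m : ℕ} (σ : SingularSimplex X m) (n : ℕ) :
    (Tuple (Simplex m) n →₀ ℤ) →ₗ[ℤ] (SingularSimplex X n →₀ ℤ) :=
  Finsupp.lmapDomain ℤ ℤ fun p => σ.comp (affineSimplex p)

@[simp]
theorem push_single {m : ℕ} (σ : SingularSimplex X m) (n : ℕ) (p : Tuple (Simplex m) n) :
    push σ n (Finsupp.single p 1) = Finsupp.single (σ.comp (affineSimplex p)) 1 := by
  simp [push]

theorem push_vertexTuple {n : ℕ} (σ : SingularSimplex X n) :
    push σ n (Finsupp.single (vertexTuple n) 1) = Finsupp.single σ 1 := by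
  rw [push_single, affineSimplex_vertexTuple, ContinuousMap.comp_id]

theorem bd_push {m : ℕ} (σ : SingularSimplex X m) (n : ℕ) (c : Tuple (Simplex m) (n + 1) →₀ ℤ) :
    bd singularFace n (push σ (n + 1) c) = push σ n (bd (tupleFace _) n c) := by
  suffices H : bd singularFace n ∘ₗ push σ (n + 1) = push σ n ∘ₗ bd (tupleFace _) n from
    LinearMap.congr_fun H c
  refine linearMap_ext_single fun p => ?_
  simp only [LinearMap.comp_apply, push_single, boundary_single, map_sum, map_smul,
    singularFace_eq, ContinuousMap.comp_assoc, affineSimplex_comp_simplexFace]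

theorem push_comp {k m : ℕ} (σ : SingularSimplex X m) (p : Tuple (Simplex m) k) (n : ℕ)
    (c : Tuple (Simplex k) n →₀ ℤ) :
    push (σ.comp (affineSimplex p)) n c = push σ n (tupleMap (affineSimplex p) n c) := by
  suffices H : push (σ.comp (affineSimplex p)) n = push σ n ∘ₗ tupleMap (affineSimplex p) n from
    LinearMap.congr_fun H c
  refine linearMap_ext_single fun q => ?_
  simp only [LinearMap.comp_apply, push_single, tupleMap_single, ContinuousMap.comp_assoc,
    affineSimplex_comp]

theorem affineSimplex_comp_vertexTuple {k m : ℕ} (p : Tuple (Simplex m) k) :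
    (affineSimplex p ∘ vertexTuple k : Tuple (Simplex m) k) = p :=
  funext fun i => affineSimplex_vertex p i

/-- Barycentric subdivision of singular chains. -/
def singularSd (n : ℕ) : (SingularSimplex X n →₀ ℤ) →ₗ[ℤ] (SingularSimplex X n →₀ ℤ) :=
  Finsupp.linearCombination ℤ fun σ =>
    push σ n (sd (bary n) n (Finsupp.single (vertexTuple n) 1))

/-- The homotopy between the identity and the subdivision of singular chains. -/
def singularSdHomotopy (n : ℕ) :
    (SingularSimplex X n →₀ ℤ) →ₗ[ℤ] (SingularSimplex X (n + 1) →₀ ℤ) :=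
  Finsupp.linearCombination ℤ fun σ =>
    push σ (n + 1) (sdHomotopy (bary n) n (Finsupp.single (vertexTuple n) 1))

theorem singularSd_single (n : ℕ) (σ : SingularSimplex X n) :
    singularSd n (Finsupp.single σ 1) =
      push σ n (sd (bary n) n (Finsupp.single (vertexTuple n) 1)) := by
  simp [singularSd]

theorem singularSdHomotopy_single (n : ℕ) (σ : SingularSimplex X n) :
    singularSdHomotopy n (Finsupp.single σ 1) =
      push σ (n + 1) (sdHomotopy (bary n) n (Finsupp.single (vertexTuple n) 1)) := by
  simp [singularSdHomotopy]

theorem singularSd_push {m : ℕ} (σ : SingularSimplex X m) (n : ℕ)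
    (c : Tuple (Simplex m) n →₀ ℤ) : singularSd n (push σ n c) = push σ n (sd (bary m) n c) := by
  suffices H : singularSd n ∘ₗ push σ n = push σ n ∘ₗ sd (bary m) n from LinearMap.congr_fun H c
  refine linearMap_ext_single fun p => ?_
  simp only [LinearMap.comp_apply, push_single, singularSd_single]
  rw [push_comp, tupleMap_sd (fun l q => affineSimplex_bary p q), tupleMap_single,
    affineSimplex_comp_vertexTuple]

theorem singularSdHomotopy_push {m : ℕ} (σ : SingularSimplex X m) (n : ℕ)
    (c : Tuple (Simplex m) n →₀ ℤ) :
    singularSdHomotopy n (push σ n c) = push σ (n + 1) (sdHomotopy (bary m) n c) := by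
  suffices H : singularSdHomotopy n ∘ₗ push σ n = push σ (n + 1) ∘ₗ sdHomotopy (bary m) n from
    LinearMap.congr_fun H c
  refine linearMap_ext_single fun p => ?_
  simp only [LinearMap.comp_apply, push_single, singularSdHomotopy_single]
  rw [push_comp, tupleMap_sdHomotopy (fun l q => affineSimplex_bary p q), tupleMap_single,
    affineSimplex_comp_vertexTuple]

theorem bd_singularSd (n : ℕ) (z : SingularSimplex X (n + 1) →₀ ℤ) :
    bd singularFace n (singularSd (n + 1) z) = singularSd n (bd singularFace n z) := by
  suffices H : bd (singularFace (X := X)) n ∘ₗ singularSd (n + 1) =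
    singularSd n ∘ₗ bd singularFace n from LinearMap.congr_fun H z
  refine linearMap_ext_single fun σ => ?_
  simp only [LinearMap.comp_apply]
  rw [singularSd_single, bd_push, bd_sd, ← singularSd_push, ← bd_push, push_vertexTuple]

/-- By naturality it suffices to know the identity for the vertex tuple of the standard simplex,
where it is the homotopy formula for tuples; `push` carries it to every singular simplex. -/
theorem isHomotopyOn_singularSd (A : ∀ n, Set (SingularSimplex X n)) :
    IsHomotopyOn singularFace singularFace A (fun _ => LinearMap.id) singularSd
      singularSdHomotopy := by
  refine ⟨fun z _ => ?_, fun n z _ => ?_⟩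
  · suffices H : bd (singularFace (X := X)) 0 ∘ₗ singularSdHomotopy 0 =
      LinearMap.id - singularSd 0 from LinearMap.congr_fun H z
    refine linearMap_ext_single fun σ => ?_
    simp only [LinearMap.comp_apply, LinearMap.sub_apply, LinearMap.id_apply]
    rw [singularSdHomotopy_single, bd_push, bd_sdHomotopy_zero, map_sub, push_vertexTuple,
      singularSd_single]
  · suffices H : bd (singularFace (X := X)) (n + 1) ∘ₗ singularSdHomotopy (n + 1) +
      singularSdHomotopy n ∘ₗ bd singularFace n = LinearMap.id - singularSd (n + 1) from
      LinearMap.congr_fun H z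
    refine linearMap_ext_single fun σ => ?_
    simp only [LinearMap.comp_apply, LinearMap.sub_apply, LinearMap.id_apply, LinearMap.add_apply]
    have h : bd singularFace n (Finsupp.single σ 1) =
        push σ n (bd (tupleFace _) n (Finsupp.single (vertexTuple (n + 1)) 1)) := by
      rw [← bd_push, push_vertexTuple]
    rw [singularSdHomotopy_single, bd_push, h, singularSdHomotopy_push, ← map_add,
      bd_sdHomotopy_succ, map_sub, push_vertexTuple, singularSd_single]

/-- Families of singular simplices that contain with a simplex all simplices in its image. -/
def IsHereditary (C : ∀ n, Set (SingularSimplex X n)) : Prop :=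
  ∀ m n, ∀ σ ∈ C m, ∀ τ : SingularSimplex X n, (∀ a, ∃ b, τ a = σ b) → τ ∈ C n

variable {C : ∀ n, Set (SingularSimplex X n)}

theorem IsHereditary.faceClosed (hC : IsHereditary C) : FaceClosed singularFace C :=
  fun n σ hσ _ => hC (n + 1) n σ hσ _ fun _ => ⟨_, rfl⟩

theorem IsHereditary.push_mem (hC : IsHereditary C) {m : ℕ} {σ : SingularSimplex X m}
    (hσ : σ ∈ C m) (n : ℕ) (c : Tuple (Simplex m) n →₀ ℤ) :
    push σ n c ∈ Finsupp.supported ℤ ℤ (C n) := by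
  refine map_mem_of_single (A := univ) (fun p _ => ?_) (by simp)
  rw [push_single]
  exact single_mem_supported (hC m n σ hσ _ fun a => ⟨_, rfl⟩)

theorem IsHereditary.mapsChains_singularSd (hC : IsHereditary C) : MapsChains C C singularSd :=
  fun n _ hz => map_mem_of_single (fun σ hσ => by
    rw [singularSd_single]
    exact hC.push_mem hσ _ _) hz

theorem IsHereditary.mapsChainsSucc_singularSdHomotopy (hC : IsHereditary C) :
    MapsChainsSucc C C singularSdHomotopy :=
  fun n _ hz => map_mem_of_single (fun σ hσ => by
    rw [singularSdHomotopy_single]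
    exact hC.push_mem hσ _ _) hz

theorem bd_iterate_singularSd (N n : ℕ) (z : SingularSimplex X (n + 1) →₀ ℤ) :
    bd singularFace n ((singularSd (n + 1))^[N] z) =
      (singularSd n)^[N] (bd singularFace n z) := by
  induction N with
  | zero => rfl
  | succ N ih => rw [Function.iterate_succ_apply', bd_singularSd, ih, Function.iterate_succ_apply']

theorem IsHereditary.iterate_singularSd_mem (hC : IsHereditary C) (N n : ℕ)
    {z : SingularSimplex X n →₀ ℤ} (hz : z ∈ Finsupp.supported ℤ ℤ (C n)) :
    (singularSd n)^[N] z ∈ Finsupp.supported ℤ ℤ (C n) := by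
  induction N with
  | zero => exact hz
  | succ N ih =>
    rw [Function.iterate_succ_apply']
    exact hC.mapsChains_singularSd n _ ih

theorem isPairMap_singularSd {A B : ∀ n, Set (SingularSimplex X n)} (hA : IsHereditary A)
    (hB : IsHereditary B) : IsPairMap singularFace singularFace A B A B singularSd :=
  ⟨fun n z _ => bd_singularSd n z, hA.mapsChains_singularSd, hB.mapsChains_singularSd⟩

theorem iterate_singularSd_mem_relCycles {A B : ∀ n, Set (SingularSimplex X n)}
    (hA : IsHereditary A) (hB : IsHereditary B) (N : ℕ) {n : ℕ} {z : SingularSimplex X n →₀ ℤ}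
    (hz : z ∈ relCycles singularFace A B n) :
    (singularSd n)^[N] z ∈ relCycles singularFace A B n := by
  induction N with
  | zero => exact hz
  | succ N ih =>
    rw [Function.iterate_succ_apply']
    exact (isPairMap_singularSd hA hB).map_relCycles n ih

theorem sub_iterate_singularSd_mem {A B : ∀ n, Set (SingularSimplex X n)} (hA : IsHereditary A)
    (hB : IsHereditary B) (N : ℕ) {n : ℕ} {z : SingularSimplex X n →₀ ℤ}
    (hz : z ∈ relCycles singularFace A B n) :
    z - (singularSd n)^[N] z ∈ relBoundaries singularFace A B n := by
  induction N with
  | zero => simp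
  | succ N ih =>
    have := (isHomotopyOn_singularSd A).sub_mem hA.mapsChainsSucc_singularSdHomotopy
      hB.mapsChainsSucc_singularSdHomotopy (iterate_singularSd_mem_relCycles hA hB N hz)
    rw [Function.iterate_succ_apply', ← sub_add_sub_cancel _ ((singularSd n)^[N] z)]
    exact add_mem ih this

theorem isHereditary_singularIn (A : Set X) : IsHereditary (singularIn A) := by
  intro m n σ hσ τ hτ a
  obtain ⟨b, hb⟩ := hτ a
  exact hb ▸ hσ b

end Subdivision

/-! ### Small singular simplices -/

section Small

variable {X : Type u} [MetricSpace X]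

/-- Singular simplices in `A` of diameter at most `δ`. -/
def smallIn (δ : ℝ) (A : Set X) (n : ℕ) : Set (SingularSimplex X n) :=
  {σ | σ ∈ singularIn A n ∧ ∀ a b, dist (σ a) (σ b) ≤ δ}

theorem smallIn_mono (δ : ℝ) {A A' : Set X} (h : A ⊆ A') (n : ℕ) :
    smallIn δ A n ⊆ smallIn δ A' n :=
  fun _ hσ => ⟨singularIn_mono h n hσ.1, hσ.2⟩

theorem smallIn_subset (δ : ℝ) (A : Set X) (n : ℕ) : smallIn δ A n ⊆ singularIn A n :=
  fun _ hσ => hσ.1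

theorem isHereditary_smallIn (δ : ℝ) (A : Set X) : IsHereditary (smallIn δ A) := by
  refine fun m n σ hσ τ hτ => ⟨isHereditary_singularIn A m n σ hσ.1 τ hτ, fun a a' => ?_⟩
  obtain ⟨b, hb⟩ := hτ a
  obtain ⟨b', hb'⟩ := hτ a'
  rw [hb, hb']
  exact hσ.2 b b'

/-- Iterated subdivision shrinks the mesh in the standard simplex geometrically, and uniform
continuity of `σ` turns a small mesh into small images. -/
theorem exists_iterate_singularSd_single_mem {δ : ℝ} (hδ : 0 < δ) {n : ℕ}
    (σ : SingularSimplex X n) :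
    ∃ N, (singularSd n)^[N] (Finsupp.single σ 1) ∈ Finsupp.supported ℤ ℤ (smallIn δ univ n) := by
  obtain ⟨η, hη, hσ⟩ := Metric.uniformContinuous_iff.1
    (CompactSpace.uniformContinuous_of_continuous σ.continuous) δ hδ
  have hlt : (n : ℝ) / (n + 1) < 1 := (div_lt_one (by positivity)).2 (by linarith)
  obtain ⟨N, hN⟩ := exists_pow_lt_of_lt_one hη hlt
  refine ⟨N, ?_⟩
  -- The standard simplex has diameter at most 1 in the sup metric, so the initial mesh is at most
  -- 1.
  have hv : Finsupp.single (vertexTuple n) (1 : ℤ) ∈ Finsupp.supported ℤ ℤ (tuplesMesh 1 n) :=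
    single_mem_supported fun i j => (dist_le_diam_of_mem (bounded_stdSimplex _)
      (vertexTuple n i).2 (vertexTuple n j).2).trans diam_stdSimplex_le
  have hmem := iterate_sd_bary_mem_mesh n n hv N
  have heq : ∀ N, (singularSd n)^[N] (Finsupp.single σ 1) =
      push σ n ((sd (bary n) n)^[N] (Finsupp.single (vertexTuple n) 1)) := by
    intro N
    induction N with
    | zero => simp only [Function.iterate_zero, id, push_vertexTuple]
    | succ N ih => rw [Function.iterate_succ_apply', ih, singularSd_push,
        Function.iterate_succ_apply']
  rw [heq]
  refine map_mem_of_single (fun p hp => ?_) hmem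
  rw [push_single]
  refine single_mem_supported ⟨fun _ => mem_univ _, fun a b => (hσ ?_).le⟩
  exact (dist_affineSimplex_le hp a b).trans_lt (by simpa using hN)

theorem exists_iterate_singularSd_mem {δ : ℝ} (hδ : 0 < δ) {n : ℕ}
    (z : SingularSimplex X n →₀ ℤ) :
    ∃ N₀, ∀ N ≥ N₀, (singularSd n)^[N] z ∈ Finsupp.supported ℤ ℤ (smallIn δ univ n) := by
  have hmono : ∀ (z : SingularSimplex X n →₀ ℤ) N,
      (singularSd n)^[N] z ∈ Finsupp.supported ℤ ℤ (smallIn δ univ n) →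
      ∀ N' ≥ N, (singularSd n)^[N'] z ∈ Finsupp.supported ℤ ℤ (smallIn δ univ n) := by
    intro z N h N' hN'
    obtain ⟨k, rfl⟩ := Nat.exists_eq_add_of_le' hN'
    rw [Function.iterate_add_apply]
    exact (isHereditary_smallIn δ univ).iterate_singularSd_mem k n h
  induction z using Finsupp.induction_linear with
  | zero => exact ⟨0, fun N _ => by simp [iterate_map_zero]⟩
  | add z w hz hw =>
    obtain ⟨N, hN⟩ := hz
    obtain ⟨N', hN'⟩ := hw
    refine ⟨max N N', fun M hM => ?_⟩
    rw [iterate_map_add]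
    exact add_mem (hN M ((le_max_left _ _).trans hM)) (hN' M ((le_max_right _ _).trans hM))
  | single σ k =>
    obtain ⟨N, hN⟩ := exists_iterate_singularSd_single_mem hδ σ
    refine ⟨N, hmono _ N ?_⟩
    have : Finsupp.single σ k = k • Finsupp.single σ (1 : ℤ) := by simp
    rw [this, iterate_map_zsmul]
    exact Submodule.smul_mem _ _ hN

theorem mem_supported_smallIn {δ : ℝ} {A : Set X} {n : ℕ} {z : SingularSimplex X n →₀ ℤ}
    (h : z ∈ Finsupp.supported ℤ ℤ (singularIn A n))
    (h' : z ∈ Finsupp.supported ℤ ℤ (smallIn δ univ n)) :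
    z ∈ Finsupp.supported ℤ ℤ (smallIn δ A n) :=
  fun _ hσ => ⟨h hσ, (h' hσ).2⟩

/-- The homology of a pair of subsets is the homology of its small singular chains. -/
theorem relMap_smallIn_bijective {δ : ℝ} (hδ : 0 < δ) (A B : Set X) (n : ℕ) :
    Function.Bijective (relMap (face := singularFace) (smallIn_subset δ A)
      (smallIn_subset δ B) n) := by
  have hA := isHereditary_singularIn A
  have hB := isHereditary_singularIn B
  have hA' := isHereditary_smallIn δ A
  have hB' := isHereditary_smallIn δ B
  constructor
  · rw [← LinearMap.ker_eq_bot, eq_bot_iff]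
    intro x hx
    obtain ⟨z, rfl⟩ := Submodule.Quotient.mk_surjective _ x
    rw [LinearMap.mem_ker, relMap_mk, Submodule.Quotient.mk_eq_zero] at hx
    rw [Submodule.mem_bot, Submodule.Quotient.mk_eq_zero]
    obtain ⟨w, hw, b, hb, hz⟩ := mem_relBoundaries.1 hx
    obtain ⟨N₁, h₁⟩ := exists_iterate_singularSd_mem hδ w
    obtain ⟨N₂, h₂⟩ := exists_iterate_singularSd_mem hδ b
    set N := max N₁ N₂
    -- The cycle `z` is already small, so it differs from its subdivision by a small relative
    -- boundary. The subdivision bounds in turn, by subdividing `w` and `b`.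
    have h3 := sub_iterate_singularSd_mem hA' hB' N z.2
    have h4 : (singularSd n)^[N] (z : SingularSimplex X n →₀ ℤ) ∈
        relBoundaries singularFace (smallIn δ A) (smallIn δ B) n := by
      refine mem_relBoundaries.2 ⟨_, mem_supported_smallIn (hA.iterate_singularSd_mem N _ hw)
        (h₁ N (le_max_left _ _)), _, mem_supported_smallIn (hB.iterate_singularSd_mem N _ hb)
        (h₂ N (le_max_right _ _)), ?_⟩
      rw [bd_iterate_singularSd, ← iterate_map_add, hz]
      rfl
    have := add_mem h3 h4
    rwa [sub_add_cancel] at this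
  · intro x
    obtain ⟨z, rfl⟩ := Submodule.Quotient.mk_surjective _ x
    obtain ⟨N₀, h₀⟩ := exists_iterate_singularSd_mem hδ (z : SingularSimplex X n →₀ ℤ)
    -- In positive degrees a single `N` has to make both the chain and its boundary small.
    have key : ∃ N, (singularSd n)^[N] (z : SingularSimplex X n →₀ ℤ) ∈
        relCycles singularFace (smallIn δ A) (smallIn δ B) n := by
      cases n with
      | zero =>
        refine ⟨N₀, mem_relCycles_zero.2 (mem_supported_smallIn
          (hA.iterate_singularSd_mem _ _ (mem_relCycles_zero.1 z.2)) (h₀ _ le_rfl))⟩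
      | succ n =>
        obtain ⟨N₁, h₁⟩ := exists_iterate_singularSd_mem hδ
          (bd singularFace n (z : SingularSimplex X (n + 1) →₀ ℤ))
        have hz := mem_relCycles_succ.1 z.2
        refine ⟨max N₀ N₁, mem_relCycles_succ.2 ⟨mem_supported_smallIn
          (hA.iterate_singularSd_mem _ _ hz.1) (h₀ _ (le_max_left _ _)), ?_⟩⟩
        rw [bd_iterate_singularSd]
        exact mem_supported_smallIn (hB.iterate_singularSd_mem _ _ hz.2) (h₁ _ (le_max_right _ _))
    obtain ⟨N, hN⟩ := key
    refine ⟨Submodule.Quotient.mk ⟨_, hN⟩, ?_⟩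
    rw [relMap_mk]
    refine ((relHomology_mk_eq_iff _ _).2 ?_).symm
    exact sub_iterate_singularSd_mem hA hB N z.2

theorem isAcyclic_smallIn {δ : ℝ} (hδ : 0 < δ) {A : Set X}
    (hA : IsAcyclic singularFace (singularIn A)) : IsAcyclic singularFace (smallIn δ A) := by
  refine ⟨?_, fun n z hz hz' => ?_⟩
  · obtain ⟨σ, hσ⟩ := hA.nonempty
    refine ⟨σ, hσ, fun a b => ?_⟩
    rw [Subsingleton.elim a b, dist_self]
    exact hδ.le
  · obtain ⟨w, hw, hwz⟩ := hA.exists_boundary n z (Finsupp.supported_mono (smallIn_subset δ A n) hz)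
      hz'
    obtain ⟨N, hN⟩ := exists_iterate_singularSd_mem hδ w
    -- With an empty second family, relative boundaries are honest boundaries, so the relative
    -- subdivision lemma applies to reduced cycles.
    have hcyc : z ∈ relCycles singularFace (smallIn δ A) (fun _ => ∅) n := by
      cases n with
      | zero => exact mem_relCycles_zero.2 hz
      | succ n =>
        refine mem_relCycles_succ.2 ⟨hz, ?_⟩
        change bd _ _ z = 0 at hz'
        rw [hz']
        exact zero_mem _
    have h := sub_iterate_singularSd_mem (isHereditary_smallIn δ A)
      (fun _ _ _ h => h.elim) N hcyc
    obtain ⟨w', hw', b, hb, hz''⟩ := mem_relBoundaries.1 h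
    have hb0 : b = 0 := by simpa using hb
    refine ⟨w' + (singularSd (n + 1))^[N] w, add_mem hw' (mem_supported_smallIn
      ((isHereditary_singularIn A).iterate_singularSd_mem _ _ hw) (hN N le_rfl)), ?_⟩
    rw [map_add, bd_iterate_singularSd, hwz]
    rw [hb0, add_zero] at hz''
    rw [hz'', sub_add_cancel]

end Small

/-! ### Contractible sets have vanishing reduced homology -/

/-- The operator `κ` satisfies `∂κz = z - κ∂z` in positive degrees, and `∂κz` is `z` minus a
multiple of `pt` by its augmentation in degree 0. It therefore fills all reduced cycles. -/
theorem isAcyclic_of_extraDegeneracy {S : ℕ → Type u}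
    {face : ∀ n, Fin (n + 2) → S (n + 1) → S n} {C : ∀ n, Set (S n)} (κ : ∀ n, S n → S (n + 1))
    (pt : S 0) (hpt : pt ∈ C 0) (hκ : ∀ n, ∀ σ ∈ C n, κ n σ ∈ C (n + 1))
    (h0 : ∀ n, ∀ σ ∈ C n, face n 0 (κ n σ) = σ) (h1 : ∀ σ ∈ C 0, face 0 1 (κ 0 σ) = pt)
    (hs : ∀ n, ∀ σ ∈ C (n + 1), ∀ i : Fin (n + 2),
      face (n + 1) i.succ (κ (n + 1) σ) = κ n (face n i σ)) : IsAcyclic face C := by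
  refine ⟨⟨pt, hpt⟩, fun n z hz hz' => ⟨Finsupp.lmapDomain ℤ ℤ (κ n) z,
    map_mem_of_single (fun σ hσ => by simpa using single_mem_supported (hκ n σ hσ)) hz, ?_⟩⟩
  cases n with
  | zero =>
    have h := map_eq_of_single (f := bd face 0 ∘ₗ Finsupp.lmapDomain ℤ ℤ (κ 0))
      (g := LinearMap.id - (augmentation (S 0)).smulRight (Finsupp.single pt (1 : ℤ)))
      (fun σ hσ => by
        simp only [LinearMap.comp_apply, Finsupp.lmapDomain_apply, Finsupp.mapDomain_single]
        rw [boundary_single, Fin.sum_univ_two, h0 0 σ hσ, h1 σ hσ]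
        simp [sub_eq_add_neg]) hz
    change augmentation _ z = 0 at hz'
    simpa [hz'] using h
  | succ n =>
    have h := map_eq_of_single (f := bd face (n + 1) ∘ₗ Finsupp.lmapDomain ℤ ℤ (κ (n + 1)))
      (g := LinearMap.id - Finsupp.lmapDomain ℤ ℤ (κ n) ∘ₗ bd face n)
      (fun σ hσ => by
        simp only [LinearMap.comp_apply, LinearMap.sub_apply, LinearMap.id_apply,
          Finsupp.lmapDomain_apply, Finsupp.mapDomain_single]
        rw [boundary_single, boundary_single, Fin.sum_univ_succ, h0 (n + 1) σ hσ]
        simp only [← Finsupp.lmapDomain_apply ℤ ℤ, map_sum, map_smul, hs n σ hσ]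
        simp [pow_succ, sub_eq_add_neg]) hz
    change bd _ _ z = 0 at hz'
    simpa [hz'] using h

/-- The quotient map from the cylinder over a simplex onto the cone. -/
def coneMap (n : ℕ) : C(Simplex n × unitInterval, Simplex (n + 1)) where
  toFun q := ⟨Fin.cons (1 - (q.2 : ℝ)) fun k => (q.2 : ℝ) * q.1 k, by
    refine ⟨fun j => ?_, ?_⟩
    · refine Fin.cases ?_ (fun k => ?_) j
      · simpa using q.2.2.2
      · exact mul_nonneg q.2.2.1 (q.1.2.1 k)
    · rw [Fin.sum_univ_succ]
      simp [← Finset.mul_sum]⟩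
  continuous_toFun := by
    refine Continuous.subtype_mk (continuous_pi fun j => ?_) _
    refine Fin.cases ?_ (fun k => ?_) j
    · simp only [Fin.cons_zero]
      fun_prop
    · simp only [Fin.cons_succ]
      exact (continuous_subtype_val.comp continuous_snd).mul
        ((continuous_apply k).comp (continuous_subtype_val.comp continuous_fst))

@[simp]
theorem coneMap_zero (n : ℕ) (s : Simplex n) (u : unitInterval) : coneMap n (s, u) 0 = 1 - u := rfl

@[simp]
theorem coneMap_succ (n : ℕ) (s : Simplex n) (u : unitInterval) (k : Fin (n + 1)) :
    coneMap n (s, u) k.succ = u * s k := rfl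

theorem coneMap_surjective (n : ℕ) : Function.Surjective (coneMap n) := by
  intro t
  have hsum : ∑ k : Fin (n + 1), t k.succ = 1 - t 0 := by
    have := stdSimplex.sum_eq_one t
    rw [Fin.sum_univ_succ] at this
    linarith
  let u : unitInterval := ⟨1 - t 0, by simp, by simp⟩
  by_cases hu : 1 - t 0 = 0
  · have h0 : ∀ k : Fin (n + 1), t k.succ = 0 := fun k =>
      (Finset.sum_eq_zero_iff_of_nonneg (fun _ _ => stdSimplex.zero_le t _)).1
        (hsum.trans hu) k (Finset.mem_univ k)
    refine ⟨(stdSimplex.vertex 0, u), ?_⟩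
    ext j
    refine Fin.cases ?_ (fun k => ?_) j
    · simp [u]
    · simp [u, hu, h0 k]
  · refine ⟨(⟨fun k => t k.succ / (1 - t 0), fun k => ?_, ?_⟩, u), ?_⟩
    · exact div_nonneg (stdSimplex.zero_le t _) u.2.1
    · rw [← Finset.sum_div, hsum, div_self hu]
    · ext j
      refine Fin.cases ?_ (fun k => ?_) j
      · simp [u]
      · rw [coneMap_succ]
        exact mul_div_cancel₀ _ hu

/-- A continuous surjection from a compact space to a Hausdorff space is closed. The quotient
property lets a homotopy that is constant at time 0 descend to a singular simplex of one dimension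
more. -/
theorem isQuotientMap_coneMap (n : ℕ) : IsQuotientMap (coneMap n) :=
  (coneMap n).continuous.isClosedMap.isQuotientMap (coneMap n).continuous (coneMap_surjective n)

theorem coneMap_eq {n : ℕ} {s s' : Simplex n} {u u' : unitInterval}
    (h : coneMap n (s, u) = coneMap n (s', u')) : u = u' ∧ (u = 0 ∨ s = s') := by
  have hu : u = u' := by
    have := DFunLike.congr_fun h 0
    simp only [coneMap_zero] at this
    exact Subtype.ext (by linarith)
  refine ⟨hu, or_iff_not_imp_left.2 fun h0 => ?_⟩
  subst hu
  ext k
  have := DFunLike.congr_fun h k.succ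
  simp only [coneMap_succ] at this
  exact mul_left_cancel₀ (fun h => h0 (Subtype.ext h)) this

theorem simplexFace_zero (n : ℕ) (s : Simplex n) : simplexFace n 0 s = coneMap n (s, 1) := by
  ext j
  refine Fin.cases ?_ (fun k => ?_) j
  · simp [simplexFace_apply_self]
  · have := simplexFace_apply_succAbove n 0 s k
    rw [Fin.succAbove_zero] at this
    simpa using this

theorem simplexFace_succ_coneMap (n : ℕ) (i : Fin (n + 2)) (s : Simplex n) (u : unitInterval) :
    simplexFace (n + 1) i.succ (coneMap n (s, u)) = coneMap (n + 1) (simplexFace n i s, u) := by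
  ext j
  induction j using Fin.succAboveCases i.succ with
  | x => rw [simplexFace_apply_self, coneMap_succ, simplexFace_apply_self, mul_zero]
  | p k =>
    rw [simplexFace_apply_succAbove]
    refine Fin.cases ?_ (fun k => ?_) k
    · rw [Fin.succ_succAbove_zero, coneMap_zero, coneMap_zero]
    · rw [Fin.succ_succAbove_succ, coneMap_succ, coneMap_succ, simplexFace_apply_succAbove]

section Contraction

variable {X : Type u} [TopologicalSpace X]

/-- `H` contracts the set `Y` to its point `z`. -/
structure Contracts (Y : Set X) (z : X) (H : X → unitInterval → X) : Prop where
  mem : z ∈ Y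
  continuousOn : ContinuousOn (fun q : X × unitInterval => H q.1 q.2) (Y ×ˢ univ)
  maps : ∀ y ∈ Y, ∀ u, H y u ∈ Y
  zero : ∀ y ∈ Y, H y 0 = z
  one : ∀ y ∈ Y, H y 1 = y

variable {Y : Set X} {z : X} {H : X → unitInterval → X}

/-- At time 0 the contraction does not depend on the point, so it respects the identifications made
by `coneMap`. Face 0 of the result is `σ`, and vertex 0 is the apex. -/
theorem Contracts.exists_cone (hH : Contracts Y z H) (n : ℕ) (σ : SingularSimplex X n)
    (hσ : σ ∈ singularIn Y n) :
    ∃ τ : SingularSimplex X (n + 1), ∀ s u, τ (coneMap n (s, u)) = H (σ s) u := by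
  let G : C(Simplex n × unitInterval, X) := ⟨fun q => H (σ q.1) q.2,
    hH.continuousOn.comp_continuous (f := fun q : Simplex n × unitInterval => (σ q.1, q.2))
      (by fun_prop) fun q => ⟨hσ _, mem_univ _⟩⟩
  have hG : Function.FactorsThrough G (coneMap n) := by
    rintro ⟨s, u⟩ ⟨s', u'⟩ h
    obtain ⟨rfl, rfl | rfl⟩ := coneMap_eq h
    · exact (hH.zero _ (hσ s)).trans (hH.zero _ (hσ s')).symm
    · rfl
  exact ⟨(isQuotientMap_coneMap n).lift G hG, fun s u =>
    DFunLike.congr_fun ((isQuotientMap_coneMap n).lift_comp G hG) (s, u)⟩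

theorem Contracts.isAcyclic (hH : Contracts Y z H) : IsAcyclic singularFace (singularIn Y) := by
  classical
  let κ : ∀ n, SingularSimplex X n → SingularSimplex X (n + 1) := fun n σ =>
    if hσ : σ ∈ singularIn Y n then (hH.exists_cone n σ hσ).choose else ContinuousMap.const _ z
  have hκ : ∀ n, ∀ σ ∈ singularIn Y n, ∀ s u, κ n σ (coneMap n (s, u)) = H (σ s) u := by
    intro n σ hσ
    simp only [κ, dif_pos hσ]
    exact (hH.exists_cone n σ hσ).choose_spec
  refine isAcyclic_of_extraDegeneracy κ (ContinuousMap.const _ z) (fun _ => hH.mem) ?_ ?_ ?_ ?_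
  · intro n σ hσ t
    obtain ⟨⟨s, u⟩, rfl⟩ := coneMap_surjective n t
    rw [hκ n σ hσ]
    exact hH.maps _ (hσ s) u
  · intro n σ hσ
    ext s
    rw [singularFace_eq, ContinuousMap.comp_apply, simplexFace_zero, hκ n σ hσ]
    exact hH.one _ (hσ s)
  · intro σ hσ
    ext s
    have : simplexFace 0 1 s = coneMap 0 (s, 0) := by
      ext j
      fin_cases j
      · have h1 := simplexFace_apply_succAbove 0 1 s 0
        have h2 : (1 : Fin 2).succAbove 0 = 0 := rfl
        rw [h2] at h1
        simp [h1]
      · have h1 := simplexFace_apply_self 0 1 s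
        have h2 := coneMap_succ 0 s 0 0
        simpa [h1] using h2.symm
    rw [singularFace_eq, ContinuousMap.comp_apply, this, hκ 0 σ hσ]
    exact hH.zero _ (hσ s)
  · intro n σ hσ i
    have hface : singularFace n i σ ∈ singularIn Y n :=
      (isHereditary_singularIn Y).faceClosed n σ hσ i
    ext t
    obtain ⟨⟨s, u⟩, rfl⟩ := coneMap_surjective n t
    rw [singularFace_eq, ContinuousMap.comp_apply, simplexFace_succ_coneMap, hκ _ σ hσ,
      hκ n _ hface]
    rfl

end Contraction

/-! ### Geodesic contractions -/

section Geodesic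

variable {X : Type u} [MetricSpace X]

open Classical in
/-- The unique shortest path between two points, if there is one. -/
def geodesic (y z : X) : C(unitInterval, X) :=
  if h : ∃! γ : C(unitInterval, X), IsShortestPath γ y z then h.choose else ContinuousMap.const _ y

theorem geodesic_eq {y z : X} {γ : C(unitInterval, X)} (hγ : IsShortestPath γ y z)
    (h : ∀ γ' : C(unitInterval, X), IsShortestPath γ' y z → γ' = γ) : geodesic y z = γ := by
  have hex : ∃! γ : C(unitInterval, X), IsShortestPath γ y z := ⟨γ, hγ, h⟩
  rw [geodesic, dif_pos hex]
  exact h _ hex.choose_spec.1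

/-- Closed sets that contain the geodesics between their points, with a continuous dependence on
the end points. -/
structure IsGeodesicallyClosed (C : Set X) : Prop where
  isClosed : IsClosed C
  continuousOn : ContinuousOn (fun q : X × X => geodesic q.1 q.2) (C ×ˢ C)
  isShortest : ∀ y ∈ C, ∀ z ∈ C, IsShortestPath (geodesic y z) y z
  maps : ∀ y ∈ C, ∀ z ∈ C, ∀ u, geodesic y z u ∈ C

theorem StronglyConvex.geodesic_spec {A : Set X} (hA : StronglyConvex A) :
    ContinuousOn (fun q : X × X => geodesic q.1 q.2) (A ×ˢ A) ∧
      ∀ y ∈ A, ∀ z ∈ A, IsShortestPath (geodesic y z) y z ∧ ∀ u, geodesic y z u ∈ A := by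
  obtain ⟨Γ, hΓ, h⟩ := hA
  have heq : ∀ y (hy : y ∈ A) z (hz : z ∈ A), geodesic y z = Γ (⟨y, hy⟩, ⟨z, hz⟩) :=
    fun y hy z hz => geodesic_eq (h (⟨y, hy⟩, ⟨z, hz⟩)).1 (h (⟨y, hy⟩, ⟨z, hz⟩)).2.2
  constructor
  · rw [continuousOn_iff_continuous_domRestrict]
    have : (A ×ˢ A).domRestrict (fun q : X × X => geodesic q.1 q.2) =
        fun q : ↥(A ×ˢ A) => Γ (⟨q.1.1, q.2.1⟩, ⟨q.1.2, q.2.2⟩) :=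
      funext fun q => heq _ q.2.1 _ q.2.2
    rw [this]
    exact hΓ.comp (by fun_prop)
  · intro y hy z hz
    rw [heq y hy z hz]
    exact ⟨(h (⟨y, hy⟩, ⟨z, hz⟩)).1, (h (⟨y, hy⟩, ⟨z, hz⟩)).2.1⟩

theorem exists_stronglyConvex_of_lt_convRadius {v : X} {a : ℝ}
    (h : ENNReal.ofReal a < convRadius v) :
    ∃ a' > a, ∀ a'' ∈ Ioc a a', 0 < a'' → StronglyConvex (ball v a'') := by
  obtain ⟨d, hd, had⟩ := lt_sSup_iff.1 h
  obtain ⟨a', ha0, ha, had'⟩ := ENNReal.lt_iff_exists_real_btwn.1 had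
  exact ⟨a', (ENNReal.ofReal_lt_ofReal_iff').1 ha |>.1, fun a'' ha'' h0 =>
    hd a'' h0 ((ENNReal.ofReal_le_ofReal ha''.2).trans had'.le)⟩

/-- The strict inequality leaves room for strongly convex open balls of all radii slightly above
`a`. Their intersection is the closed ball, so geodesics cannot leave it. -/
theorem isGeodesicallyClosed_closedBall {v : X} {a : ℝ} (h : ENNReal.ofReal a < convRadius v) :
    IsGeodesicallyClosed (closedBall v a) := by
  obtain ha | ha := lt_or_ge a 0
  · rw [closedBall_eq_empty.2 ha]
    exact ⟨isClosed_empty, by simp, by simp, by simp⟩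
  obtain ⟨a', ha', hconv⟩ := exists_stronglyConvex_of_lt_convRadius h
  have hs := (hconv a' ⟨ha', le_rfl⟩ (ha.trans_lt ha')).geodesic_spec
  have hsub := closedBall_subset_ball (x := v) ha'
  refine ⟨isClosed_closedBall, hs.1.mono (prod_mono hsub hsub),
    fun y hy z hz => (hs.2 y (hsub hy) z (hsub hz)).1, fun y hy z hz u => ?_⟩
  rw [mem_closedBall]
  refine le_of_forall_gt_imp_ge_of_dense fun b hb => ?_
  have hb' : a < min b a' := lt_min hb ha'
  have hsub' := closedBall_subset_ball (x := v) hb'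
  have := ((hconv _ ⟨hb', min_le_right _ _⟩ (ha.trans_lt hb')).geodesic_spec.2 y (hsub' hy) z
    (hsub' hz)).2 u
  exact (mem_ball.1 this).le.trans (min_le_left _ _)

theorem IsGeodesicallyClosed.iInter {ι : Type v} [Nonempty ι] {C : ι → Set X}
    (h : ∀ i, IsGeodesicallyClosed (C i)) : IsGeodesicallyClosed (⋂ i, C i) := by
  obtain ⟨i₀⟩ := ‹Nonempty ι›
  refine ⟨isClosed_iInter fun i => (h i).isClosed,
    (h i₀).continuousOn.mono (prod_mono (iInter_subset _ _) (iInter_subset _ _)),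
    fun y hy z hz => (h i₀).isShortest y (mem_iInter.1 hy _) z (mem_iInter.1 hz _),
    fun y hy z hz u => mem_iInter.2 fun i =>
      (h i).maps y (mem_iInter.1 hy _) z (mem_iInter.1 hz _) u⟩

/-- Every set is star-shaped about the common point `z`. Shortest paths are unique in the whole
space, so the contractions of the single sets agree on overlaps, and they glue continuously because
the sets are closed and finite in number. -/
theorem contracts_iUnion {ι : Type v} [Finite ι] [Nonempty ι] {C : ι → Set X} {z : X}
    (h : ∀ i, IsGeodesicallyClosed (C i)) (hz : ∀ i, z ∈ C i) :
    Contracts (⋃ i, C i) z fun y u => geodesic z y u := by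
  obtain ⟨i₀⟩ := ‹Nonempty ι›
  refine ⟨mem_iUnion.2 ⟨i₀, hz i₀⟩, ?_, ?_, ?_, ?_⟩
  · rw [iUnion_prod_const]
    refine (locallyFinite_of_finite _).continuousOn_iUnion
      (fun i => (h i).isClosed.prod isClosed_univ) fun i => ?_
    have h1 : ContinuousOn (fun q : X × unitInterval => (geodesic z q.1, q.2))
        (C i ×ˢ univ) :=
      ((h i).continuousOn.comp (f := fun q : X × unitInterval => (z, q.1)) (by fun_prop)
        fun q hq => ⟨hz i, hq.1⟩).prodMk continuousOn_snd
    exact (ContinuousEval.continuous_eval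
      (F := C(unitInterval, X))).comp_continuousOn h1
  · intro y hy u
    obtain ⟨i, hi⟩ := mem_iUnion.1 hy
    exact mem_iUnion.2 ⟨i, (h i).maps z (hz i) y hi u⟩
  · intro y hy
    obtain ⟨i, hi⟩ := mem_iUnion.1 hy
    exact ((h i).isShortest z (hz i) y hi).1
  · intro y hy
    obtain ⟨i, hi⟩ := mem_iUnion.1 hy
    exact ((h i).isShortest z (hz i) y hi).2.1

end Geodesic

/-! ### Compositions and sums of chain maps and homotopies -/

section Homotopies

variable {S : ℕ → Type u} {T : ℕ → Type v} {U : ℕ → Type w}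
variable {face : ∀ n, Fin (n + 2) → S (n + 1) → S n}
variable {face' : ∀ n, Fin (n + 2) → T (n + 1) → T n}
variable {face'' : ∀ n, Fin (n + 2) → U (n + 1) → U n}

theorem IsHomotopyOn.comp {A : ∀ n, Set (S n)} {A' : ∀ n, Set (T n)}
    {f g : ∀ n, (T n →₀ ℤ) →ₗ[ℤ] (U n →₀ ℤ)} {D : ∀ n, (T n →₀ ℤ) →ₗ[ℤ] (U (n + 1) →₀ ℤ)}
    {s : ∀ n, (S n →₀ ℤ) →ₗ[ℤ] (T n →₀ ℤ)} (hD : IsHomotopyOn face' face'' A' f g D)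
    (hs : IsChainMapOn face face' A s) (hs' : MapsChains A A' s) :
    IsHomotopyOn face face'' A (fun n => f n ∘ₗ s n) (fun n => g n ∘ₗ s n)
      (fun n => D n ∘ₗ s n) := by
  refine ⟨fun z hz => hD.zero _ (hs' 0 z hz), fun n z hz => ?_⟩
  have := hD.succ n _ (hs' (n + 1) z hz)
  rwa [hs n z hz] at this

theorem IsHomotopyOn.add {A : ∀ n, Set (S n)} {f g h : ∀ n, (S n →₀ ℤ) →ₗ[ℤ] (T n →₀ ℤ)}
    {D D' : ∀ n, (S n →₀ ℤ) →ₗ[ℤ] (T (n + 1) →₀ ℤ)} (hD : IsHomotopyOn face face' A f g D)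
    (hD' : IsHomotopyOn face face' A g h D') :
    IsHomotopyOn face face' A f h (fun n => D n + D' n) := by
  refine ⟨fun z hz => ?_, fun n z hz => ?_⟩
  · rw [LinearMap.add_apply, map_add, hD.zero z hz, hD'.zero z hz, sub_add_sub_cancel]
  · rw [LinearMap.add_apply, LinearMap.add_apply, map_add, add_add_add_comm, hD.succ n z hz,
      hD'.succ n z hz, sub_add_sub_cancel]

theorem IsChainMapOn.comp {A : ∀ n, Set (S n)} {A' : ∀ n, Set (T n)}
    {f : ∀ n, (T n →₀ ℤ) →ₗ[ℤ] (U n →₀ ℤ)} {s : ∀ n, (S n →₀ ℤ) →ₗ[ℤ] (T n →₀ ℤ)}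
    (hf : IsChainMapOn face' face'' A' f) (hs : IsChainMapOn face face' A s)
    (hs' : MapsChains A A' s) : IsChainMapOn face face'' A (fun n => f n ∘ₗ s n) :=
  fun n z hz => by
    rw [LinearMap.comp_apply, hf n _ (hs' _ z hz), hs n z hz, LinearMap.comp_apply]

theorem augmentation_map_of_isAugmented {A : ∀ n, Set (S n)}
    {f : ∀ n, (S n →₀ ℤ) →ₗ[ℤ] (T n →₀ ℤ)} (hf : IsAugmented A f) {z : S 0 →₀ ℤ}
    (hz : z ∈ Finsupp.supported ℤ ℤ (A 0)) :
    augmentation (T 0) (f 0 z) = augmentation (S 0) z :=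
  map_eq_of_single (f := augmentation (T 0) ∘ₗ f 0) (fun σ hσ => by simp [hf σ hσ]) hz

theorem IsAugmented.comp {A : ∀ n, Set (S n)} {A' : ∀ n, Set (T n)}
    {f : ∀ n, (T n →₀ ℤ) →ₗ[ℤ] (U n →₀ ℤ)} {s : ∀ n, (S n →₀ ℤ) →ₗ[ℤ] (T n →₀ ℤ)}
    (hf : IsAugmented A' f) (hs : IsAugmented A s) (hs' : MapsChains A A' s) :
    IsAugmented A (fun n => f n ∘ₗ s n) := fun σ hσ => by
  rw [LinearMap.comp_apply, augmentation_map_of_isAugmented hf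
    (hs' 0 _ (single_mem_supported hσ)), hs σ hσ]

end Homotopies

/-! ### Ordered simplices of Čech complexes and flags -/

section Flags

variable {X : Type u}

theorem faceClosed_orderedIn (L : PreAbstractSimplicialComplex X) :
    FaceClosed (tupleFace X) (orderedIn L) :=
  fun _ _ ⟨σ, hσ, hv⟩ _ => ⟨σ, hσ, fun _ => hv _⟩

/-- Tuples of faces of `L` that are pairwise comparable: the ordered simplices of the barycentric
subdivision. -/
def flagsIn (L : PreAbstractSimplicialComplex X) (n : ℕ) : Set (Tuple (Finset X) n) :=
  {w | (∀ i, w i ∈ L.faces) ∧ ∀ i j, w i ⊆ w j ∨ w j ⊆ w i}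

theorem faceClosed_flagsIn (L : PreAbstractSimplicialComplex X) :
    FaceClosed (tupleFace (Finset X)) (flagsIn L) :=
  fun _ _ hw _ => ⟨fun _ => hw.1 _, fun _ _ => hw.2 _ _⟩

variable {L : PreAbstractSimplicialComplex X} {n : ℕ} {w : Tuple (Finset X) n}

theorem exists_min_of_mem_flagsIn (hw : w ∈ flagsIn L n) : ∃ i, ∀ j, w i ⊆ w j := by
  obtain ⟨i, -, hi⟩ := Finset.exists_min_image Finset.univ (fun i => (w i).card)
    Finset.univ_nonempty
  refine ⟨i, fun j => (hw.2 i j).elim id fun h => ?_⟩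
  rw [Finset.eq_of_subset_of_card_le h (hi j (Finset.mem_univ j))]

theorem exists_max_of_mem_flagsIn (hw : w ∈ flagsIn L n) : ∃ i, ∀ j, w j ⊆ w i := by
  obtain ⟨i, -, hi⟩ := Finset.exists_max_image Finset.univ (fun i => (w i).card)
    Finset.univ_nonempty
  refine ⟨i, fun j => (hw.2 j i).elim id fun h => ?_⟩
  rw [Finset.eq_of_subset_of_card_le h (hi j (Finset.mem_univ j))]

/-- The flags of faces with vertices in a given tuple. -/
def flagsOver (L : PreAbstractSimplicialComplex X) (m : ℕ) (v : Tuple X m) (n : ℕ) :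
    Set (Tuple (Finset X) n) :=
  {w | w ∈ flagsIn L n ∧ ∀ i, ∀ y ∈ w i, y ∈ range v}

-- The set of all entries of `v` is itself a face and contains every member of every flag over `v`;
-- it serves as the apex of a cone.
open Classical in
theorem isAcyclicCarrier_flagsOver (L : PreAbstractSimplicialComplex X) :
    IsAcyclicCarrier (tupleFace X) (tupleFace (Finset X)) (orderedIn L) (flagsOver L) := by
  refine ⟨faceClosed_orderedIn L, fun n v _ i k w hw => ⟨hw.1, fun j y hy => ?_⟩, ?_⟩
  · obtain ⟨l, rfl⟩ := hw.2 j y hy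
    exact ⟨_, rfl⟩
  · rintro n v ⟨σ, hσ, hv⟩
    have hmem : Finset.univ.image v ∈ L.faces :=
      (L.isRelLowerSet_faces hσ).2 (by
        intro y hy
        obtain ⟨i, -, rfl⟩ := Finset.mem_image.1 hy
        exact hv i) (Finset.univ_nonempty.image v)
    refine isAcyclic_of_cone (Finset.univ.image v)
      ⟨⟨fun _ => hmem, fun _ _ => Or.inl subset_rfl⟩, fun _ y hy => by simpa using hy⟩
      fun k w hw => ?_
    have hsub : ∀ i, w i ⊆ Finset.univ.image v := fun i y hy => by simpa using hw.2 i y hy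
    refine ⟨⟨Fin.cases hmem hw.1.1, fun i j => ?_⟩, Fin.cases (fun y hy => by simpa using hy) hw.2⟩
    refine Fin.cases ?_ (fun i => ?_) i <;> refine Fin.cases ?_ (fun j => ?_) j
    · exact Or.inl subset_rfl
    · exact Or.inr (hsub j)
    · exact Or.inl (hsub i)
    · exact hw.1.2 i j

/-- A vertex of a face. -/
def someVertex [Nonempty X] (σ : Finset X) : X := by
  classical exact if h : σ.Nonempty then h.choose else Classical.arbitrary X

theorem someVertex_mem [Nonempty X] {σ : Finset X} (h : σ.Nonempty) : someVertex σ ∈ σ := by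
  rw [someVertex, dif_pos h]
  exact h.choose_spec

theorem isCarried_tupleMap_someVertex [Nonempty X] {s : ∀ n, (Tuple X n →₀ ℤ) →ₗ[ℤ]
    (Tuple (Finset X) n →₀ ℤ)} (hs : IsCarried (orderedIn L) (flagsOver L) s) :
    IsCarried (orderedIn L) (fun _ v => tuplesIn (range v))
      (fun n => tupleMap someVertex n ∘ₗ s n) := fun n v hv =>
  map_mem_of_single (f := tupleMap someVertex n) (fun w hw => by
    rw [tupleMap_single]
    exact single_mem_supported fun i => hw.2 i _
      (someVertex_mem (L.isRelLowerSet_faces (hw.1.1 i)).1)) (hs n v hv)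

/-- This carrier serves to compare the identity with subdivision followed by a choice of vertices:
both keep a simplex within its own vertices. -/
theorem isAcyclicCarrier_tuplesIn_range (L : PreAbstractSimplicialComplex X) :
    IsAcyclicCarrier (tupleFace X) (tupleFace X) (orderedIn L)
      (fun _ v => tuplesIn (range v)) := by
  refine ⟨faceClosed_orderedIn L, fun n v _ i k τ hτ j => ?_, fun n v _ => ?_⟩
  · obtain ⟨l, hl⟩ := hτ j
    exact ⟨_, hl⟩
  · exact isAcyclic_of_cone (v 0) (fun _ => ⟨0, rfl⟩) fun k τ hτ => Fin.cases ⟨0, rfl⟩ hτ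

theorem isAugmented_tupleMap {V : Type u} {W : Type v} (φ : V → W) (A : ∀ n, Set (Tuple V n)) :
    IsAugmented A (tupleMap φ) := fun v _ => by simp

theorem isAugmented_id {S : ℕ → Type u} (A : ∀ n, Set (S n)) :
    IsAugmented A (fun _ => LinearMap.id) := fun v _ => by simp

end Flags

/-! ### Realization of Čech complexes by singular chains -/

section Cech

variable {X : Type u} [MetricSpace X]

open Classical in
theorem mem_orderedIn_cech {P : Set X} {a : ℝ} {n : ℕ} {v : Tuple X n} :
    v ∈ orderedIn (cech P a) n ↔ (∀ i, v i ∈ P) ∧ ∃ y, ∀ i, y ∈ closedBall (v i) a := by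
  constructor
  · rintro ⟨σ, ⟨-, hσ, y, hy⟩, hv⟩
    exact ⟨fun i => hσ _ (hv i), y, fun i => hy _ (hv i)⟩
  · rintro ⟨hv, y, hy⟩
    refine ⟨Finset.univ.image v, ⟨Finset.univ_nonempty.image v, ?_, y, ?_⟩,
      fun i => Finset.mem_image_of_mem v (Finset.mem_univ i)⟩
    · intro x hx
      obtain ⟨i, -, rfl⟩ := Finset.mem_image.1 hx
      exact hv i
    · intro x hx
      obtain ⟨i, -, rfl⟩ := Finset.mem_image.1 hx
      exact hy i

/-- The common points of the balls of some member of a flag. -/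
def flagBall (a : ℝ) {n : ℕ} (w : Tuple (Finset X) n) : Set X :=
  ⋃ i, ⋂ v : w i, closedBall (v : X) a

theorem mem_flagBall {a : ℝ} {n : ℕ} {w : Tuple (Finset X) n} {y : X} :
    y ∈ flagBall a w ↔ ∃ i, ∀ v ∈ w i, y ∈ closedBall v a := by
  simp [flagBall]

theorem flagBall_face_subset (a : ℝ) {n : ℕ} (w : Tuple (Finset X) (n + 1)) (i : Fin (n + 2)) :
    flagBall a (tupleFace (Finset X) n i w) ⊆ flagBall a w := by
  intro y hy
  obtain ⟨j, hj⟩ := mem_flagBall.1 hy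
  exact mem_flagBall.2 ⟨_, hj⟩

/-- Larger members of a flag have smaller intersections of balls. A common point of the balls of the
largest member therefore lies in all the intersections, and their union contracts to it. -/
theorem isAcyclicCarrier_flagBall {P : Set X} {a δ : ℝ} (hδ : 0 < δ)
    (hP : ∀ v ∈ P, ENNReal.ofReal a < convRadius v) :
    IsAcyclicCarrier (tupleFace (Finset X)) singularFace (flagsIn (cech P a))
      (fun _ w => smallIn δ (flagBall a w)) := by
  refine ⟨faceClosed_flagsIn _, fun n w _ i k => smallIn_mono δ (flagBall_face_subset a w i) k,
    fun n w hw => isAcyclic_smallIn hδ ?_⟩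
  obtain ⟨m, hm⟩ := exists_max_of_mem_flagsIn hw
  obtain ⟨-, -, z, hz⟩ := hw.1 m
  refine Contracts.isAcyclic (contracts_iUnion (z := z) (fun i => ?_) fun i =>
    mem_iInter.2 fun v => hz v (hm i v.2))
  have hne : Nonempty (w i) := (hw.1 i).1.to_subtype
  exact IsGeodesicallyClosed.iInter fun v =>
    isGeodesicallyClosed_closedBall (hP v ((hw.1 i).2.1 v v.2))

theorem isAcyclic_smallIn_iUnion_closedBall {P : Set X} {a δ : ℝ} (hδ : 0 < δ)
    (hP : ∀ v ∈ P, ENNReal.ofReal a < convRadius v) {n : ℕ} {v : Tuple X n}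
    (hv : v ∈ orderedIn (cech P a) n) :
    IsAcyclic singularFace (smallIn δ (⋃ i, closedBall (v i) a)) := by
  obtain ⟨hvP, z, hz⟩ := mem_orderedIn_cech.1 hv
  exact isAcyclic_smallIn hδ (contracts_iUnion (fun i =>
    isGeodesicallyClosed_closedBall (hP _ (hvP i))) hz).isAcyclic

/-- The chain map to ordered chains that maps a singular simplex to the images of its vertices. -/
def vertexMap (q : X → X) (n : ℕ) : (SingularSimplex X n →₀ ℤ) →ₗ[ℤ] (Tuple X n →₀ ℤ) :=
  Finsupp.lmapDomain ℤ ℤ fun σ i => q (σ (stdSimplex.vertex i))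

@[simp]
theorem vertexMap_single (q : X → X) (n : ℕ) (σ : SingularSimplex X n) :
    vertexMap q n (Finsupp.single σ 1) =
      Finsupp.single (fun i => q (σ (stdSimplex.vertex i)) : Tuple X n) 1 := by
  simp [vertexMap]

theorem bd_vertexMap (q : X → X) (n : ℕ) (z : SingularSimplex X (n + 1) →₀ ℤ) :
    bd (tupleFace X) n (vertexMap q (n + 1) z) = vertexMap q n (bd singularFace n z) := by
  suffices H : bd (tupleFace X) n ∘ₗ vertexMap q (n + 1) = vertexMap q n ∘ₗ bd singularFace n from
    LinearMap.congr_fun H z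
  refine linearMap_ext_single fun σ => ?_
  simp only [LinearMap.comp_apply, vertexMap_single, boundary_single, map_sum, map_smul]
  refine Finset.sum_congr rfl fun i _ => ?_
  congr 2
  funext k
  simp [orderedFace, singularFace]

/-- Tuples in `P` whose balls of radius `b` meet in a point near some entry of a given tuple. -/
def nearTuples (P : Set X) (a b : ℝ) (m : ℕ) (v : Tuple X m) (n : ℕ) : Set (Tuple X n) :=
  {τ | (∀ j, τ j ∈ P) ∧ ∃ i, ∃ y ∈ closedBall (v i) a, ∀ j, y ∈ closedBall (τ j) b}

/-- Tuples in `P` whose balls of radius `b` meet in a common point of the balls of radius `a` of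
some member of a flag. -/
def nearFlagTuples (P : Set X) (a b : ℝ) (m : ℕ) (w : Tuple (Finset X) m) (n : ℕ) :
    Set (Tuple X n) :=
  {τ | (∀ j, τ j ∈ P) ∧ ∃ y ∈ flagBall a w, ∀ j, y ∈ closedBall (τ j) b}

/-- A vertex of the smallest member belongs to all members, so its ball contains the whole
`flagBall`. It can be added to any nearby tuple without changing the witness `y`, which makes it the
apex of a cone. -/
theorem isAcyclicCarrier_nearFlagTuples {P : Set X} {a b : ℝ} (hab : a ≤ b) :
    IsAcyclicCarrier (tupleFace (Finset X)) (tupleFace X) (flagsIn (cech P a))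
      (nearFlagTuples P a b) := by
  refine ⟨faceClosed_flagsIn _, fun n w _ i k τ ⟨hτ, y, hy, hy'⟩ =>
    ⟨hτ, y, flagBall_face_subset a w i hy, hy'⟩, fun n w hw => ?_⟩
  obtain ⟨m, hm⟩ := exists_min_of_mem_flagsIn hw
  obtain ⟨⟨v, hv⟩, hP, z, hz⟩ := hw.1 m
  refine isAcyclic_of_cone v ⟨fun _ => hP v hv, z, mem_flagBall.2 ⟨m, hz⟩,
    fun _ => closedBall_subset_closedBall hab (hz v hv)⟩ fun k τ ⟨hτ, y, hy, hy'⟩ =>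
    ⟨Fin.cases (hP v hv) hτ, y, hy, Fin.cases ?_ hy'⟩
  obtain ⟨i, hi⟩ := mem_flagBall.1 hy
  exact closedBall_subset_closedBall hab (hi v (hm i hv))

/-- A chain map from the ordered chains of a Čech complex to the singular chains of the union of
the balls. Following it by a map to nearby sample points is homotopic to the inclusion. -/
theorem exists_cech_realization {P : Set X} {a δ : ℝ} (hδ : 0 < δ)
    (hP : ∀ v ∈ P, ENNReal.ofReal a < convRadius v) :
    ∃ g : ∀ n, (Tuple X n →₀ ℤ) →ₗ[ℤ] (SingularSimplex X n →₀ ℤ),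
      IsChainMapOn (tupleFace X) singularFace (orderedIn (cech P a)) g ∧
      IsCarried (orderedIn (cech P a)) (fun _ v => smallIn δ (⋃ i, closedBall (v i) a)) g ∧
      IsAugmented (orderedIn (cech P a)) g ∧
      ∀ (q : X → X) (b : ℝ), a ≤ b →
        (∀ v ∈ P, ∀ z ∈ closedBall v a, q z ∈ P ∧ dist z (q z) ≤ b - δ) →
        ∃ D, IsHomotopyOn (tupleFace X) (tupleFace X) (orderedIn (cech P a))
            (fun n => vertexMap q n ∘ₗ g n) (fun _ => LinearMap.id) D ∧
          IsCarriedSucc (orderedIn (cech P a)) (nearTuples P a b) D := by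
  obtain hX | hX := isEmpty_or_nonempty X
  -- Choosing vertices of faces needs a point, so the empty space is treated apart; there are no
  -- simplices in it.
  · have h0 : ∀ n, orderedIn (cech P a) n = ∅ := fun n =>
      eq_empty_of_forall_notMem fun v _ => hX.elim (v 0)
    refine ⟨fun _ => 0, fun n z _ => by simp, fun n v _ => hX.elim (v 0), fun v _ => hX.elim (v 0),
      fun q b _ _ => ⟨fun _ => 0, ⟨fun z hz => ?_, fun n z hz => ?_⟩, fun n v _ => hX.elim (v 0)⟩⟩
    all_goals
      rw [h0] at hz
      have hz0 : z = 0 := by simpa using hz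
      simp [hz0]
  obtain ⟨s, hs1, hs2, hs3⟩ := exists_carried_chainMap faceIdentity_tuple
    (isAcyclicCarrier_flagsOver (cech P a))
  obtain ⟨f, hf1, hf2, hf3⟩ := exists_carried_chainMap faceIdentity_tuple
    (isAcyclicCarrier_flagBall hδ hP)
  have hs4 : MapsChains (orderedIn (cech P a)) (flagsIn (cech P a)) s :=
    hs2.mapsChains (fun _ _ h => h) fun _ _ _ _ h => h.1
  refine ⟨fun n => f n ∘ₗ s n, hf1.comp hs1 hs4, fun n v hv => ?_, hf3.comp hs3 hs4,
    fun q b hab hq => ?_⟩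
  · refine map_mem_of_single (fun w hw => Finsupp.supported_mono ?_ (hf2 n w hw.1)) (hs2 n v hv)
    refine smallIn_mono δ (fun y hy => ?_) n
    obtain ⟨i, hi⟩ := mem_flagBall.1 hy
    obtain ⟨x, hx⟩ := (hw.1.1 i).1
    obtain ⟨j, rfl⟩ := hw.2 i x hx
    exact mem_iUnion.2 ⟨j, hi _ hx⟩
  · have h1 : IsCarried (flagsIn (cech P a)) (nearFlagTuples P a b)
        (fun n => vertexMap q n ∘ₗ f n) := fun n w hw => by
      refine map_mem_of_single (f := vertexMap q n) (fun σ hσ => ?_) (hf2 n w hw)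
      have hσ' : ∀ t, q (σ t) ∈ P ∧ dist (σ t) (q (σ t)) ≤ b - δ := fun t => by
        obtain ⟨i, hi⟩ := mem_flagBall.1 (hσ.1 t)
        obtain ⟨x, hx⟩ := (hw.1 i).1
        exact hq x ((hw.1 i).2.1 x hx) _ (hi x hx)
      rw [vertexMap_single]
      refine single_mem_supported ⟨fun j => (hσ' _).1, σ (stdSimplex.vertex 0), hσ.1 _,
        fun j => mem_closedBall.2 ?_⟩
      -- The margin `δ` left by `q` pays for the diameter of `σ`, so one point of `σ` lies in all
      -- the balls of radius `b`.
      have := dist_triangle (σ (stdSimplex.vertex 0)) (σ (stdSimplex.vertex j))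
        (q (σ (stdSimplex.vertex j)))
      linarith [hσ.2 (stdSimplex.vertex 0) (stdSimplex.vertex j), (hσ' (stdSimplex.vertex j)).2]
    have h2 : IsCarried (flagsIn (cech P a)) (nearFlagTuples P a b) (tupleMap someVertex) := by
      intro n w hw
      have hmem : ∀ i, someVertex (w i) ∈ w i := fun i => someVertex_mem (hw.1 i).1
      obtain ⟨m, hm⟩ := exists_max_of_mem_flagsIn hw
      obtain ⟨-, -, z, hz⟩ := hw.1 m
      rw [tupleMap_single]
      exact single_mem_supported ⟨fun j => (hw.1 j).2.1 _ (hmem j), z, mem_flagBall.2 ⟨m, hz⟩,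
        fun j => closedBall_subset_closedBall hab (hz _ (hm j (hmem j)))⟩
    -- The homotopy has two stages. On flags, the points given by `q` are exchanged for a chosen
    -- vertex of each member; then the chosen vertices of the subdivided simplex are compared with
    -- the simplex itself.
    obtain ⟨D, hD, hD'⟩ := exists_carried_homotopy faceIdentity_tuple
      (isAcyclicCarrier_nearFlagTuples hab)
      (IsChainMapOn.comp (A' := fun _ => univ) (fun n z _ => bd_vertexMap q n z) hf1
        fun _ _ _ => by simp)
      (fun n z _ => bd_tupleMap someVertex n z) h1 h2
      (IsAugmented.comp (A' := fun _ => univ) (fun σ _ => by simp) hf3 fun _ _ _ => by simp)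
      (isAugmented_tupleMap _ _)
    obtain ⟨D', hE, hE'⟩ := exists_carried_homotopy faceIdentity_tuple
      (isAcyclicCarrier_tuplesIn_range (cech P a))
      (IsChainMapOn.comp (A' := flagsIn (cech P a)) (fun n z _ => bd_tupleMap someVertex n z)
        hs1 hs4) (fun _ _ _ => rfl) (isCarried_tupleMap_someVertex hs2)
      (fun n v _ => single_mem_supported fun i => ⟨i, rfl⟩)
      ((isAugmented_tupleMap _ (flagsIn (cech P a))).comp hs3 hs4) (isAugmented_id _)
    refine ⟨_, (hD.comp hs1 hs4).add hE, fun n v hv => ?_⟩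
    refine add_mem (map_mem_of_single (fun w hw => Finsupp.supported_mono ?_ (hD' n w hw.1))
      (hs2 n v hv)) (Finsupp.supported_mono ?_ (hE' n v hv))
    · rintro τ ⟨hτ, y, hy, hy'⟩
      obtain ⟨i, hi⟩ := mem_flagBall.1 hy
      obtain ⟨x, hx⟩ := (hw.1.1 i).1
      obtain ⟨j, rfl⟩ := hw.2 i x hx
      exact ⟨hτ, j, y, hi _ hx, hy'⟩
    · intro τ hτ
      obtain ⟨hvP, y, hy⟩ := mem_orderedIn_cech.1 hv
      refine ⟨fun j => ?_, 0, y, hy 0, fun j => ?_⟩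
      · obtain ⟨i, hi⟩ := hτ j
        exact hi ▸ hvP i
      · obtain ⟨i, hi⟩ := hτ j
        exact hi ▸ closedBall_subset_closedBall hab (hy i)

end Cech

/-! ### Interleaving pairs of sets with pairs of complexes -/

section Interleaving

variable {X : Type u} [MetricSpace X]

theorem smallIn_closedBall_subset {Q Y : Set X} {a δ : ℝ}
    (hY : ∀ v ∈ Q, closedBall v a ⊆ Y) {n : ℕ} {v : Tuple X n} (hv : v ∈ orderedIn (cech Q a) n)
    (k : ℕ) : smallIn δ (⋃ i, closedBall (v i) a) k ⊆ smallIn δ Y k :=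
  smallIn_mono δ (iUnion_subset fun i => hY _ ((mem_orderedIn_cech.1 hv).1 i)) k

theorem orderedIn_cech_mono {P Q : Set X} (h : Q ⊆ P) (a : ℝ) (n : ℕ) :
    orderedIn (cech Q a) n ⊆ orderedIn (cech P a) n :=
  orderedIn_mono (cech_mono h le_rfl) n

/-- The vertices of small simplices have nearby sample points that span Čech simplices. -/
theorem vertexMap_mem_cech {Q Y : Set X} {a δ : ℝ} {q : X → X}
    (hq : ∀ z ∈ Y, q z ∈ Q ∧ dist z (q z) ≤ a - δ) {n : ℕ} {σ : SingularSimplex X n}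
    (hσ : σ ∈ smallIn δ Y n) :
    (fun i => q (σ (stdSimplex.vertex i)) : Tuple X n) ∈ orderedIn (cech Q a) n ∧
      ∀ t i, σ t ∈ closedBall (q (σ (stdSimplex.vertex i))) a := by
  have h : ∀ t i, σ t ∈ closedBall (q (σ (stdSimplex.vertex i))) a := fun t i => by
    rw [mem_closedBall]
    have := dist_triangle (σ t) (σ (stdSimplex.vertex i)) (q (σ (stdSimplex.vertex i)))
    linarith [hσ.2 t (stdSimplex.vertex i), (hq _ (hσ.1 (stdSimplex.vertex i))).2]
  exact ⟨mem_orderedIn_cech.2 ⟨fun i => (hq _ (hσ.1 _)).1, σ (stdSimplex.vertex 0), h _⟩, h⟩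

theorem isPairMap_vertexMap {Q Q' Y Z : Set X} {a δ : ℝ} {q : X → X}
    {L N : PreAbstractSimplicialComplex X} (hL : (cech Q a).faces ⊆ L.faces)
    (hN : (cech Q' a).faces ⊆ N.faces) (hY : ∀ z ∈ Y, q z ∈ Q ∧ dist z (q z) ≤ a - δ)
    (hZ : ∀ z ∈ Z, q z ∈ Q' ∧ dist z (q z) ≤ a - δ) :
    IsPairMap singularFace (tupleFace X) (smallIn δ Y) (smallIn δ Z) (orderedIn L) (orderedIn N)
      (vertexMap q) := by
  refine ⟨fun n z _ => bd_vertexMap q n z, fun n z hz => map_mem_of_single (fun σ hσ => ?_) hz,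
    fun n z hz => map_mem_of_single (fun σ hσ => ?_) hz⟩
  · rw [vertexMap_single]
    exact single_mem_supported (orderedIn_mono hL n (vertexMap_mem_cech hY hσ).1)
  · rw [vertexMap_single]
    exact single_mem_supported (orderedIn_mono hN n (vertexMap_mem_cech hZ hσ).1)

theorem isPairMap_realization {P Q Y Z : Set X} {a δ : ℝ} (hQ : Q ⊆ P)
    {L N : PreAbstractSimplicialComplex X} (hL : L.faces ⊆ (cech P a).faces)
    (hN : N.faces ⊆ (cech Q a).faces) (hY : ∀ v ∈ P, closedBall v a ⊆ Y)
    (hZ : ∀ v ∈ Q, closedBall v a ⊆ Z)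
    {g : ∀ n, (Tuple X n →₀ ℤ) →ₗ[ℤ] (SingularSimplex X n →₀ ℤ)}
    (hg : IsChainMapOn (tupleFace X) singularFace (orderedIn (cech P a)) g)
    (hg' : IsCarried (orderedIn (cech P a)) (fun _ v => smallIn δ (⋃ i, closedBall (v i) a)) g) :
    IsPairMap (tupleFace X) singularFace (orderedIn L) (orderedIn N) (smallIn δ Y) (smallIn δ Z)
      g :=
  ⟨fun n z hz => hg n z (Finsupp.supported_mono (orderedIn_mono hL _) hz),
    hg'.mapsChains (orderedIn_mono hL) fun n _ hv =>
      smallIn_closedBall_subset hY (orderedIn_mono hL n hv) n,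
    hg'.mapsChains (fun n _ hv => orderedIn_cech_mono hQ a n (orderedIn_mono hN n hv))
      fun n _ hv => smallIn_closedBall_subset hZ (orderedIn_mono hN n hv) n⟩

/-- Passing from small simplices to Čech simplices and back is homotopic to the inclusion. -/
theorem exists_homotopy_realization_vertexMap {P Y : Set X} {a b δ : ℝ} (hδ : 0 < δ) (hab : a ≤ b)
    (hP : ∀ v ∈ P, ENNReal.ofReal b < convRadius v) {q : X → X}
    (hY : ∀ z ∈ Y, q z ∈ P ∧ dist z (q z) ≤ a - δ)
    {g : ∀ n, (Tuple X n →₀ ℤ) →ₗ[ℤ] (SingularSimplex X n →₀ ℤ)}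
    (hg : IsChainMapOn (tupleFace X) singularFace (orderedIn (cech P b)) g)
    (hg' : IsCarried (orderedIn (cech P b)) (fun _ v => smallIn δ (⋃ i, closedBall (v i) b)) g)
    (hg'' : IsAugmented (orderedIn (cech P b)) g) :
    ∃ D, IsHomotopyOn singularFace singularFace (smallIn δ Y) (fun n => g n ∘ₗ vertexMap q n)
        (fun _ => LinearMap.id) D ∧
      IsCarriedSucc (smallIn δ Y) (fun _ σ => smallIn δ
        (⋃ i, closedBall (q (σ (stdSimplex.vertex i))) b)) D := by
  have hv : ∀ n, ∀ σ ∈ smallIn δ Y n,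
      (fun i => q (σ (stdSimplex.vertex i)) : Tuple X n) ∈ orderedIn (cech P b) n :=
    fun n σ hσ => orderedIn_mono (cech_mono subset_rfl hab) n (vertexMap_mem_cech hY hσ).1
  have hmaps : MapsChains (smallIn δ Y) (orderedIn (cech P b)) (vertexMap q) := fun n z hz =>
    map_mem_of_single (fun σ hσ => by
      rw [vertexMap_single]
      exact single_mem_supported (hv n σ hσ)) hz
  -- The carrier of `σ` is the union of the balls around the sample points assigned to its vertices.
  -- It is acyclic since these points span a Čech simplex, and it contains `σ` itself since `σ` is
  -- small.
  refine exists_carried_homotopy faceIdentity_singular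
    ⟨(isHereditary_smallIn δ Y).faceClosed, fun n σ _ i k => ?_,
      fun n σ hσ => isAcyclic_smallIn_iUnion_closedBall hδ hP (hv n σ hσ)⟩
    (hg.comp (fun n z _ => bd_vertexMap q n z) hmaps) (fun _ _ _ => rfl) (fun n σ hσ => ?_)
    (fun n σ hσ => single_mem_supported ⟨fun t => mem_iUnion.2 ⟨0, closedBall_subset_closedBall hab
      ((vertexMap_mem_cech hY hσ).2 t 0)⟩, hσ.2⟩)
    (hg''.comp (fun σ _ => by simp) hmaps) (isAugmented_id _)
  · refine smallIn_mono δ (iUnion_subset fun j => ?_) k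
    have : singularFace n i σ (stdSimplex.vertex j) = σ (stdSimplex.vertex (i.succAbove j)) := by
      simp [singularFace]
    rw [this]
    exact subset_iUnion (fun j => closedBall (q (σ (stdSimplex.vertex j))) b) _
  · rw [LinearMap.comp_apply, vertexMap_single]
    exact hg' n _ (hv n σ hσ)

/-- The balls that carry the homotopy lie in `Y'`, and in `Z'` for simplices of `Z`, so it is a
homotopy of maps of pairs. -/
theorem inducedMap_realization_vertexMap {P Q Y Z Y' Z' : Set X} {a b δ : ℝ} (hδ : 0 < δ)
    (hab : a ≤ b) (hP : ∀ v ∈ P, ENNReal.ofReal b < convRadius v) {q : X → X}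
    (hY : ∀ z ∈ Y, q z ∈ P ∧ dist z (q z) ≤ a - δ) (hZ : ∀ z ∈ Z, q z ∈ Q)
    (hYY' : Y ⊆ Y') (hZY : Z ⊆ Y) (hZZ' : Z ⊆ Z') (hY' : ∀ v ∈ P, closedBall v b ⊆ Y')
    (hZ' : ∀ v ∈ Q, closedBall v b ⊆ Z') {L N : PreAbstractSimplicialComplex X}
    {g : ∀ n, (Tuple X n →₀ ℤ) →ₗ[ℤ] (SingularSimplex X n →₀ ℤ)}
    (hg : IsChainMapOn (tupleFace X) singularFace (orderedIn (cech P b)) g)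
    (hg' : IsCarried (orderedIn (cech P b)) (fun _ v => smallIn δ (⋃ i, closedBall (v i) b)) g)
    (hg'' : IsAugmented (orderedIn (cech P b)) g)
    (h₁ : IsPairMap singularFace (tupleFace X) (smallIn δ Y) (smallIn δ Z) (orderedIn L)
      (orderedIn N) (vertexMap q))
    (h₂ : IsPairMap (tupleFace X) singularFace (orderedIn L) (orderedIn N) (smallIn δ Y')
      (smallIn δ Z') g) (n : ℕ) :
    inducedMap h₂ n ∘ₗ inducedMap h₁ n =
      relMap (smallIn_mono δ hYY') (smallIn_mono δ hZZ') n := by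
  obtain ⟨D, hD, hD'⟩ := exists_homotopy_realization_vertexMap hδ hab hP hY hg hg' hg''
  rw [← inducedMap_comp, ← inducedMap_id (smallIn_mono δ hYY') (smallIn_mono δ hZZ')]
  refine inducedMap_eq_of_homotopy _ _ hD (hD'.mapsChainsSucc (fun _ _ h => h) fun n σ hσ => ?_)
    (hD'.mapsChainsSucc (fun n => smallIn_mono δ hZY n) fun n σ hσ => ?_) n
  · exact smallIn_mono δ (iUnion_subset fun i => hY' _ (hY _ (hσ.1 _)).1) _
  · exact smallIn_mono δ (iUnion_subset fun i => hZ' _ (hZ _ (hσ.1 _))) _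

/-- If pairs of sets and pairs of complexes are interleaved, then the image of the homology of the
first pair of complexes in that of the second one is the homology of the middle pair of sets. -/
theorem nonempty_range_equiv {P Q₁ Q₂ YA ZA YM ZM YE ZE : Set X} {a₀ a₁ a₂ a₃ δ : ℝ} {q : X → X}
    {L₁ N₁ L₂ N₂ : PreAbstractSimplicialComplex X} (hδ : 0 < δ) (h01 : a₀ ≤ a₁) (h12 : a₁ ≤ a₂)
    (h23 : a₂ ≤ a₃) (hP : ∀ v ∈ P, ENNReal.ofReal a₃ < convRadius v) (hQ₁ : Q₁ ⊆ P) (hQ₂ : Q₂ ⊆ P)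
    (hL₁ : (cech P a₀).faces ⊆ L₁.faces) (hL₁' : L₁.faces ⊆ (cech P a₁).faces)
    (hN₁ : (cech Q₁ a₀).faces ⊆ N₁.faces) (hN₁' : N₁.faces ⊆ (cech Q₁ a₁).faces)
    (hL₂ : (cech P a₂).faces ⊆ L₂.faces) (hL₂' : L₂.faces ⊆ (cech P a₃).faces)
    (hN₂ : (cech Q₂ a₂).faces ⊆ N₂.faces) (hN₂' : N₂.faces ⊆ (cech Q₂ a₃).faces)
    (hYA : ∀ z ∈ YA, q z ∈ P ∧ dist z (q z) ≤ a₀ - δ) (hZA : ∀ z ∈ ZA, q z ∈ Q₁)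
    (hYM : ∀ z ∈ YM, q z ∈ P ∧ dist z (q z) ≤ a₂ - δ) (hZM : ∀ z ∈ ZM, q z ∈ Q₂)
    (hPM : ∀ v ∈ P, closedBall v a₁ ⊆ YM) (hQM : ∀ v ∈ Q₁, closedBall v a₁ ⊆ ZM)
    (hPE : ∀ v ∈ P, closedBall v a₃ ⊆ YE) (hQE : ∀ v ∈ Q₂, closedBall v a₃ ⊆ ZE)
    (hnear : ∀ v ∈ Q₁, ∀ y ∈ closedBall v a₁, ∀ τ ∈ P, y ∈ closedBall τ a₂ → τ ∈ Q₂)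
    (hAM : YA ⊆ YM) (hAM' : ZA ⊆ ZM) (hME : YM ⊆ YE) (hME' : ZM ⊆ ZE) (hZYA : ZA ⊆ YA)
    (hZYM : ZM ⊆ YM) (hL : L₁.faces ⊆ L₂.faces) (hN : N₁.faces ⊆ N₂.faces) (n : ℕ)
    (hsurj : Function.Surjective (singularMap hAM hAM' n))
    (hinj : Function.Injective (singularMap hME hME' n)) :
    Nonempty (LinearMap.range (simplicialMap hL hN n) ≃ₗ[ℤ] SingularHomology YM ZM n) := by
  have hP₁ : ∀ v ∈ P, ENNReal.ofReal a₁ < convRadius v := fun v hv =>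
    (ENNReal.ofReal_le_ofReal (h12.trans h23)).trans_lt (hP v hv)
  obtain ⟨g, hg, hg', hg'', hgq⟩ := exists_cech_realization hδ hP₁
  obtain ⟨k, hk, hk', hk'', -⟩ := exists_cech_realization hδ hP
  have p₁ := isPairMap_vertexMap hL₁ hN₁ hYA fun z hz => ⟨hZA z hz, (hYA z (hZYA hz)).2⟩
  have p₂ := isPairMap_realization hQ₁ hL₁' hN₁' hPM hQM hg hg'
  have p₃ := isPairMap_vertexMap hL₂ hN₂ hYM fun z hz => ⟨hZM z hz, (hYM z (hZYM hz)).2⟩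
  have p₄ := isPairMap_realization hQ₂ hL₂' hN₂' hPE hQE hk hk'
  have e₁ := inducedMap_realization_vertexMap hδ h01 hP₁ hYA hZA hAM hZYA hAM' hPM hQM
    hg hg' hg'' p₁ p₂ n
  have e₂ := inducedMap_realization_vertexMap hδ h23 hP hYM hZM hME hZYM hME' hPE hQE
    hk hk' hk'' p₃ p₄ n
  have e₃ : inducedMap p₃ n ∘ₗ inducedMap p₂ n = simplicialMap hL hN n := by
    obtain ⟨D, hD, hD'⟩ := hgq q a₂ h12 fun v hv z hz => hYM z (hPM v hv hz)
    rw [← inducedMap_comp]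
    refine (inducedMap_eq_of_homotopy (p₃.comp p₂)
      (IsPairMap.id_of_subset (orderedIn_mono hL) (orderedIn_mono hN))
      (D := D) ⟨fun z hz => hD.zero z (Finsupp.supported_mono (orderedIn_mono hL₁' _) hz),
        fun m z hz => hD.succ m z (Finsupp.supported_mono (orderedIn_mono hL₁' _) hz)⟩
      (hD'.mapsChainsSucc (fun m => orderedIn_mono hL₁' m) fun m v hv => ?_)
      (hD'.mapsChainsSucc (fun m _ hv => orderedIn_cech_mono hQ₁ a₁ m (orderedIn_mono hN₁' m hv))
        fun m v hv => ?_) n).trans (inducedMap_id _ _ n)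
    · rintro τ ⟨hτ, -, y, -, hy⟩
      exact orderedIn_mono hL₂ _ (mem_orderedIn_cech.2 ⟨hτ, y, hy⟩)
    -- Here `hnear` keeps the homotopy inside the second complex of the pair.
    · rintro τ ⟨hτ, i, y, hy, hy'⟩
      have hv' := (mem_orderedIn_cech.1 (orderedIn_mono hN₁' m hv)).1 i
      exact orderedIn_mono hN₂ _ (mem_orderedIn_cech.2
        ⟨fun j => hnear _ hv' y hy _ (hτ j) (hy' j), y, hy'⟩)
  have bA := relMap_smallIn_bijective hδ YA ZA n
  have bM := relMap_smallIn_bijective hδ YM ZM n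
  have bE := relMap_smallIn_bijective hδ YE ZE n
  have sq₁ : ∀ z, relMap (face := singularFace) (smallIn_subset δ YM) (smallIn_subset δ ZM) n
      (relMap (smallIn_mono δ hAM) (smallIn_mono δ hAM') n z) = singularMap hAM hAM' n
        (relMap (smallIn_subset δ YA) (smallIn_subset δ ZA) n z) := by
    intro z
    obtain ⟨z, rfl⟩ := Submodule.Quotient.mk_surjective _ z
    rfl
  have sq₂ : ∀ z, relMap (face := singularFace) (smallIn_subset δ YE) (smallIn_subset δ ZE) n
      (relMap (smallIn_mono δ hME) (smallIn_mono δ hME') n z) = singularMap hME hME' n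
        (relMap (smallIn_subset δ YM) (smallIn_subset δ ZM) n z) := by
    intro z
    obtain ⟨z, rfl⟩ := Submodule.Quotient.mk_surjective _ z
    rfl
  -- The composite with `p₁` is the inclusion of the first pair of sets into the middle one, which
  -- is onto in homology.
  have hsurj' : Function.Surjective (inducedMap p₂ n) := by
    intro y
    obtain ⟨x, hx⟩ := hsurj (relMap (smallIn_subset δ YM) (smallIn_subset δ ZM) n y)
    obtain ⟨x, rfl⟩ := bA.2 x
    refine ⟨inducedMap p₁ n x, ?_⟩
    have := LinearMap.congr_fun e₁ x
    rw [LinearMap.comp_apply] at this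
    rw [this]
    exact bM.1 ((sq₁ x).trans hx)
  -- Following `p₃` by `p₄` gives the inclusion of the middle pair of sets into the last one, which
  -- is injective in homology.
  have hinj' : Function.Injective (inducedMap p₃ n) := by
    refine Function.Injective.of_comp (f := inducedMap p₄ n) ?_
    rw [← LinearMap.coe_comp, e₂]
    intro x y hxy
    refine bM.1 (hinj ?_)
    rw [← sq₂, ← sq₂, hxy]
  rw [← e₃, LinearMap.range_comp_of_range_eq_top _ (LinearMap.range_eq_top.2 hsurj')]
  exact ⟨(LinearEquiv.ofInjective _ hinj').symm.trans (LinearEquiv.ofBijective _ bM)⟩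

end Interleaving

/-! ### Vietoris-Rips complexes in Čech complexes -/

section Rips

variable {X : Type u} [MetricSpace X]

theorem cech_subset_rips (Q : Set X) (a : ℝ) : (cech Q a).faces ⊆ (rips Q a).faces := by
  rintro σ ⟨h0, hQ, y, hy⟩
  exact ⟨h0, hQ, fun v hv w hw => ⟨y, hy v hv, hy w hw⟩⟩

/-- Each vertex of a Rips simplex is within `2a` of all the others and so witnesses the common
intersection. -/
theorem rips_subset_cech_two_mul (Q : Set X) (a : ℝ) :
    (rips Q a).faces ⊆ (cech Q (2 * a)).faces := by
  rintro σ ⟨⟨v, hv⟩, hQ, h⟩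
  refine ⟨⟨v, hv⟩, hQ, v, fun w hw => ?_⟩
  obtain ⟨y, hy, hy'⟩ := h v hv w hw
  rw [mem_closedBall] at *
  linarith [dist_triangle_left v w y]

/-- A weak form of Jung's theorem: a finite set of diameter `d` in a Euclidean space is contained
in a closed ball of radius `d / √2`. -/
theorem exists_forall_dist_sq_le {E : Type u} [NormedAddCommGroup E] [InnerProductSpace ℝ E]
    [ProperSpace E] {σ : Finset E} (hσ : σ.Nonempty) {d : ℝ}
    (h : ∀ v ∈ σ, ∀ w ∈ σ, dist v w ≤ d) : ∃ y, ∀ v ∈ σ, 2 * dist y v ^ 2 ≤ d ^ 2 := by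
  let f : E → ℝ := fun y => σ.sup' hσ fun v => dist y v
  have hf : Continuous f := by
    refine Continuous.finset_sup'_apply hσ fun v _ => ?_
    fun_prop
  obtain ⟨v₀, hv₀⟩ := id hσ
  have hlim : Tendsto f (cocompact E) atTop :=
    tendsto_atTop_mono (fun y => Finset.le_sup' (fun v => dist y v) hv₀)
      (tendsto_dist_right_cocompact_atTop v₀)
  -- The point `c` is the center of a smallest enclosing ball, and `v` is a point of `σ` at maximal
  -- distance from it.
  obtain ⟨c, hc⟩ := hf.exists_forall_le hlim
  obtain ⟨v, hv, hvc⟩ := Finset.exists_mem_eq_sup' hσ fun v => dist c v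
  have hle : ∀ w ∈ σ, dist c w ≤ dist c v := fun w hw => by
    rw [← hvc]
    exact Finset.le_sup' (fun v => dist c v) hw
  suffices H : 2 * dist c v ^ 2 ≤ d ^ 2 from
    ⟨c, fun w hw => le_trans (by gcongr; exact hle w hw) H⟩
  obtain hr | hr := (dist_nonneg (x := c) (y := v)).eq_or_lt
  · rw [← hr]
    nlinarith [sq_nonneg d]
  -- Otherwise all farthest points make an acute angle with `v` at `c`, and a small move of `c`
  -- towards `v` would bring it closer than the radius to all of `σ`.
  obtain ⟨w, hw, hwr, hin⟩ : ∃ w ∈ σ, dist c w = dist c v ∧ inner ℝ (w - c) (v - c) ≤ 0 := by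
    by_contra! hcon
    have hev : ∀ w ∈ σ, ∀ᶠ s : ℝ in 𝓝[>] 0, dist (c + s • (v - c)) w < dist c v := by
      intro w hw
      obtain hlt | heq := (hle w hw).lt_or_eq
      · have hcont : Continuous fun s : ℝ => dist (c + s • (v - c)) w := by fun_prop
        have := hcont.tendsto 0
        simp only [zero_smul, add_zero] at this
        exact (this.eventually_lt_const hlt).filter_mono nhdsWithin_le_nhds
      · have hpos := hcon w hw heq
        have hvc0 : 0 < ‖v - c‖ ^ 2 := by
          rw [dist_comm, dist_eq_norm] at hr
          positivity
        have hsm : ∀ᶠ s : ℝ in 𝓝[>] 0, s < 2 * inner ℝ (w - c) (v - c) / ‖v - c‖ ^ 2 :=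
          (eventually_lt_nhds (by positivity)).filter_mono nhdsWithin_le_nhds
        filter_upwards [hsm, self_mem_nhdsWithin] with s hs hs0
        have hs0' : 0 < s := hs0
        rw [lt_div_iff₀ hvc0] at hs
        rw [← heq]
        refine lt_of_pow_lt_pow_left₀ 2 dist_nonneg ?_
        rw [dist_comm _ w, dist_comm c w, dist_eq_norm, dist_eq_norm, ← sub_sub,
          norm_sub_sq_real, norm_smul, inner_smul_right, mul_pow, Real.norm_eq_abs, sq_abs]
        nlinarith
    have := (Finset.eventually_all σ).2 hev
    obtain ⟨s, hs⟩ := this.exists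
    have h1 : f (c + s • (v - c)) < f c := by
      rw [show f c = dist c v from hvc]
      exact (Finset.sup'_lt_iff _).2 hs
    exact absurd (hc _) (not_le.2 h1)
  -- Law of cosines: two sides equal to the radius at an angle that is not acute give an opposite
  -- side of square at least twice the squared radius.
  have h2 := norm_sub_sq_real (w - c) (v - c)
  rw [sub_sub_sub_cancel_right, ← dist_eq_norm, ← dist_eq_norm, ← dist_eq_norm, dist_comm w c,
    dist_comm v c, hwr] at h2
  have h3 : dist w v ^ 2 ≤ d ^ 2 := by
    gcongr
    exact h w hw v hv
  linarith

theorem rips_subset_cech_sqrt_two_mul {n : ℕ} (e : X ≃ᵢ EuclideanSpace ℝ (Fin n)) (Q : Set X)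
    (a : ℝ) : (rips Q a).faces ⊆ (cech Q (√2 * a)).faces := by
  classical
  rintro σ ⟨hσ, hQ, h⟩
  have ha : 0 ≤ a := by
    obtain ⟨v, hv⟩ := hσ
    obtain ⟨y, hy, -⟩ := h v hv v hv
    exact dist_nonneg.trans (mem_closedBall.1 hy)
  obtain ⟨y, hy⟩ := exists_forall_dist_sq_le (hσ.image e) (d := 2 * a) (by
    intro v' hv' w' hw'
    obtain ⟨v, hv, rfl⟩ := Finset.mem_image.1 hv'
    obtain ⟨w, hw, rfl⟩ := Finset.mem_image.1 hw'
    obtain ⟨y, hy, hy'⟩ := h v hv w hw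
    rw [e.dist_eq]
    rw [mem_closedBall] at hy hy'
    linarith [dist_triangle_left v w y])
  refine ⟨hσ, hQ, e.symm y, fun v hv => ?_⟩
  have := hy (e v) (Finset.mem_image_of_mem e hv)
  rw [mem_closedBall, ← e.dist_eq, e.apply_symm_apply]
  refine (pow_le_pow_iff_left₀ dist_nonneg (by positivity) two_ne_zero).1 ?_
  rw [mul_pow, Real.sq_sqrt zero_le_two]
  linarith

theorem rips_subset_cech_ripsConst (Q : Set X) (a : ℝ) :
    (rips Q a).faces ⊆ (cech Q (ripsConst X * a)).faces := by
  rw [ripsConst]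
  split_ifs with h
  · obtain ⟨n, ⟨e⟩⟩ := h
    exact rips_subset_cech_sqrt_two_mul e Q a
  · exact rips_subset_cech_two_mul Q a

theorem one_le_ripsConst : 1 ≤ ripsConst X := by
  rw [ripsConst]
  split_ifs
  · exact Real.one_le_sqrt.2 one_le_two
  · exact one_le_two

end Rips

/-! ### Isomorphisms provided by strong seemliness -/

section Seemly

variable {X : Type u}

theorem singularMap_singularMap [TopologicalSpace X] {A B A' B' A'' B'' : Set X} (hA : A ⊆ A')
    (hB : B ⊆ B') (hA' : A' ⊆ A'') (hB' : B' ⊆ B'') (n : ℕ) (z : SingularHomology A B n) :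
    singularMap hA' hB' n (singularMap hA hB n z) =
      singularMap (hA.trans hA') (hB.trans hB') n z := by
  obtain ⟨z, rfl⟩ := Submodule.Quotient.mk_surjective _ z
  rfl

theorem singularMap_self [TopologicalSpace X] {A B : Set X} (hA : A ⊆ A) (hB : B ⊆ B) (n : ℕ)
    (z : SingularHomology A B n) : singularMap hA hB n z = z := by
  obtain ⟨z, rfl⟩ := Submodule.Quotient.mk_surjective _ z
  rfl

variable [MetricSpace X] {K : Set X} {𝒮 : Set (Set X)} {x : X}

/-- When `r = R` and `α = ε` the map `j` is the identity, and the condition on `j ∘ i` says that `i`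
is bijective. -/
theorem IsAdmissible.mapF_bijective {e b : ℝ} (h : IsAdmissible K 𝒮 x e b b e) (n : ℕ) :
    Function.Bijective (mapF K x h.nonneg (le_refl b) n) := by
  have hid : mapF K x h.le_alpha h.le_R n = LinearMap.id :=
    LinearMap.ext fun z => singularMap_self _ _ n z
  have h1 := h.injective n
  have h2 := h.range_eq n
  rw [hid, LinearMap.id_comp] at h1 h2
  exact ⟨h1, LinearMap.range_eq_top.1 (by rw [h2, LinearMap.range_id])⟩

/-- The map factors as F(0, R) → F(0, b) → F(e, b): the first factor is a local isomorphism of `K`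
at `x`, the second is bijective by admissibility of `b` at scale `e`. -/
theorem IsAdmissible.mapF_comp_bijective {e b R α : ℝ} (hR : IsAdmissible K 𝒮 x α R R α)
    (h : IsAdmissible K 𝒮 x e b b e) (hb : b ≤ R) (n : ℕ) :
    Function.Bijective (mapF K x h.nonneg hb n) := by
  obtain ⟨⟨hA, hB, h1⟩, -⟩ := hR.localIso b ⟨h.nonneg.trans_lt h.alpha_lt, hb⟩
  have := (h.mapF_bijective n).comp (h1 n)
  convert! this using 1
  funext z
  exact (singularMap_singularMap _ _ _ _ n z).symm

theorem IsAdmissible.nonempty_equiv {e b R α : ℝ} (hR : IsAdmissible K 𝒮 x α R R α)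
    (h : IsAdmissible K 𝒮 x e b b e) (hb : b ≤ R) (n : ℕ) :
    Nonempty (F K x e b n ≃ₗ[ℤ] SingularHomology K (K \ {x}) n) := by
  obtain ⟨-, ⟨hA, hB, h1⟩⟩ := hR.localIso b ⟨h.nonneg.trans_lt h.alpha_lt, hb⟩
  exact ⟨(LinearEquiv.ofBijective _ (h.mapF_bijective n)).symm.trans
    (LinearEquiv.ofBijective _ (h1 n))⟩

theorem injective_of_bijective_mapF {e₁ e₂ R b r : ℝ} (h0 : 0 ≤ e₁) (h1 : e₁ ≤ e₂) (hbR : b ≤ R)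
    (hrb : r ≤ b) (n : ℕ) (hM : Function.Bijective (mapF K x h0 hbR n))
    (hE : Function.Bijective (mapF K x (h0.trans h1) (hrb.trans hbR) n)) :
    Function.Injective (mapF K x h1 hrb n) := by
  intro y z hyz
  obtain ⟨y, rfl⟩ := hM.2 y
  obtain ⟨z, rfl⟩ := hM.2 z
  rw [mapF, mapF, singularMap_singularMap, singularMap_singularMap] at hyz
  rw [hE.1 hyz]

variable {εx : ℝ} {αl αu : ℝ → ℝ} {ρl ρu : ℝ → ℝ → ℝ}

theorem IsStronglySeemly.mem_scaleDomain (h : IsStronglySeemly K 𝒮 x εx αl αu ρl ρu) {β : ℝ}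
    (hβ : β ∈ Icc 0 εx) : (β, β) ∈ scaleDomain εx αl αu :=
  ⟨hβ, (h.αl_eq β hβ).le, hβ.2.trans (h.αu_eq β hβ).ge⟩

theorem IsStronglySeemly.diagBound_lower_mono (h : IsStronglySeemly K 𝒮 x εx αl αu ρl ρu)
    {β β' : ℝ} (h0 : 0 ≤ β) (hle : β ≤ β') (hβ' : β' ≤ εx) : diagBound ρl β ≤ diagBound ρl β' :=
  h.ρl_mono (h.mem_scaleDomain ⟨h0, hle.trans hβ'⟩) (h.mem_scaleDomain ⟨h0.trans hle, hβ'⟩)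
    ⟨hle, hle⟩

theorem IsStronglySeemly.diagBound_upper_anti (h : IsStronglySeemly K 𝒮 x εx αl αu ρl ρu)
    {β β' : ℝ} (h0 : 0 ≤ β) (hle : β ≤ β') (hβ' : β' ≤ εx) : diagBound ρu β' ≤ diagBound ρu β :=
  h.ρu_anti (h.mem_scaleDomain ⟨h0, hle.trans hβ'⟩) (h.mem_scaleDomain ⟨h0.trans hle, hβ'⟩)
    ⟨hle, hle⟩

/-- All radii between the lower and the upper bound at scale `β` are admissible for all scales
up to `β`. -/
theorem IsStronglySeemly.isAdmissible (h : IsStronglySeemly K 𝒮 x εx αl αu ρl ρu) {e β ρ : ℝ}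
    (h0 : 0 < e) (hle : e ≤ β) (hβ : β ≤ εx) (hl : diagBound ρl β ≤ ρ)
    (hu : ρ ≤ diagBound ρu β) : IsAdmissible K 𝒮 x e ρ ρ e :=
  -- By monotonicity the interval of radii at `(e, e)` contains the one at `(β, β)`. Positivity of
  -- `e` matters, since admissibility is only granted for positive scales.
  h.admissible (e, e) (h.mem_scaleDomain ⟨h0.le, hle.trans hβ⟩) h0 ρ
    ⟨(h.diagBound_lower_mono h0.le hle hβ).trans hl, hu.trans (h.diagBound_upper_anti h0.le hle hβ)⟩

end Seemly

/-! ### Distances between the sample and the set -/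

section Sample

theorem noiseConst_nonneg {X : Type u} {K P : Set X} : 0 ≤ noiseConst K P := by
  rw [noiseConst]
  split_ifs <;> norm_num

variable {X : Type u} [MetricSpace X] {K P : Set X}

/-- In the noise-free case `p` lies in `K`, so its closest point is `p` itself. -/
theorem IsBasePoint.dist_le {ε : ℝ} {p x : X} (hx : IsBasePoint K P ε p x) (hp : p ∈ P) :
    dist x p ≤ noiseConst K P * ε := by
  rw [noiseConst]
  split_ifs with h
  · have := hx.2.1 h p (h hp)
    rw [dist_self] at this
    rw [dist_comm, zero_mul]
    exact this
  · rw [one_mul]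
    exact (hx.2.2 h).le

theorem IsSample.exists_mem_dist_le {ε : ℝ} (h : IsSample K P ε) {v : X} (hv : v ∈ P) :
    ∃ y ∈ K, dist v y ≤ noiseConst K P * ε := by
  rw [noiseConst]
  split_ifs with hPK
  · exact ⟨v, hPK hv, by simp⟩
  · have h2 := h.2
    rw [hausdorffEDist_comm] at h2
    obtain ⟨y, hy, hvy⟩ := exists_edist_lt_of_hausdorffEDist_lt hv h2
    rw [edist_lt_ofReal] at hvy
    exact ⟨y, hy, by linarith⟩

theorem IsSample.closedBall_subset {ε a : ℝ} (h : IsSample K P ε) {v : X} (hv : v ∈ P) :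
    closedBall v a ⊆ cthickening (a + noiseConst K P * ε) K := by
  intro z hz
  obtain ⟨y, hy, hvy⟩ := h.exists_mem_dist_le hv
  exact mem_cthickening_of_dist_le z y _ K hy ((dist_triangle z v y).trans
    (add_le_add (mem_closedBall.1 hz) hvy))

/-- A choice of sample points near all points, with a margin. -/
theorem IsSample.exists_nearby {ε : ℝ} (h : IsSample K P ε) (hK : IsCompact K)
    (hne : K.Nonempty) :
    ∃ δ > 0, ∃ q : X → X, ∀ z, q z ∈ P ∧
      ∀ e, 0 ≤ e → z ∈ cthickening e K → dist z (q z) ≤ e + ε - δ := by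
  -- The strict bound on the Hausdorff distance holds for some `ε₀ < ε` as well; the margin `δ` is
  -- `ε - ε₀`.
  obtain ⟨ε₀, h0, h1, h2⟩ := ENNReal.lt_iff_exists_real_btwn.1 h.2
  have hlt : ε₀ < ε := (ENNReal.ofReal_lt_ofReal_iff'.1 h2).1
  have hq : ∀ z, ∃ v ∈ P, dist z v ≤ infDist z K + ε₀ := by
    intro z
    obtain ⟨y, hy, hzy⟩ := hK.exists_infDist_eq_dist hne z
    obtain ⟨v, hv, hyv⟩ := exists_edist_lt_of_hausdorffEDist_lt hy h1
    rw [edist_lt_ofReal] at hyv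
    exact ⟨v, hv, by linarith [dist_triangle z y v]⟩
  choose q hq hq' using hq
  refine ⟨ε - ε₀, by linarith, q, fun z => ⟨hq z, fun e he hz => ?_⟩⟩
  rw [hK.cthickening_eq_biUnion_closedBall he] at hz
  obtain ⟨y, hy, hzy⟩ := mem_iUnion₂.1 hz
  linarith [hq' z, infDist_le_dist_of_mem (x := z) hy, mem_closedBall.1 hzy]

end Sample

/-- The interleaving of thickenings of `K` with complexes over a sample, for complexes `V Q a`
between the Čech complexes at scales `a` and `c a`. -/
theorem nonempty_range_equiv_local {X : Type u} [MetricSpace X] {K : Set X} (hK : IsCompact K)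
    {𝒮 : Set (Set X)} {P : Set X} {ε : ℝ} (hε : 0 < ε) (hP : IsSample K P ε) {p : X} (hp : p ∈ P)
    {x : X} (hx : IsBasePoint K P ε p x) {εx : ℝ} {αl αu : ℝ → ℝ} {ρl ρu : ℝ → ℝ → ℝ}
    (hseemly : IsStronglySeemly K 𝒮 x εx αl αu ρl ρu) {t c : ℝ} (ht : t = noiseConst K P)
    (hc : 1 ≤ c) (hconvP : ENNReal.ofReal (c * (1 + c + t) * ε) < convRadiusSet P)
    (V : Set X → ℝ → PreAbstractSimplicialComplex X)
    (hV : ∀ Q a, (cech Q a).faces ⊆ (V Q a).faces)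
    (hV' : ∀ Q a, (V Q a).faces ⊆ (cech Q (c * a)).faces) {β R' r' R r : ℝ}
    (hβ : β = (c ^ 2 + (t + 1) * c + t) * ε) (hβx : β ≤ εx) (hr' : diagBound ρl β ≤ r')
    (hR' : R' ≤ diagBound ρu β) (hrR : r' ≤ R' - (c ^ 2 + (3 + t) * c + 5 * t + 2) * ε)
    (hR : R = R' - (1 + t) * ε) (hr : r = r' + β)
    (h : (V P ε).faces ⊆ (V P ((1 + c + t) * ε)).faces)
    (h' : (V (P \ ball p R) ε).faces ⊆ (V (P \ ball p r) ((1 + c + t) * ε)).faces) (n : ℕ) :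
    Nonempty (LinearMap.range (simplicialMap h h' n) ≃ₗ[ℤ] SingularHomology K (K \ {x}) n) := by
  have ht0 : 0 ≤ t := ht ▸ noiseConst_nonneg
  have hc0 : 0 ≤ c := zero_le_one.trans hc
  have htε : 0 ≤ t * ε := by positivity
  have hctε : 0 ≤ c * t * ε := by positivity
  have hcε : ε ≤ c * ε := le_mul_of_one_le_left hε.le hc
  have hccε : c * ε ≤ c ^ 2 * ε := by nlinarith
  have hxp : dist x p ≤ t * ε := ht ▸ hx.dist_le hp
  obtain ⟨δ, hδ, q, hq⟩ := hP.exists_nearby hK ⟨x, hx.1⟩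
  -- Balls of radius `c ε` around sample points lie in the `e`-thickening of `K`.
  set e : ℝ := (c + t) * ε with he
  -- The shift is `(e + ε) + t ε`: passing to a nearby sample point costs `e + ε`, and exchanging
  -- the center `x` for `p` costs `t ε`.
  set b : ℝ := r + (1 + c + 2 * t) * ε with hb
  have he0 : 0 < e := by nlinarith
  have heβ : e ≤ β := by rw [he, hβ]; nlinarith
  have hrb : r' ≤ b := by rw [hb, hr]; nlinarith
  have hbR : b ≤ R' := by rw [hb, hr, hβ]; nlinarith
  have aR := hseemly.isAdmissible (he0.trans_le heβ) le_rfl hβx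
    (hr'.trans (hrb.trans hbR)) hR'
  have ab := hseemly.isAdmissible he0 heβ hβx (hr'.trans hrb) (hbR.trans hR')
  have ar := hseemly.isAdmissible (he0.trans_le heβ) le_rfl hβx hr' ((hrb.trans hbR).trans hR')
  have bM := aR.mapF_comp_bijective ab hbR n
  have bE := aR.mapF_comp_bijective ar (hrb.trans hbR) n
  have iME := injective_of_bijective_mapF he0.le heβ hbR hrb n bM bE
  obtain ⟨equiv⟩ := aR.nonempty_equiv ab hbR n
  have hdist : ∀ e', 0 ≤ e' → ∀ z ∈ cthickening e' K, q z ∈ P ∧ dist z (q z) ≤ e' + ε - δ :=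
    fun e' he' z hz => ⟨(hq z).1, (hq z).2 e' he' hz⟩
  have hdiff : ∀ e' ρ ρ', 0 ≤ e' → ρ' ≤ ρ - (e' + ε) - t * ε →
      ∀ z ∈ cthickening e' K \ ball x ρ, q z ∈ P \ ball p ρ' := by
    rintro e' ρ ρ' he' hρ z ⟨hz, hzx⟩
    refine ⟨(hq z).1, fun hzp => ?_⟩
    rw [mem_ball, not_lt] at hzx
    rw [mem_ball] at hzp
    have h1 := dist_triangle4 z (q z) p x
    rw [dist_comm p x] at h1
    linarith [(hq z).2 e' he' hz]
  have hball : ∀ a ρ ρ', ρ' ≤ ρ - a - t * ε → ∀ v ∈ P \ ball p ρ,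
      closedBall v a ⊆ cthickening (a + t * ε) K \ ball x ρ' := by
    rintro a ρ ρ' hρ v ⟨hv, hvp⟩ z hz
    refine ⟨ht ▸ hP.closedBall_subset hv hz, fun hzx => ?_⟩
    rw [mem_ball, not_lt] at hvp
    rw [mem_ball] at hzx
    rw [mem_closedBall, dist_comm] at hz
    linarith [dist_triangle4 v z x p]
  -- Going from `R'` to `R`, `b`, `r` and `r'`, the required losses of radius are `(1 + t) ε`, `(c +
  -- t) ε`, `(1 + c + 2t) ε` and `β`. Their sum is the constant in `hrR`. The last thickening has
  -- scale `c (1 + c + t) ε + t ε = β`.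
  have hmap := nonempty_range_equiv (P := P) (Q₁ := P \ ball p R) (Q₂ := P \ ball p r)
    (YA := cthickening 0 K) (ZA := cthickening 0 K \ ball x R') (YM := cthickening e K)
    (ZM := cthickening e K \ ball x b) (YE := cthickening β K) (ZE := cthickening β K \ ball x r')
    (a₀ := ε) (a₁ := c * ε) (a₂ := (1 + c + t) * ε) (a₃ := c * ((1 + c + t) * ε)) (q := q) hδ hcε
    (by nlinarith) (by nlinarith)
    (fun v hv => by
      rw [← mul_assoc]
      exact hconvP.trans_le (iInf₂_le v hv))
    sdiff_subset sdiff_subset (hV _ _) (hV' _ _) (hV _ _) (hV' _ _) (hV _ _) (hV' _ _) (hV _ _)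
    (hV' _ _)
    (fun z hz => by simpa using hdist 0 le_rfl z hz)
    (hdiff 0 R' R le_rfl (by rw [hR]; linarith))
    (fun z hz => by
      have := hdist e he0.le z hz
      exact ⟨this.1, this.2.trans (by rw [he]; linarith)⟩)
    (hdiff e b r he0.le (by rw [he, hb]; linarith))
    (fun v hv => by
      have := hP.closedBall_subset (a := c * ε) hv
      rwa [← ht, ← add_mul] at this)
    (by
      have := hball (c * ε) R b (by rw [hb, hr, hR, hβ]; linarith)
      rwa [← add_mul] at this)
    (fun v hv => by
      have := hP.closedBall_subset (a := c * ((1 + c + t) * ε)) hv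
      rwa [← ht, show c * ((1 + c + t) * ε) + t * ε = β by rw [hβ]; ring] at this)
    (by
      have := hball (c * ((1 + c + t) * ε)) r r' (by rw [hr, hβ]; linarith)
      rwa [show c * ((1 + c + t) * ε) + t * ε = β by rw [hβ]; ring] at this)
    -- Two overlapping balls of radii `c ε` and `(1 + c + t) ε` have centers at distance at most `(1
    -- + 2c + t) ε`, which does not exceed `R - r`.
    (by
      rintro v ⟨hv, hvp⟩ y hy τ hτ hyτ
      refine ⟨hτ, fun hτp => ?_⟩
      rw [mem_ball, not_lt] at hvp
      rw [mem_ball] at hτp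
      rw [mem_closedBall, dist_comm] at hy
      rw [mem_closedBall] at hyτ
      have := dist_triangle4 v y τ p
      rw [hr, hβ] at hτp
      rw [hR] at hvp
      linarith)
    (cthickening_mono he0.le K) (diff_ball_mono (cthickening_mono he0.le K) x hbR)
    (cthickening_mono heβ K) (diff_ball_mono (cthickening_mono heβ K) x hrb) sdiff_subset
    sdiff_subset h h' n bM.2 iME
  obtain ⟨equiv'⟩ := hmap
  exact ⟨equiv'.trans equiv⟩

end LocalHomology

end

/-! ### Conclusion: comparison of the constants -/

theorem mainTheorem10 {X : Type*} [MetricSpace X] [CompleteSpace X] [LocallyCompactSpace X]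
    (hmid : LocalHomology.HasMidpoints X) (hconv : LocalHomology.LocallyStronglyConvex X)
    (K : Set X) (hK : IsCompact K) (hret : LocalHomology.IsNeighborhoodRetract K)
    (𝒮 : Set (Set X)) (hstrat : LocalHomology.IsTameHomologyStratification K 𝒮)
    (P : Set X) (ε : ℝ) (hε : 0 < ε) (hP : LocalHomology.IsSample K P ε)
    (p : X) (hp : p ∈ P) (x : X) (hx : LocalHomology.IsBasePoint K P ε p x)
    (εx : ℝ) (αl αu : ℝ → ℝ) (ρl ρu : ℝ → ℝ → ℝ)
    (hseemly : LocalHomology.IsStronglySeemly K 𝒮 x εx αl αu ρl ρu)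
    (s t c : ℝ) (hs : s = LocalHomology.ripsConst X) (ht : t = LocalHomology.noiseConst K P)
    (hc : c = 1 ∨ c = s)
    (hconvP : ENNReal.ofReal (c * (1 + c + t) * ε) < LocalHomology.convRadiusSet P)
    (M m M₀ : ℝ) (hM : 0 < M) (hm : 0 < m)
    (hbound : ∀ β ∈ Set.Icc 0 εx, LocalHomology.diagBound ρl β ≤ M * β ^ m)
    (hM₀ : M₀ = LocalHomology.diagBound ρu εx)
    (hscale : (c ^ 2 + (t + 1) * c + t) * ε ≤ εx)
    (hmain : M * (c ^ 2 + (t + 1) * c + t) ^ m * ε ^ m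
      + (c ^ 2 + (3 + t) * c + 5 * t + 2) * ε < M₀) :
    (c ^ 2 + (t + 3) * c + 5 * t + 2) * ε <
      LocalHomology.diagBound ρu ((c ^ 2 + (t + 1) * c + t) * ε) -
        LocalHomology.diagBound ρl ((c ^ 2 + (t + 1) * c + t) * ε) ∧
    ∀ R' ∈ Set.Ioo (M * (c ^ 2 + (t + 1) * c + t) ^ m * ε ^ m
        + (c ^ 2 + (3 + t) * c + 5 * t + 2) * ε) M₀,
    ∀ r' ∈ Set.Ioo (M * (c ^ 2 + (t + 1) * c + t) ^ m * ε ^ m)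
        (R' - (c ^ 2 + (3 + t) * c + 5 * t + 2) * ε),
    ∀ R r : ℝ, R = R' - (1 + t) * ε → r = r' + (c ^ 2 + (t + 1) * c + t) * ε →
      ∃ (hscales : ε ≤ (1 + c + t) * ε) (hradii : r ≤ R),
        (c = 1 → ∀ ℓ : ℕ, Nonempty
          (LinearMap.range (LocalHomology.cechMap P p hscales hradii ℓ) ≃ₗ[ℤ]
            LocalHomology.SingularHomology K (K \ {x}) ℓ)) ∧
        (c = s → ∀ ℓ : ℕ, Nonempty
          (LinearMap.range (LocalHomology.ripsMap P p hscales hradii ℓ) ≃ₗ[ℤ]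
            LocalHomology.SingularHomology K (K \ {x}) ℓ)) := by
  have ht0 : 0 ≤ t := ht ▸ LocalHomology.noiseConst_nonneg
  have hc1 : 1 ≤ c := by
    obtain rfl | rfl := hc
    · exact le_rfl
    · exact hs ▸ LocalHomology.one_le_ripsConst
  have hc0 : 0 ≤ c := zero_le_one.trans hc1
  have hβ0 : 0 ≤ (c ^ 2 + (t + 1) * c + t) * ε := by positivity
  have hl : LocalHomology.diagBound ρl ((c ^ 2 + (t + 1) * c + t) * ε) ≤
      M * (c ^ 2 + (t + 1) * c + t) ^ m * ε ^ m := by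
    rw [mul_assoc, ← Real.mul_rpow (by positivity) hε.le]
    exact hbound _ ⟨hβ0, hscale⟩
  have hu : M₀ ≤ LocalHomology.diagBound ρu ((c ^ 2 + (t + 1) * c + t) * ε) :=
    hM₀ ▸ hseemly.diagBound_upper_anti hβ0 hscale le_rfl
  refine ⟨by linarith, fun R' hR' r' hr' R r hR hr => ?_⟩
  have hscales : ε ≤ (1 + c + t) * ε := le_mul_of_one_le_left hε.le (by linarith)
  have hradii : r ≤ R := by
    -- This is what remains of the gap `γ` between `r'` and `R'` after subtracting `(1 + t) ε` and
    -- `β`.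
    have : 0 ≤ (2 * c + 3 * t + 1) * ε := by positivity
    rw [hR, hr]
    linarith [hr'.2]
  refine ⟨hscales, hradii, fun hc' ℓ => ?_, fun hc' ℓ => ?_⟩
  · exact LocalHomology.nonempty_range_equiv_local hK hε hP hp hx hseemly ht hc1 hconvP
      LocalHomology.cech (fun _ _ => subset_rfl) (fun Q a => by rw [hc', one_mul]) rfl hscale
      (hl.trans hr'.1.le) (hR'.2.le.trans hu) hr'.2.le hR hr _ _ ℓ
  · exact LocalHomology.nonempty_range_equiv_local hK hε hP hp hx hseemly ht hc1 hconvP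
      LocalHomology.rips LocalHomology.cech_subset_rips
      (fun Q a => by rw [hc', hs]; exact LocalHomology.rips_subset_cech_ripsConst Q a) rfl hscale
      (hl.trans hr'.1.le) (hR'.2.le.trans hu) hr'.2.le hR hr _ _ ℓ
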